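/- **Notation.** Let $d\in\mathbb N$, $\langle\xi\rangle=(1+|\xi|^2)^{1/2}$ and $E_{x_0,M}(x)=e^{-|x-x_0|^2/(4M)}$ for $x_0\in\mathbb R^d$ and $M\in\{1,2,\dots\}$. Let $S^{1/2}_{1/2}(\mathbb R^d)$ be the Gelfand–Shilov space of all $\varphi\in C^\infty(\mathbb R^d)$ such that, for some $A,K>0$, $|x|^k\,\|D^n\varphi(x)\|\le K A^{k+n}k!^{1/2}n!^{1/2}$ for all $k,n\in\mathbb N_0$, $x\in\mathbb R^d$ (with its inductive limit topology), and let $(S^{1/2}_{1/2})'$ be its dual. A distribution $T\in\mathcal D'(\mathbb R^d)$ belongs to $(S^{1/2}_{1/2})'$ if there is $L\in(S^{1/2}_{1/2})'$ with $\langle T,\chi(\cdot/k)\varphi\rangle\to\langle L,\varphi\rangle$ as $k\to\infty$ for all $\varphi\in S^{1/2}_{1/2}$ and all $\chi\in C_c^\infty(\mathbb R^d)$ that equal $1$ near $0$; then $L$ is unique and one writes $\langle T,\varphi\rangle=\langle L,\varphi\rangle$. For $u\in\mathcal D'(\mathbb R^d)$, a *suitable extension* of $u$ at $x_0$ is a distribution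 $u^{rex}\in\mathcal D'(\mathbb R^d)\cap(S^{1/2}_{1/2})'$ that coincides with $u$ in some open ball around $x_0$. For $f\in\mathcal D'(\mathbb R^d)\cap(S^{1/2}_{1/2})'$ and $\xi_0\ne0$, the *$s$-estimate for $f$ at $(x_0,\xi_0)$* says that there are an open cone $\Gamma\ni\xi_0$, positive integers $v,N_0$ and $C>0$ such that $$|\langle f, E_{x_0,vN}\,e^{-i\langle\cdot,\xi\rangle}\rangle|\le\frac{C^{n+1}n^{sn}}{\langle\xi\rangle^n}\qquad(\xi\in\Gamma,\ 0\le n\le N,\ N>N_0),\qquad 0^0=1 .$$ * $WF_s(u)$ is the set of all $(x_0,\xi_0)\in\mathbb R^d\times(\mathbb R^d\setminus\{0\})$ for which no suitable extension $u^{rex}$ of $u$ at $x_0$ satisfies the $s$-estimate at $(x_0,\xi_0)$. * For a polynomial $P(\xi)=\sum_{|\alpha|\le m}a_\alpha\xi^\alpha$ with complex coefficients, of degree $m$, let $P(D)=\sum a_\alpha D^\alpha$, $D_j=-i\partial_j$, let $P_m=\sum_{|\alpha|=m}a_\alpha\xi^\alpha$, and let $\mathrm{Char}(P)=\{(x,\xi)\in\mathbb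 R^d\times(\mathbb R^d\setminus\{0\}):P_m(\xi)=0\}$ (everything, if $P=0$). * $WF(s,P,u)$ is the set of all $(x_0,\xi_0)\in\mathbb R^d\times(\mathbb R^d\setminus\{0\})$ for which there is no suitable extension $u^{rex}$ of $u$ at $x_0$ such that both the Fourier transform of $u^{rex}$ is a measurable function with $|\widehat{u^{rex}}(\xi)|\le C\langle\xi\rangle^l$ on $\mathbb R^d$ for some $C,l$, and $P(D)u^{rex}$ satisfies the $s$-estimate at $(x_0,\xi_0)$. **Theorem.** Let $P(D)$ be a differential operator with constant coefficients, $u\in\mathcal D'(\mathbb R^d)$ and $s\in[1/2,1)$. Then $$WF_s(P(D)u)\subset WF_s(u)\subset WF(s,P,u)\cup\mathrm{Char}(P).$$ -/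

import Mathlib

open Filter Topology
open scoped Distributions ContDiff Nat

noncomputable section

/-- `ℝᵈ` with its Euclidean norm. -/
abbrev Rd (d : ℕ) : Type := EuclideanSpace ℝ (Fin d)

/-- `𝒟'(ℝᵈ)`: complex-valued Schwartz distributions on `ℝᵈ`. -/
abbrev Distr (d : ℕ) : Type := 𝓓'((⊤ : TopologicalSpace.Opens (Rd d)), ℂ)

/-- `C_c^∞(ℝᵈ; 𝕜)`. -/
abbrev RealTest (d : ℕ) : Type := 𝓓((⊤ : TopologicalSpace.Opens (Rd d)), ℝ)
abbrev CplxTest (d : ℕ) : Type := 𝓓((⊤ : TopologicalSpace.Opens (Rd d)), ℂ)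

/-! ### The Gelfand–Shilov space `S^{1/2}_{1/2}(ℝᵈ)` -/

/-- `|x|^k ‖D^n g(x)‖ ≤ K A^{k+n} k!^{1/2} n!^{1/2}` for all `k, n, x`: the function `g` lies in the
step `S^{1/2,A}_{1/2,A}` of the inductive limit `S^{1/2}_{1/2}`, with norm at most `K`. -/
def GSBound {d : ℕ} (A K : ℝ) (g : Rd d → ℂ) : Prop :=
  ∀ (k n : ℕ) (x : Rd d),
    ‖x‖ ^ k * ‖iteratedFDeriv ℝ n g x‖ ≤ K * A ^ (k + n) * (√(k ! : ℝ) * √(n ! : ℝ))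

theorem GSBound.mono {d : ℕ} {A A' K K' : ℝ} {g : Rd d → ℂ} (h : GSBound A K g)
    (hA : 0 ≤ A) (hAA : A ≤ A') (hK : 0 ≤ K) (hKK : K ≤ K') : GSBound A' K' g := by
  intro k n x
  refine (h k n x).trans ?_
  have : 0 ≤ K' := hK.trans hKK
  gcongr

theorem GSBound.add {d : ℕ} {A K K' : ℝ} {g ψ : Rd d → ℂ} (hg : ContDiff ℝ ∞ g)
    (hψ : ContDiff ℝ ∞ ψ) (h : GSBound A K g) (h' : GSBound A K' ψ) :
    GSBound A (K + K') (g + ψ) := by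
  intro k n x
  have e : iteratedFDeriv ℝ n (g + ψ) x = iteratedFDeriv ℝ n g x + iteratedFDeriv ℝ n ψ x :=
    iteratedFDeriv_add_apply (hg.of_le (mod_cast le_top)).contDiffAt
      (hψ.of_le (mod_cast le_top)).contDiffAt
  rw [e]
  calc ‖x‖ ^ k * ‖iteratedFDeriv ℝ n g x + iteratedFDeriv ℝ n ψ x‖
      ≤ ‖x‖ ^ k * (‖iteratedFDeriv ℝ n g x‖ + ‖iteratedFDeriv ℝ n ψ x‖) := by
        gcongr; exact norm_add_le _ _
    _ ≤ _ := by
        have h1 := h k n x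
        have h2 := h' k n x
        linarith

theorem GSBound.smul {d : ℕ} {A K : ℝ} {g : Rd d → ℂ} (hg : ContDiff ℝ ∞ g)
    (h : GSBound A K g) (c : ℂ) : GSBound A (‖c‖ * K) (c • g) := by
  intro k n x
  have e : iteratedFDeriv ℝ n (c • g) x = c • iteratedFDeriv ℝ n g x :=
    iteratedFDeriv_const_smul_apply (hg.of_le (mod_cast le_top)).contDiffAt
  rw [e, norm_smul]
  have h1 := mul_le_mul_of_nonneg_left (h k n x) (norm_nonneg c)
  linarith

/-- The Gelfand–Shilov space `S^{1/2}_{1/2}(ℝᵈ)` (Roumieu type). -/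
def GS (d : ℕ) : Submodule ℂ (Rd d → ℂ) where
  carrier := {g | ContDiff ℝ ∞ g ∧ ∃ A K : ℝ, 0 < A ∧ 0 ≤ K ∧ GSBound A K g}
  zero_mem' := by
    refine ⟨contDiff_const, 1, 0, one_pos, le_rfl, fun k n x => ?_⟩
    have : iteratedFDeriv ℝ n (0 : Rd d → ℂ) x = 0 := by
      simp
    simp [this]
  add_mem' := by
    rintro g ψ ⟨hg, A, K, hA, hK, h⟩ ⟨hψ, A', K', hA', hK', h'⟩
    refine ⟨hg.add hψ, max A A', K + K', lt_max_of_lt_left hA, add_nonneg hK hK', ?_⟩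
    exact GSBound.add hg hψ (h.mono hA.le (le_max_left _ _) hK le_rfl)
      (h'.mono hA'.le (le_max_right _ _) hK' le_rfl)
  smul_mem' := by
    rintro c g ⟨hg, A, K, hA, hK, h⟩
    exact ⟨contDiff_const.smul hg, A, ‖c‖ * K, hA, by positivity, h.smul hg c⟩

theorem GS.fderiv_mem {d : ℕ} {g : Rd d → ℂ} (h : g ∈ GS d) (w : Rd d) :
    (fun x => fderiv ℝ g x w) ∈ GS d := by
  obtain ⟨hg, A, K, hA, hK, hb⟩ := h
  have hf : ContDiff ℝ ∞ (fderiv ℝ g) := hg.fderiv_right (by simp)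
  refine ⟨hf.clm_apply contDiff_const, 2 * A, ‖w‖ * K * A, by positivity, by positivity, ?_⟩
  intro k n x
  have h1 : ‖iteratedFDeriv ℝ n (fun y => fderiv ℝ g y w) x‖
      ≤ ‖w‖ * ‖iteratedFDeriv ℝ (n + 1) g x‖ := by
    rw [← norm_iteratedFDeriv_fderiv]
    exact norm_iteratedFDeriv_clm_apply_const (hf.contDiffAt (x := x)) (mod_cast le_top)
  have h2 : √((n + 1)! : ℝ) ≤ 2 ^ (k + n) * √(n ! : ℝ) := by
    have h3 : ((n + 1 : ℕ) : ℝ) ≤ (2 ^ (k + n)) ^ 2 := by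
      have ha : n + 1 ≤ 2 ^ (k + n) :=
        (Nat.lt_two_pow_self (n := n)).trans_le (Nat.pow_le_pow_right (by norm_num) (by omega))
      have hc : ((n + 1 : ℕ) : ℝ) ≤ 2 ^ (k + n) := by exact_mod_cast ha
      have hd : (1 : ℝ) ≤ 2 ^ (k + n) := one_le_pow₀ (by norm_num)
      nlinarith
    rw [Nat.factorial_succ]
    push_cast at h3 ⊢
    rw [Real.sqrt_mul (by positivity)]
    gcongr
    exact (Real.sqrt_le_left (by positivity)).2 h3
  calc ‖x‖ ^ k * ‖iteratedFDeriv ℝ n (fun y => fderiv ℝ g y w) x‖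
      ≤ ‖x‖ ^ k * (‖w‖ * ‖iteratedFDeriv ℝ (n + 1) g x‖) := by gcongr
    _ = ‖w‖ * (‖x‖ ^ k * ‖iteratedFDeriv ℝ (n + 1) g x‖) := by ring
    _ ≤ ‖w‖ * (K * A ^ (k + (n + 1)) * (√(k ! : ℝ) * √((n + 1)! : ℝ))) := by
        exact mul_le_mul_of_nonneg_left (hb k (n + 1) x) (norm_nonneg w)
    _ ≤ ‖w‖ * (K * A ^ (k + (n + 1)) * (√(k ! : ℝ) * (2 ^ (k + n) * √(n ! : ℝ)))) := by gcongr
    _ = ‖w‖ * K * A * (2 * A) ^ (k + n) * (√(k ! : ℝ) * √(n ! : ℝ)) := by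
        rw [mul_pow]; ring

/-- The partial derivative `∂_j` on `S^{1/2}_{1/2}`. -/
def GS.partial {d : ℕ} (j : Fin d) : GS d →ₗ[ℂ] GS d where
  toFun g := ⟨fun x => fderiv ℝ g.1 x (EuclideanSpace.single j 1), GS.fderiv_mem g.2 _⟩
  map_add' g ψ := by
    ext x
    have h1 : DifferentiableAt ℝ g.1 x := (g.2.1.differentiable (by simp)) x
    have h2 : DifferentiableAt ℝ ψ.1 x := (ψ.2.1.differentiable (by simp)) x
    simp [fderiv_add h1 h2]
  map_smul' c g := by
    ext x
    have h1 : DifferentiableAt ℝ g.1 x := (g.2.1.differentiable (by simp)) x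
    simp [fderiv_const_smul h1]

/-- Continuity of a linear functional on `S^{1/2}_{1/2}`: continuity on every step of the inductive
limit. The continuous functionals form the dual `(S^{1/2}_{1/2})'`. -/
def GSContinuous {d : ℕ} (L : GS d →ₗ[ℂ] ℂ) : Prop :=
  ∀ A : ℝ, 0 < A → ∃ C : ℝ, ∀ (g : GS d) (K : ℝ), 0 ≤ K → GSBound A K g.1 → ‖L g‖ ≤ C * K

/-! ### Gaussian windows -/

theorem pow_le_sqrt_factorial_mul_exp {ε y : ℝ} (hε : 0 < ε) (k : ℕ) :
    y ^ k ≤ (√(2 * ε))⁻¹ ^ k * √(k ! : ℝ) * Real.exp (ε * y ^ 2) := by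
  have h := Real.pow_div_factorial_le_exp (2 * ε * y ^ 2) (by positivity) k
  have hk : (0 : ℝ) < k ! := by positivity
  rw [div_le_iff₀ hk] at h
  have e1 : (2 * ε * y ^ 2) ^ k = (√(2 * ε) ^ k * y ^ k) ^ 2 := by
    have : √(2 * ε) ^ 2 = 2 * ε := Real.sq_sqrt (by positivity)
    rw [← mul_pow, ← pow_mul, mul_comm k 2, pow_mul, mul_pow (√(2 * ε)) y 2, this]
  have e2 : Real.exp (2 * ε * y ^ 2) * (k ! : ℝ) = (√(k ! : ℝ) * Real.exp (ε * y ^ 2)) ^ 2 := by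
    rw [mul_pow, Real.sq_sqrt hk.le, ← Real.exp_nat_mul]
    push_cast
    ring_nf
  rw [e1, e2] at h
  have h3 := (abs_le_of_sq_le_sq' h (by positivity)).2
  have hp : 0 < √(2 * ε) ^ k := by positivity
  rw [inv_pow, mul_assoc, inv_mul_eq_div, le_div_iff₀ hp]
  linarith

/-- If `Dg = g · (Λ + ℓ)` with `Λ + ℓ` affine, then `g` has derivatives of Hermite type. -/
theorem norm_iteratedFDeriv_le_of_fderiv_eq {d : ℕ} {g : Rd d → ℂ} (hg : ContDiff ℝ ∞ g)
    (Λ : Rd d →L[ℝ] Rd d →L[ℝ] ℂ) (ℓ : Rd d →L[ℝ] ℂ)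
    (h : ∀ x, fderiv ℝ g x = g x • (Λ x + ℓ)) (x : Rd d) (n : ℕ) :
    ‖iteratedFDeriv ℝ n g x‖ ≤ ‖g x‖ * (‖Λ x + ℓ‖ + √(‖Λ‖ * n)) ^ n := by
  set t := ‖Λ x + ℓ‖
  set c := ‖Λ‖
  have hℓ : ContDiff ℝ ∞ (fun y => Λ y + ℓ) := Λ.contDiff.add contDiff_const
  have d1 : fderiv ℝ (fun y => Λ y + ℓ) = fun _ => Λ := by
    funext y
    rw [fderiv_add_const]
    exact Λ.fderiv
  have hstep : ∀ m : ℕ, ‖iteratedFDeriv ℝ (m + 1) g x‖ ≤ t * ‖iteratedFDeriv ℝ m g x‖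
      + m * c * ‖iteratedFDeriv ℝ (m - 1) g x‖ := by
    intro m
    have e : fderiv ℝ g = fun y => g y • (Λ y + ℓ) := funext h
    rw [← norm_iteratedFDeriv_fderiv, e]
    refine (norm_iteratedFDeriv_smul_le hg hℓ x (n := m) (mod_cast le_top)).trans ?_
    have z0 : ‖iteratedFDeriv ℝ 0 (fun y => Λ y + ℓ) x‖ = t := by
      rw [norm_iteratedFDeriv_zero]
    have z1 : ‖iteratedFDeriv ℝ 1 (fun y => Λ y + ℓ) x‖ = c := by
      rw [norm_iteratedFDeriv_one, d1]
    have z2 : ∀ i : ℕ, ‖iteratedFDeriv ℝ (i + 2) (fun y => Λ y + ℓ) x‖ = 0 := by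
      intro i
      rw [← norm_iteratedFDeriv_fderiv, d1, iteratedFDeriv_const_of_ne (by omega)]
      simp
    rcases m with _ | m
    · simp only [zero_add, Finset.sum_range_one, Nat.choose_self, Nat.cast_one, one_mul, z0]
      simp [mul_comm]
    · rw [Finset.sum_range_succ, Finset.sum_range_succ, Finset.sum_eq_zero]
      · have a1 : m + 1 - (m + 1) = 0 := by omega
        have a2 : m + 1 - m = 1 := by omega
        rw [a1, a2, z0, z1, Nat.choose_self, Nat.choose_succ_self_right, Nat.add_sub_cancel]
        push_cast
        apply le_of_eq
        ring
      · intro i hi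
        have hi' := Finset.mem_range.1 hi
        obtain ⟨p, hp⟩ : ∃ p, m + 1 - i = p + 2 := ⟨m - 1 - i, by omega⟩
        rw [hp, z2, mul_zero]
  have ht : 0 ≤ t := norm_nonneg _
  have hc : 0 ≤ c := norm_nonneg Λ
  induction n using Nat.strong_induction_on with
  | _ n ih =>
    rcases n with _ | m
    · simp
    · set S := t + √(c * ((m + 1 : ℕ) : ℝ)) with hS
      have hS0 : 0 ≤ S := by positivity
      have b1 : ‖iteratedFDeriv ℝ m g x‖ ≤ ‖g x‖ * (t + √(c * m)) ^ m := ih m (by omega)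
      rcases m with _ | p
      · have s0 := hstep 0
        rw [norm_iteratedFDeriv_zero] at s0
        simp only [CharP.cast_eq_zero, zero_mul, add_zero] at s0
        refine s0.trans ?_
        have : t ≤ S := by rw [hS]; linarith [Real.sqrt_nonneg (c * ((0 + 1 : ℕ) : ℝ))]
        rw [mul_comm, zero_add, pow_one]
        gcongr
      · have b2 : ‖iteratedFDeriv ℝ p g x‖ ≤ ‖g x‖ * (t + √(c * p)) ^ p := ih p (by omega)
        set q := √(c * ((p + 1 : ℕ) : ℝ)) with hq
        have hq0 : 0 ≤ q := Real.sqrt_nonneg _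
        have hqq : q * q = c * ((p + 1 : ℕ) : ℝ) := Real.mul_self_sqrt (by positivity)
        have hpq : √(c * (p : ℝ)) ≤ q := by
          apply Real.sqrt_le_sqrt
          gcongr
          omega
        have hqS : t + q ≤ S := by
          rw [hS]
          gcongr
          apply Real.sqrt_le_sqrt
          gcongr
          omega
        have s1 := hstep (p + 1)
        rw [Nat.add_sub_cancel] at s1
        have b2' : ‖iteratedFDeriv ℝ p g x‖ ≤ ‖g x‖ * (t + q) ^ p := b2.trans (by gcongr)
        calc ‖iteratedFDeriv ℝ (p + 1 + 1) g x‖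
            ≤ t * (‖g x‖ * (t + q) ^ (p + 1)) + (q * q) * (‖g x‖ * (t + q) ^ p) := by
              refine s1.trans ?_
              have : ((p + 1 : ℕ) : ℝ) * c = q * q := by rw [hqq]; ring
              rw [this]
              gcongr
          _ = ‖g x‖ * (t + q) ^ p * (t * (t + q) + q * q) := by ring
          _ ≤ ‖g x‖ * (t + q) ^ p * (t + q) ^ 2 := by
              gcongr
              nlinarith [mul_nonneg ht hq0]
          _ = ‖g x‖ * (t + q) ^ (p + 1 + 1) := by ring
          _ ≤ ‖g x‖ * S ^ (p + 1 + 1) := by gcongr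

theorem mem_GS_of_fderiv_eq {d : ℕ} {g : Rd d → ℂ} (hg : ContDiff ℝ ∞ g)
    (Λ : Rd d →L[ℝ] Rd d →L[ℝ] ℂ) (ℓ : Rd d →L[ℝ] ℂ)
    (h : ∀ x, fderiv ℝ g x = g x • (Λ x + ℓ)) {K₀ η : ℝ} (hK₀ : 0 ≤ K₀) (hη : 0 < η)
    (hdecay : ∀ x, ‖g x‖ ≤ K₀ * Real.exp (-(2 * η) * ‖x‖ ^ 2)) : g ∈ GS d := by
  set c := ‖Λ‖ with hc'
  have hc : 0 ≤ c := norm_nonneg Λ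
  set b := ‖ℓ‖ with hb'
  have hb : 0 ≤ b := norm_nonneg _
  set ε := η / (3 * (c ^ 2 + 1)) with hε'
  have hε : 0 < ε := by positivity
  set B := (√(2 * η))⁻¹ with hB'
  have hB : 0 < B := by positivity
  set D := (√(2 * ε))⁻¹ * Real.exp (3 * ε * c) with hD'
  have hD : 0 < D := by positivity
  refine ⟨hg, B + D, K₀ * Real.exp (3 * ε * b ^ 2), by positivity, by positivity, ?_⟩
  intro k n x
  set r := ‖Λ x + ℓ‖ + √(c * n) with hr'
  have hr : 0 ≤ r := by positivity
  have hr2 : ε * r ^ 2 ≤ η * ‖x‖ ^ 2 + 3 * ε * b ^ 2 + n * (3 * ε * c) := by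
    have h1 : ‖Λ x + ℓ‖ ≤ c * ‖x‖ + b := (norm_add_le _ _).trans (by gcongr; exact Λ.le_opNorm x)
    have h2 : r ≤ c * ‖x‖ + b + √(c * n) := by rw [hr']; linarith
    have h3 : √(c * n) ^ 2 = c * n := Real.sq_sqrt (by positivity)
    have h4 : r ^ 2 ≤ 3 * (c ^ 2 * ‖x‖ ^ 2 + b ^ 2 + c * n) := by
      have h5 : r ^ 2 ≤ (c * ‖x‖ + b + √(c * n)) ^ 2 := by gcongr
      nlinarith [sq_nonneg (c * ‖x‖ - b), sq_nonneg (c * ‖x‖ - √(c * n)),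
        sq_nonneg (b - √(c * n))]
    have h6 : 3 * ε * c ^ 2 ≤ η := by
      have : 3 * ε * (c ^ 2 + 1) = η := by rw [hε']; field_simp
      nlinarith
    nlinarith [mul_le_mul_of_nonneg_left h4 hε.le,
      mul_le_mul_of_nonneg_right h6 (sq_nonneg ‖x‖)]
  have p1 := pow_le_sqrt_factorial_mul_exp (y := ‖x‖) hη k
  have p2 := pow_le_sqrt_factorial_mul_exp (y := r) hε n
  have p3 : r ^ n ≤ D ^ n * √(n ! : ℝ) *
      (Real.exp (η * ‖x‖ ^ 2) * Real.exp (3 * ε * b ^ 2)) := by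
    refine p2.trans ?_
    have : Real.exp (ε * r ^ 2) ≤
        Real.exp (η * ‖x‖ ^ 2) * Real.exp (3 * ε * b ^ 2) * Real.exp (3 * ε * c) ^ n := by
      rw [← Real.exp_nat_mul, ← Real.exp_add, ← Real.exp_add]
      exact Real.exp_le_exp.2 hr2
    calc _ ≤ (√(2 * ε))⁻¹ ^ n * √(n ! : ℝ) * (Real.exp (η * ‖x‖ ^ 2) * Real.exp (3 * ε * b ^ 2)
          * Real.exp (3 * ε * c) ^ n) := by gcongr
      _ = _ := by rw [hD', mul_pow]; ring
  have p4 := norm_iteratedFDeriv_le_of_fderiv_eq hg Λ ℓ h x n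
  have e0 : Real.exp (η * ‖x‖ ^ 2) * Real.exp (η * ‖x‖ ^ 2) * Real.exp (-(2 * η) * ‖x‖ ^ 2) = 1 := by
    rw [← Real.exp_add, ← Real.exp_add, ← Real.exp_zero]
    congr 1
    ring
  calc ‖x‖ ^ k * ‖iteratedFDeriv ℝ n g x‖
      ≤ (B ^ k * √(k ! : ℝ) * Real.exp (η * ‖x‖ ^ 2)) *
        ((K₀ * Real.exp (-(2 * η) * ‖x‖ ^ 2)) * (D ^ n * √(n ! : ℝ) *
          (Real.exp (η * ‖x‖ ^ 2) * Real.exp (3 * ε * b ^ 2)))) := by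
        refine mul_le_mul p1 (p4.trans ?_) (norm_nonneg _) (by positivity)
        exact mul_le_mul (hdecay x) p3 (by positivity) (by positivity)
    _ = K₀ * Real.exp (3 * ε * b ^ 2) * (B ^ k * D ^ n) * (√(k ! : ℝ) * √(n ! : ℝ)) *
        (Real.exp (η * ‖x‖ ^ 2) * Real.exp (η * ‖x‖ ^ 2) * Real.exp (-(2 * η) * ‖x‖ ^ 2)) := by
        ring
    _ = K₀ * Real.exp (3 * ε * b ^ 2) * (B ^ k * D ^ n) * (√(k ! : ℝ) * √(n ! : ℝ)) := by
        rw [e0, mul_one]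
    _ ≤ K₀ * Real.exp (3 * ε * b ^ 2) * (B + D) ^ (k + n) * (√(k ! : ℝ) * √(n ! : ℝ)) := by
        rw [pow_add]
        gcongr <;> linarith

/-- `x ↦ E_{x₀,M}(x) e^{-i⟨x,ξ⟩}` with `E_{x₀,M}(x) = e^{-|x-x₀|²/(4M)}`. -/
def gaussianWave {d : ℕ} (x₀ : Rd d) (M : ℕ+) (ξ : Rd d) (x : Rd d) : ℂ :=
  Complex.exp (-((‖x - x₀‖ ^ 2 / (4 * (M : ℝ)) : ℝ) : ℂ) - Complex.I * ((inner ℝ x ξ : ℝ) : ℂ))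

theorem gaussianWave_mem {d : ℕ} (x₀ : Rd d) (M : ℕ+) (ξ : Rd d) : gaussianWave x₀ M ξ ∈ GS d := by
  have hM : (0 : ℝ) < (M : ℝ) := by exact_mod_cast M.pos
  set a : ℝ := 1 / (2 * (M : ℝ)) with ha
  have hsm : ContDiff ℝ ∞ (gaussianWave x₀ M ξ) := by
    unfold gaussianWave
    have h1 : ContDiff ℝ ∞ (fun x : Rd d => ‖x - x₀‖ ^ 2 / (4 * (M : ℝ))) :=
      ((contDiff_id.sub contDiff_const).norm_sq ℝ).div_const _
    have h2 : ContDiff ℝ ∞ (fun x : Rd d => (inner ℝ x ξ : ℝ)) :=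
      contDiff_id.inner ℝ contDiff_const
    exact ((Complex.ofRealCLM.contDiff.comp h1).neg.sub
      (contDiff_const.mul (Complex.ofRealCLM.contDiff.comp h2))).cexp
  let Λ : Rd d →L[ℝ] Rd d →L[ℝ] ℂ :=
    (-a) • (ContinuousLinearMap.compL ℝ (Rd d) ℝ ℂ Complex.ofRealCLM).comp (innerSL ℝ)
  let ℓ : Rd d →L[ℝ] ℂ := a • Complex.ofRealCLM.comp (innerSL ℝ x₀)
    - Complex.I • Complex.ofRealCLM.comp (innerSL ℝ ξ)
  have hder : ∀ x, fderiv ℝ (gaussianWave x₀ M ξ) x = gaussianWave x₀ M ξ x • (Λ x + ℓ) := by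
    intro x
    have h1 : HasFDerivAt (fun x : Rd d => ‖x - x₀‖ ^ 2) (2 • (innerSL ℝ (x - x₀))) x := by
      have := ((hasFDerivAt_id (𝕜 := ℝ) x).sub_const x₀).norm_sq
      simpa using this
    have h2 : HasFDerivAt (fun x : Rd d => ‖x - x₀‖ ^ 2 / (4 * (M : ℝ)))
        (a • (innerSL ℝ (x - x₀))) x := by
      have := h1.mul_const ((4 * (M : ℝ))⁻¹)
      refine this.congr_fderiv ?_
      ext w
      simp [ha]
      field_simp
      ring
    have h3 : HasFDerivAt (fun x : Rd d => (inner ℝ x ξ : ℝ)) (innerSL ℝ ξ) x := by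
      have := (innerSL ℝ ξ).hasFDerivAt (x := x)
      refine this.congr_of_eventuallyEq (Eventually.of_forall fun y => ?_)
      simp [real_inner_comm]
    have h4 := ((Complex.ofRealCLM.hasFDerivAt.comp x h2).neg.sub
      ((Complex.ofRealCLM.hasFDerivAt.comp x h3).const_mul Complex.I)).cexp
    have h5 : HasFDerivAt (gaussianWave x₀ M ξ) _ x := h4
    rw [h5.fderiv]
    ext w
    simp [Λ, ℓ, gaussianWave]
    ring_nf
  refine mem_GS_of_fderiv_eq hsm Λ ℓ hder (K₀ := Real.exp (‖x₀‖ ^ 2 / (4 * (M : ℝ))))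
    (η := 1 / (16 * (M : ℝ))) (by positivity) (by positivity) ?_
  intro x
  have hn : ‖gaussianWave x₀ M ξ x‖ = Real.exp (-(‖x - x₀‖ ^ 2 / (4 * (M : ℝ)))) := by
    unfold gaussianWave
    rw [Complex.norm_exp]
    simp only [Complex.sub_re, Complex.neg_re, Complex.ofReal_re, Complex.mul_re, Complex.I_re,
      Complex.I_im, Complex.ofReal_im]
    simp
  rw [hn, ← Real.exp_add]
  apply Real.exp_le_exp.2
  have h1 : ‖x‖ ≤ ‖x - x₀‖ + ‖x₀‖ := by
    simpa using norm_add_le (x - x₀) x₀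
  have h2 : ‖x‖ ^ 2 ≤ 2 * ‖x - x₀‖ ^ 2 + 2 * ‖x₀‖ ^ 2 := by
    nlinarith [sq_nonneg (‖x - x₀‖ - ‖x₀‖), norm_nonneg x, norm_nonneg (x - x₀), norm_nonneg x₀]
  have h3 : ‖x‖ ^ 2 / (8 * (M : ℝ)) ≤ (2 * ‖x - x₀‖ ^ 2 + 2 * ‖x₀‖ ^ 2) / (8 * (M : ℝ)) := by
    gcongr
  have h4 : (2 * ‖x - x₀‖ ^ 2 + 2 * ‖x₀‖ ^ 2) / (8 * (M : ℝ)) =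
      ‖x - x₀‖ ^ 2 / (4 * (M : ℝ)) + ‖x₀‖ ^ 2 / (4 * (M : ℝ)) := by
    field_simp
    ring
  have h5 : -(2 * (1 / (16 * (M : ℝ)))) * ‖x‖ ^ 2 = -(‖x‖ ^ 2 / (8 * (M : ℝ))) := by
    field_simp
    ring
  rw [h5]
  linarith

/-- The Gaussian short-time Fourier transform
`𝓕(L E_{x₀,M})(ξ) = ⟨L, E_{x₀,M} e^{-i⟨·,ξ⟩}⟩` of a functional `L` on `S^{1/2}_{1/2}`. -/
def gaussianSTFT {d : ℕ} (L : GS d →ₗ[ℂ] ℂ) (x₀ : Rd d) (M : ℕ+) (ξ : Rd d) : ℂ :=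
  L ⟨gaussianWave x₀ M ξ, gaussianWave_mem x₀ M ξ⟩

/-! ### Constant-coefficient operators -/

/-- `P(D) = ∑_α a_α D₁^{α₁} ⋯ D_d^{α_d}` for given operators `D₁, …, D_d`. -/
def polyOp {d : ℕ} {V : Type*} [AddCommGroup V] [Module ℂ V] (D : Fin d → Module.End ℂ V)
    (P : MvPolynomial (Fin d) ℂ) : Module.End ℂ V :=
  ∑ α ∈ P.support, P.coeff α • (List.ofFn fun j => D j ^ α j).prod

/-- `D_j = -i ∂_j` on distributions. -/
def distrD {d : ℕ} (j : Fin d) : Module.End ℂ (Distr d) where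
  toFun u := (-Complex.I) • Distribution.lineDerivCLM (EuclideanSpace.single j (1 : ℝ)) u
  map_add' u v := by rw [map_add, smul_add]
  map_smul' c u := by
    ext ψ
    simp [Distribution.lineDerivCLM_apply]
    ring

/-- `D_j = -i ∂_j` on functionals on `S^{1/2}_{1/2}`: `⟨D_j L, g⟩ = -⟨L, -i ∂_j g⟩`. -/
def gsD {d : ℕ} (j : Fin d) : Module.End ℂ (GS d →ₗ[ℂ] ℂ) where
  toFun L := (-Complex.I) • (-(L ∘ₗ GS.partial j))
  map_add' L L' := by
    ext g
    simp
    ring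
  map_smul' c L := by
    ext g
    simp
    ring

/-- `P(D)u` for `u ∈ 𝒟'(ℝᵈ)`. -/
def PDu {d : ℕ} (P : MvPolynomial (Fin d) ℂ) (u : Distr d) : Distr d := polyOp distrD P u

/-- `Char(P)`: the zeros `ξ ≠ 0` of the principal part `P_m`, over all base points. -/
def CharSet {d : ℕ} (P : MvPolynomial (Fin d) ℂ) : Set (Rd d × Rd d) :=
  {p | p.2 ≠ 0 ∧
    MvPolynomial.eval (fun j => ((p.2 j : ℝ) : ℂ))
      (MvPolynomial.homogeneousComponent P.totalDegree P) = 0}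

/-! ### Suitable extensions -/

/-- The value of a distribution on a complex-valued test function. -/
def Distr.pair {d : ℕ} (u : Distr d) (ψ : CplxTest d) : ℂ :=
  u (TestFunction.postcompCLM (𝕜 := ℝ) Complex.reCLM ψ) +
    Complex.I * u (TestFunction.postcompCLM (𝕜 := ℝ) Complex.imCLM ψ)

/-- The truncation `x ↦ χ(x/(k+1)) g(x)`. -/
def truncate {d : ℕ} (χ : RealTest d) (g : GS d) (k : ℕ) : CplxTest d where
  toFun x := ((χ (((k : ℝ) + 1)⁻¹ • x) : ℝ) : ℂ) * g.1 x
  contDiff' := by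
    have h1 : ContDiff ℝ ∞ (fun x : Rd d => χ (((k : ℝ) + 1)⁻¹ • x)) :=
      χ.contDiff.comp (contDiff_id.const_smul (((k : ℝ) + 1)⁻¹))
    exact (Complex.ofRealCLM.contDiff.comp h1).mul g.2.1
  hasCompactSupport' := by
    have h1 : HasCompactSupport (fun x : Rd d => χ (((k : ℝ) + 1)⁻¹ • x)) :=
      χ.hasCompactSupport.comp_smul (by positivity)
    have h2 : HasCompactSupport (fun x : Rd d => ((χ (((k : ℝ) + 1)⁻¹ • x) : ℝ) : ℂ)) :=
      h1.comp_left (g := fun r : ℝ => (r : ℂ)) (by simp)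
    exact h2.mul_right
  tsupport_subset' := by simp

/-- The distribution `T` belongs to `(S^{1/2}_{1/2})'`, acting there as `L`: the functional `L` is
continuous on `S^{1/2}_{1/2}` and `⟨L, g⟩ = lim_k ⟨T, χ(·/(k+1)) g⟩` for every cut-off function `χ`
that equals `1` near the origin. (As `S^{1/2}_{1/2}` has no compactly supported elements but `0`,
the two actions have to be linked by truncation; `L` is determined by `T`.) -/
def BelongsToGSDual {d : ℕ} (T : Distr d) (L : GS d →ₗ[ℂ] ℂ) : Prop :=
  GSContinuous L ∧
    ∀ χ : RealTest d, (∀ᶠ x in 𝓝 (0 : Rd d), χ x = 1) → ∀ g : GS d,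
      Tendsto (fun k : ℕ => T.pair (truncate χ g k)) atTop (𝓝 (L g))

/-- `(T, L)` is a suitable extension of `u` from some ball around `x₀`: `T` coincides with `u` in the
ball and belongs to `(S^{1/2}_{1/2})'`, acting there as `L`. -/
def IsSuitableExtension {d : ℕ} (u : Distr d) (x₀ : Rd d) (T : Distr d) (L : GS d →ₗ[ℂ] ℂ) : Prop :=
  BelongsToGSDual T L ∧
    ∃ r : ℝ, 0 < r ∧ ∀ ψ : RealTest d, tsupport ψ ⊆ Metric.ball x₀ r → T ψ = u ψ

/-! ### Wave-front sets -/

/-- `⟨ξ⟩ = (1 + |ξ|²)^{1/2}`. -/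
def bracket {d : ℕ} (ξ : Rd d) : ℝ := √(1 + ‖ξ‖ ^ 2)

/-- The Gevrey `s`-estimate at `(x₀, ξ₀)`: for some open cone `Γ ∋ ξ₀`, positive integers `v`, `N₀`
and `C > 0`, `|𝓕(L E_{x₀,vN})(ξ)| ≤ C^{n+1} n^{sn} / ⟨ξ⟩^n` for `ξ ∈ Γ`, `n ≤ N`, `N > N₀`. -/
def GevreyEstimate {d : ℕ} (s : ℝ) (L : GS d →ₗ[ℂ] ℂ) (x₀ ξ₀ : Rd d) : Prop :=
  ∃ Γ : Set (Rd d), IsOpen Γ ∧ (∀ ξ ∈ Γ, ∀ t : ℝ, 0 < t → t • ξ ∈ Γ) ∧ ξ₀ ∈ Γ ∧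
    ∃ (v N₀ : ℕ+) (C : ℝ), 0 < C ∧
      ∀ ξ ∈ Γ, ∀ N : ℕ+, N₀ < N → ∀ n : ℕ, n ≤ (N : ℕ) →
        ‖gaussianSTFT L x₀ (v * N) ξ‖ ≤ C ^ (n + 1) * (n : ℝ) ^ (s * n) / bracket ξ ^ n

/-- `WF_s(u)`: the complement in `ℝᵈ × (ℝᵈ ∖ {0})` of the set of Gevrey `s`-regular points. -/
def WFs {d : ℕ} (s : ℝ) (u : Distr d) : Set (Rd d × Rd d) :=
  {p | p.2 ≠ 0 ∧ ¬ ∃ (T : Distr d) (L : GS d →ₗ[ℂ] ℂ),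
    IsSuitableExtension u p.1 T L ∧ GevreyEstimate s L p.1 p.2}

/-- The Fourier transform `∫ T(x) e^{-i⟨x,ξ⟩} dx` of the distribution `T` is a (measurable) function
`U` with `|U(ξ)| ≤ C ⟨ξ⟩^l`; this is expressed by Fourier inversion, tested on `C_c^∞`. -/
def HasPolyBoundedFourier {d : ℕ} (T : Distr d) : Prop :=
  ∃ (U : Rd d → ℂ) (C l : ℝ), Measurable U ∧ (∀ ξ, ‖U ξ‖ ≤ C * bracket ξ ^ l) ∧
    ∀ ψ : RealTest d,
      T ψ = (((2 * Real.pi) ^ d : ℝ) : ℂ)⁻¹ *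
        ∫ ξ, U ξ * ∫ x, Complex.exp (Complex.I * ((inner ℝ x ξ : ℝ) : ℂ)) * ((ψ x : ℝ) : ℂ)

/-- `Reg(s,P,u)`. -/
def RegSet {d : ℕ} (s : ℝ) (P : MvPolynomial (Fin d) ℂ) (u : Distr d) : Set (Rd d × Rd d) :=
  {p | p.2 ≠ 0 ∧ ∃ (T : Distr d) (L : GS d →ₗ[ℂ] ℂ), IsSuitableExtension u p.1 T L ∧
    HasPolyBoundedFourier T ∧ GevreyEstimate s (polyOp gsD P L) p.1 p.2}

/-- `WF(s,P,u)`: the complement of `Reg(s,P,u)` in `ℝᵈ × (ℝᵈ ∖ {0})`. -/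
def WFsP {d : ℕ} (s : ℝ) (P : MvPolynomial (Fin d) ℂ) (u : Distr d) : Set (Rd d × Rd d) :=
  {p | p.2 ≠ 0 ∧ p ∉ RegSet s P u}

end

open MeasureTheory
open scoped BoundedContinuousFunction

/-! ### Quantitative Gelfand–Shilov bounds for Gaussian waves -/

/-! The wave-front set leaves the suitable extension free away from `x₀`, and this freedom carries
the whole argument. The pivot is `RapidAt`: for each fixed width `M`, the transform of `L` against
`E_{x₀,M}` decays faster than any power of `⟨ξ⟩` in a cone, with constants that may depend on `M` in
any way. Three facts about this notion, in which `s` does not occur, give both inclusions.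

(1) The Gevrey estimate implies it (`GevreyEstimate.rapidAt`), and it is stable under `P(D)`
(`RapidAt.gsD`, `IsSuitableExtension.PDu`). A wave with a narrow window, or its derivative, is a
Gaussian superposition of waves with a wider window. Continuous functionals commute with such
superpositions (`GSContinuous.apply_eq_integral`), and Gaussian averaging preserves decay in a
slightly smaller cone because the transforms are subgaussian (`exists_gaussian_mul_shift_le`).

(2) Rapid decay can be upgraded to the Gevrey estimate by changing the extension
(`IsSuitableExtension.exists_gevreyEstimate`). Functions `f_0, f_1, ...`, supported farther and
farther from `x₀`, are added to the extension. The function `f_j` cancels, up to a tiny error, the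
transform of width `j + 1` in the cone, while its transforms at all narrower widths are tiny
everywhere. At width `k + 1` the functions up to `f_k` make the transform small and the later ones
do no harm, so the estimate holds with an absolute constant.

The existence of one correction (`exists_correction`) is a duality statement. By Hahn–Banach it
suffices that a functional `ℓ` on weighted bounded functions over the cone, dominated by the
narrower windows, kills the target. Test it on `ψ(x - tθ) / E_{x₀,M}(x)`: at width `M` the transform
is `e^{-it⟨θ,ξ⟩} ψ̂(ξ)`, whereas at narrower widths everything is `O(e^{-κt²})`. Since `⟨θ,ξ⟩ ≤ 0`
on the cone, `t ↦ ℓ(⟨ξ⟩^N e^{-it⟨θ,ξ⟩} ψ̂)` extends to a bounded holomorphic function on the upper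
half-plane with Gaussian decay on the real axis, so it vanishes by Phragmén–Lindelöf
(`eq_zero_of_gaussian_decay`). Finally, the functions `ψ̂` are dense (`exists_eft_approx`).

(3) Off the characteristic set, the Gevrey estimate for `P(D)L` together with a polynomially bounded
Fourier transform `U` gives `RapidAt` for `L` (`IsSuitableExtension.rapidAt_of_polyOp`). The
transforms of `P(D)L` are averages of `P U`, up to a unimodular factor, over Gaussians of size
`(vN)^{-1/2}`. Letting `N → ∞` shows that `P U` decays almost everywhere in a cone. There `|P|` is
bounded below for large `ξ`, so `U` decays as well, and hence so do its Gaussian averages. -/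

theorem GSBound.of_fderiv_eq {d : ℕ} {g : Rd d → ℂ} (hg : ContDiff ℝ ∞ g)
    (Λ : Rd d →L[ℝ] Rd d →L[ℝ] ℂ) (ℓ : Rd d →L[ℝ] ℂ)
    (h : ∀ x, fderiv ℝ g x = g x • (Λ x + ℓ)) {K₀ η ε b : ℝ} (hK₀ : 0 ≤ K₀) (hη : 0 < η)
    (hε : 0 < ε) (hεη : 3 * ε * ‖Λ‖ ^ 2 ≤ η) (hb : ‖ℓ‖ ≤ b)
    (hdecay : ∀ x, ‖g x‖ ≤ K₀ * Real.exp (-(2 * η) * ‖x‖ ^ 2)) :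
    GSBound ((√(2 * η))⁻¹ + (√(2 * ε))⁻¹ * Real.exp (3 * ε * ‖Λ‖))
      (K₀ * Real.exp (3 * ε * b ^ 2)) g := by
  set c := ‖Λ‖ with hc'
  have hc : 0 ≤ c := norm_nonneg Λ
  have hb0 : 0 ≤ b := (norm_nonneg _).trans hb
  set B := (√(2 * η))⁻¹ with hB'
  have hB : 0 < B := by positivity
  set D := (√(2 * ε))⁻¹ * Real.exp (3 * ε * c) with hD'
  have hD : 0 < D := by positivity
  intro k n x
  set r := ‖Λ x + ℓ‖ + √(c * n) with hr'
  have hr : 0 ≤ r := by positivity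
  -- The three summands go to different places: the first is absorbed by the decay of `g`, the
  -- second enters the norm, the third enters the step. Hence `b` does not influence the step, and a
  -- family with unbounded `ℓ` still lies in a single one.
  have hr2 : ε * r ^ 2 ≤ η * ‖x‖ ^ 2 + 3 * ε * b ^ 2 + n * (3 * ε * c) := by
    have h1 : ‖Λ x + ℓ‖ ≤ c * ‖x‖ + b := (norm_add_le _ _).trans (by gcongr; exact Λ.le_opNorm x)
    have h2 : r ≤ c * ‖x‖ + b + √(c * n) := by rw [hr']; linarith
    have h3 : √(c * n) ^ 2 = c * n := Real.sq_sqrt (by positivity)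
    have h4 : r ^ 2 ≤ 3 * (c ^ 2 * ‖x‖ ^ 2 + b ^ 2 + c * n) := by
      have h5 : r ^ 2 ≤ (c * ‖x‖ + b + √(c * n)) ^ 2 := by gcongr
      nlinarith [sq_nonneg (c * ‖x‖ - b), sq_nonneg (c * ‖x‖ - √(c * n)),
        sq_nonneg (b - √(c * n))]
    nlinarith [mul_le_mul_of_nonneg_left h4 hε.le,
      mul_le_mul_of_nonneg_right hεη (sq_nonneg ‖x‖)]
  have p1 := pow_le_sqrt_factorial_mul_exp (y := ‖x‖) hη k
  have p2 := pow_le_sqrt_factorial_mul_exp (y := r) hε n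
  have p3 : r ^ n ≤ D ^ n * √(n ! : ℝ) *
      (Real.exp (η * ‖x‖ ^ 2) * Real.exp (3 * ε * b ^ 2)) := by
    refine p2.trans ?_
    have : Real.exp (ε * r ^ 2) ≤
        Real.exp (η * ‖x‖ ^ 2) * Real.exp (3 * ε * b ^ 2) * Real.exp (3 * ε * c) ^ n := by
      rw [← Real.exp_nat_mul, ← Real.exp_add, ← Real.exp_add]
      exact Real.exp_le_exp.2 hr2
    calc _ ≤ (√(2 * ε))⁻¹ ^ n * √(n ! : ℝ) * (Real.exp (η * ‖x‖ ^ 2) * Real.exp (3 * ε * b ^ 2)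
          * Real.exp (3 * ε * c) ^ n) := by gcongr
      _ = _ := by rw [hD', mul_pow]; ring
  have p4 := norm_iteratedFDeriv_le_of_fderiv_eq hg Λ ℓ h x n
  have e0 : Real.exp (η * ‖x‖ ^ 2) * Real.exp (η * ‖x‖ ^ 2) * Real.exp (-(2 * η) * ‖x‖ ^ 2) = 1 := by
    rw [← Real.exp_add, ← Real.exp_add, ← Real.exp_zero]
    congr 1
    ring
  calc ‖x‖ ^ k * ‖iteratedFDeriv ℝ n g x‖
      ≤ (B ^ k * √(k ! : ℝ) * Real.exp (η * ‖x‖ ^ 2)) *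
        ((K₀ * Real.exp (-(2 * η) * ‖x‖ ^ 2)) * (D ^ n * √(n ! : ℝ) *
          (Real.exp (η * ‖x‖ ^ 2) * Real.exp (3 * ε * b ^ 2)))) := by
        refine mul_le_mul p1 (p4.trans ?_) (norm_nonneg _) (by positivity)
        exact mul_le_mul (hdecay x) p3 (by positivity) (by positivity)
    _ = K₀ * Real.exp (3 * ε * b ^ 2) * (B ^ k * D ^ n) * (√(k ! : ℝ) * √(n ! : ℝ)) *
        (Real.exp (η * ‖x‖ ^ 2) * Real.exp (η * ‖x‖ ^ 2) * Real.exp (-(2 * η) * ‖x‖ ^ 2)) := by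
        ring
    _ = K₀ * Real.exp (3 * ε * b ^ 2) * (B ^ k * D ^ n) * (√(k ! : ℝ) * √(n ! : ℝ)) := by
        rw [e0, mul_one]
    _ ≤ K₀ * Real.exp (3 * ε * b ^ 2) * (B + D) ^ (k + n) * (√(k ! : ℝ) * √(n ! : ℝ)) := by
        rw [pow_add]
        gcongr <;> linarith

/-- The real-linear functional `x ↦ ⟨v, x⟩` with complex values. -/
noncomputable def innerC {d : ℕ} (v : Rd d) : Rd d →L[ℝ] ℂ := Complex.ofRealCLM.comp (innerSL ℝ v)

@[simp] theorem innerC_apply {d : ℕ} (v x : Rd d) : innerC v x = ((inner ℝ v x : ℝ) : ℂ) := rfl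

theorem norm_innerC_le {d : ℕ} (v : Rd d) : ‖innerC v‖ ≤ ‖v‖ :=
  ContinuousLinearMap.opNorm_le_bound _ (norm_nonneg _) fun x => by
    rw [innerC_apply, Complex.norm_real]
    exact norm_inner_le_norm v x

/-- The bilinear form `(x, y) ↦ ⟨x, y⟩` with complex values. -/
noncomputable def innerCBilin (d : ℕ) : Rd d →L[ℝ] Rd d →L[ℝ] ℂ :=
  (ContinuousLinearMap.compL ℝ (Rd d) ℝ ℂ Complex.ofRealCLM).comp (innerSL ℝ)

@[simp] theorem innerCBilin_apply {d : ℕ} (x y : Rd d) :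
    innerCBilin d x y = ((inner ℝ x y : ℝ) : ℂ) := rfl

theorem contDiff_gaussianWave {d : ℕ} (x₀ : Rd d) (M : ℕ+) (ξ : Rd d) :
    ContDiff ℝ ∞ (gaussianWave x₀ M ξ) := (gaussianWave_mem x₀ M ξ).1

theorem fderiv_gaussianWave {d : ℕ} (x₀ : Rd d) (M : ℕ+) (ξ x : Rd d) :
    fderiv ℝ (gaussianWave x₀ M ξ) x = gaussianWave x₀ M ξ x •
      (((-(1 / (2 * (M : ℝ)))) • innerCBilin d) x +
        ((1 / (2 * (M : ℝ))) • innerC x₀ - Complex.I • innerC ξ)) := by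
  have hM : (0 : ℝ) < (M : ℝ) := by exact_mod_cast M.pos
  set a : ℝ := 1 / (2 * (M : ℝ)) with ha
  have h1 : HasFDerivAt (fun x : Rd d => ‖x - x₀‖ ^ 2) (2 • (innerSL ℝ (x - x₀))) x := by
    have := ((hasFDerivAt_id (𝕜 := ℝ) x).sub_const x₀).norm_sq
    simpa using this
  have h2 : HasFDerivAt (fun x : Rd d => ‖x - x₀‖ ^ 2 / (4 * (M : ℝ)))
      (a • (innerSL ℝ (x - x₀))) x := by
    have := h1.mul_const ((4 * (M : ℝ))⁻¹)
    refine this.congr_fderiv ?_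
    ext w
    simp [ha]
    field_simp
    ring
  have h3 : HasFDerivAt (fun x : Rd d => (inner ℝ x ξ : ℝ)) (innerSL ℝ ξ) x := by
    have := (innerSL ℝ ξ).hasFDerivAt (x := x)
    refine this.congr_of_eventuallyEq (Eventually.of_forall fun y => ?_)
    simp [real_inner_comm]
  have h4 := ((Complex.ofRealCLM.hasFDerivAt.comp x h2).neg.sub
    ((Complex.ofRealCLM.hasFDerivAt.comp x h3).const_mul Complex.I)).cexp
  have h5 : HasFDerivAt (gaussianWave x₀ M ξ) _ x := h4
  rw [h5.fderiv]
  ext w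
  simp [gaussianWave]
  ring_nf

theorem norm_gaussianWave {d : ℕ} (x₀ : Rd d) (M : ℕ+) (ξ x : Rd d) :
    ‖gaussianWave x₀ M ξ x‖ = Real.exp (-(‖x - x₀‖ ^ 2 / (4 * (M : ℝ)))) := by
  unfold gaussianWave
  rw [Complex.norm_exp]
  simp only [Complex.sub_re, Complex.neg_re, Complex.ofReal_re, Complex.mul_re, Complex.I_re,
    Complex.I_im, Complex.ofReal_im]
  simp

theorem norm_gaussianWave_le {d : ℕ} (x₀ : Rd d) (M : ℕ+) (ξ x : Rd d) :
    ‖gaussianWave x₀ M ξ x‖ ≤ Real.exp (‖x₀‖ ^ 2 / (4 * (M : ℝ))) *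
      Real.exp (-(2 * (1 / (16 * (M : ℝ)))) * ‖x‖ ^ 2) := by
  have hM : (0 : ℝ) < (M : ℝ) := by exact_mod_cast M.pos
  rw [norm_gaussianWave, ← Real.exp_add]
  apply Real.exp_le_exp.2
  have h1 : ‖x‖ ≤ ‖x - x₀‖ + ‖x₀‖ := by
    simpa using norm_add_le (x - x₀) x₀
  have h2 : ‖x‖ ^ 2 ≤ 2 * ‖x - x₀‖ ^ 2 + 2 * ‖x₀‖ ^ 2 := by
    nlinarith [sq_nonneg (‖x - x₀‖ - ‖x₀‖), norm_nonneg x, norm_nonneg (x - x₀), norm_nonneg x₀]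
  have h3 : ‖x‖ ^ 2 / (8 * (M : ℝ)) ≤ (2 * ‖x - x₀‖ ^ 2 + 2 * ‖x₀‖ ^ 2) / (8 * (M : ℝ)) := by
    gcongr
  have h4 : (2 * ‖x - x₀‖ ^ 2 + 2 * ‖x₀‖ ^ 2) / (8 * (M : ℝ)) =
      ‖x - x₀‖ ^ 2 / (4 * (M : ℝ)) + ‖x₀‖ ^ 2 / (4 * (M : ℝ)) := by
    field_simp
    ring
  have h5 : -(2 * (1 / (16 * (M : ℝ)))) * ‖x‖ ^ 2 = -(‖x‖ ^ 2 / (8 * (M : ℝ))) := by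
    field_simp
    ring
  rw [h5]
  linarith

/-- The frequency enters the logarithmic derivative of the wave only through its constant part, so
it affects the norm but not the step `A`. An arbitrarily small growth rate `ε` is paid for by a
larger `A`. -/
theorem exists_GSBound_gaussianWave {d : ℕ} (x₀ : Rd d) (M : ℕ+) {ε : ℝ} (hε : 0 < ε) :
    ∃ A C : ℝ, 0 < A ∧ 0 ≤ C ∧
      ∀ ξ, GSBound A (C * Real.exp (ε * ‖ξ‖ ^ 2)) (gaussianWave x₀ M ξ) := by
  have hM : (0 : ℝ) < (M : ℝ) := by exact_mod_cast M.pos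
  set a : ℝ := 1 / (2 * (M : ℝ)) with ha
  have ha0 : 0 < a := by positivity
  set Λ : Rd d →L[ℝ] Rd d →L[ℝ] ℂ := (-a) • innerCBilin d with hΛ
  set η : ℝ := 1 / (16 * (M : ℝ)) with hη'
  have hη : 0 < η := by positivity
  -- The bound `ε / 6` is dictated by `3δ (a‖x₀‖ + ‖ξ‖)² ≤ 6δ ((a‖x₀‖)² + ‖ξ‖²)`; the other one
  -- makes the linear part of the derivative absorbable by the decay rate `η`.
  set δ := min (ε / 6) (η / (3 * (‖Λ‖ ^ 2 + 1))) with hδ'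
  have hδ : 0 < δ := by positivity
  have hδ1 : 6 * δ ≤ ε := by have := min_le_left (ε / 6) (η / (3 * (‖Λ‖ ^ 2 + 1))); linarith
  have hδ2 : 3 * δ * ‖Λ‖ ^ 2 ≤ η := by
    have h1 := min_le_right (ε / 6) (η / (3 * (‖Λ‖ ^ 2 + 1)))
    rw [← hδ', le_div_iff₀ (by positivity)] at h1
    nlinarith
  refine ⟨(√(2 * η))⁻¹ + (√(2 * δ))⁻¹ * Real.exp (3 * δ * ‖Λ‖),
    Real.exp (‖x₀‖ ^ 2 / (4 * (M : ℝ))) * Real.exp (ε * (a * ‖x₀‖) ^ 2), by positivity,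
    by positivity, fun ξ => ?_⟩
  · have hb : ‖a • innerC x₀ - Complex.I • innerC ξ‖ ≤ a * ‖x₀‖ + ‖ξ‖ := by
      refine (norm_sub_le _ _).trans ?_
      rw [norm_smul, norm_smul, Complex.norm_I, one_mul, Real.norm_of_nonneg ha0.le]
      gcongr
      · exact norm_innerC_le x₀
      · exact norm_innerC_le ξ
    refine (GSBound.of_fderiv_eq (contDiff_gaussianWave x₀ M ξ) Λ _ (fderiv_gaussianWave x₀ M ξ)
      (Real.exp_pos _).le hη hδ hδ2 hb (norm_gaussianWave_le x₀ M ξ)).mono (by positivity) le_rfl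
      (by positivity) ?_
    simp only [← Real.exp_add]
    apply Real.exp_le_exp.2
    have h2 : (a * ‖x₀‖ + ‖ξ‖) ^ 2 ≤ 2 * ((a * ‖x₀‖) ^ 2 + ‖ξ‖ ^ 2) := by
      nlinarith [sq_nonneg (a * ‖x₀‖ - ‖ξ‖)]
    nlinarith [mul_le_mul_of_nonneg_left h2 hδ.le, sq_nonneg (a * ‖x₀‖), sq_nonneg ‖ξ‖]

/-! ### Multiplication by a character -/

/-- The character `x ↦ e^{-i⟨v,x⟩}`. -/
noncomputable def character {d : ℕ} (v : Rd d) (x : Rd d) : ℂ :=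
  Complex.exp (-Complex.I * ((inner ℝ v x : ℝ) : ℂ))

theorem norm_character {d : ℕ} (v x : Rd d) : ‖character v x‖ = 1 := by
  unfold character
  rw [Complex.norm_exp]
  simp

theorem contDiff_character {d : ℕ} (v : Rd d) : ContDiff ℝ ∞ (character v) :=
  (contDiff_const.mul (innerC v).contDiff).cexp

theorem fderiv_character {d : ℕ} (v x : Rd d) :
    fderiv ℝ (character v) x = character v x • ((0 : Rd d →L[ℝ] Rd d →L[ℝ] ℂ) x
      + (-Complex.I) • innerC v) := by
  have h := (((innerC v).hasFDerivAt (x := x)).const_mul (-Complex.I)).cexp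
  have h' : HasFDerivAt (character v) _ x := h
  rw [h'.fderiv]
  ext w
  simp [character]

theorem norm_iteratedFDeriv_character_le {d : ℕ} (v x : Rd d) (n : ℕ) :
    ‖iteratedFDeriv ℝ n (character v) x‖ ≤ ‖v‖ ^ n := by
  refine (norm_iteratedFDeriv_le_of_fderiv_eq (contDiff_character v) 0 _ (fderiv_character v) x
    n).trans ?_
  rw [norm_character, one_mul]
  have hz : ‖(0 : Rd d →L[ℝ] Rd d →L[ℝ] ℂ)‖ = 0 := ContinuousLinearMap.opNorm_zero
  rw [hz, zero_mul, Real.sqrt_zero, add_zero, zero_apply, zero_add]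
  gcongr
  rw [norm_smul, norm_neg, Complex.norm_I, one_mul]
  exact norm_innerC_le v

theorem norm_character_sub_one_le {d : ℕ} (v x : Rd d) : ‖character v x - 1‖ ≤ ‖v‖ * ‖x‖ := by
  have h := Real.norm_exp_I_mul_ofReal_sub_one_le (x := -(inner ℝ v x : ℝ))
  have e : character v x = Complex.exp (Complex.I * ((-(inner ℝ v x : ℝ) : ℝ) : ℂ)) := by
    unfold character; push_cast; ring_nf
  rw [e]
  refine h.trans ?_
  rw [norm_neg]
  exact norm_inner_le_norm v x

theorem gaussianWave_add {d : ℕ} (x₀ : Rd d) (M : ℕ+) (ξ v : Rd d) :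
    gaussianWave x₀ M (ξ + v) = fun x => gaussianWave x₀ M ξ x * character v x := by
  funext x
  unfold gaussianWave character
  rw [← Complex.exp_add, inner_add_right, real_inner_comm v x]
  push_cast
  ring_nf

/-- In the Leibniz formula the undifferentiated factor is at most `‖v‖ ‖x‖`, which costs one more
power of `‖x‖`, and its derivatives are at most `‖v‖` because `‖v‖ ≤ 1`. The factor `√(k+1) ≤ 2^k`
from the extra power and the binomial sum only enlarge the step. Applied to waves, this yields their
Lipschitz dependence on the frequency. -/
theorem GSBound.mul_character_sub_one {d : ℕ} {A K : ℝ} (hA : 0 < A) (hK : 0 ≤ K) {g : Rd d → ℂ}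
    (hg : ContDiff ℝ ∞ g) (h : GSBound A K g) {v : Rd d} (hv : ‖v‖ ≤ 1) :
    GSBound (2 * (A + 1)) ((A + 1) * K * ‖v‖) (fun x => g x * (character v x - 1)) := by
  intro k n x
  have hc : ContDiff ℝ ∞ (fun x => character v x - 1) := (contDiff_character v).sub contDiff_const
  have hd : ∀ i, ‖iteratedFDeriv ℝ i (fun x => character v x - 1) x‖ ≤
      ‖v‖ * (if i = 0 then ‖x‖ else 1) := by
    intro i
    rcases i with _ | i
    · simpa using norm_character_sub_one_le v x
    · have e : iteratedFDeriv ℝ (i + 1) (fun x => character v x - 1) x =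
          iteratedFDeriv ℝ (i + 1) (character v) x := by
        have := iteratedFDeriv_sub_apply (𝕜 := ℝ) (x := x) (i := i + 1)
          ((contDiff_character v).contDiffAt.of_le (mod_cast le_top))
          (contDiff_const (c := (1 : ℂ)).contDiffAt)
        rw [iteratedFDeriv_const_of_ne (by omega), Pi.zero_apply, sub_zero] at this
        exact this
      rw [e]
      refine (norm_iteratedFDeriv_character_le v x _).trans ?_
      simp only [Nat.add_eq_zero_iff, one_ne_zero, and_false, if_false, mul_one]
      rw [pow_succ]
      exact mul_le_of_le_one_left (norm_nonneg _) (pow_le_one₀ (norm_nonneg _) hv)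
  have hL := norm_iteratedFDeriv_mul_le (𝕜 := ℝ) hg hc x (n := n) (mod_cast le_top)
  have hterm : ∀ i ∈ Finset.range (n + 1), ‖x‖ ^ k * ((n.choose i : ℝ) * ‖iteratedFDeriv ℝ i g x‖ *
      ‖iteratedFDeriv ℝ (n - i) (fun x => character v x - 1) x‖) ≤
      (n.choose i : ℝ) * (A ^ i * 1 ^ (n - i)) * (‖v‖ * ((A + 1) * K * A ^ k * 2 ^ k * (√(k ! : ℝ) * √(n ! : ℝ)))) := by
    intro i hi
    have hi' : i ≤ n := by have := Finset.mem_range.1 hi; omega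
    have hfac : √(i ! : ℝ) ≤ √(n ! : ℝ) := by
      apply Real.sqrt_le_sqrt; exact_mod_cast Nat.factorial_le hi'
    have hfk : √((k + 1)! : ℝ) ≤ 2 ^ k * √(k ! : ℝ) := by
      rw [Nat.factorial_succ, Nat.cast_mul, Real.sqrt_mul (by positivity)]
      gcongr
      rw [Real.sqrt_le_left (by positivity)]
      have h1 : ((k + 1 : ℕ) : ℝ) ≤ 2 ^ k := by exact_mod_cast Nat.lt_two_pow_self (n := k)
      have h2 : (1 : ℝ) ≤ 2 ^ k := one_le_pow₀ (by norm_num)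
      nlinarith
    have key : ‖x‖ ^ k * (‖iteratedFDeriv ℝ i g x‖ * (if n - i = 0 then ‖x‖ else 1)) ≤
        A ^ i * ((A + 1) * K * A ^ k * 2 ^ k * (√(k ! : ℝ) * √(n ! : ℝ))) := by
      split_ifs
      · calc ‖x‖ ^ k * (‖iteratedFDeriv ℝ i g x‖ * ‖x‖)
            = ‖x‖ ^ (k + 1) * ‖iteratedFDeriv ℝ i g x‖ := by ring
          _ ≤ K * A ^ (k + 1 + i) * (√((k + 1)! : ℝ) * √(i ! : ℝ)) := h _ _ _
          _ ≤ K * A ^ (k + 1 + i) * ((2 ^ k * √(k ! : ℝ)) * √(n ! : ℝ)) := by gcongr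
          _ = A ^ i * (A * K * A ^ k * 2 ^ k * (√(k ! : ℝ) * √(n ! : ℝ))) := by ring
          _ ≤ _ := by gcongr; linarith
      · calc ‖x‖ ^ k * (‖iteratedFDeriv ℝ i g x‖ * 1)
            = ‖x‖ ^ k * ‖iteratedFDeriv ℝ i g x‖ := by ring
          _ ≤ K * A ^ (k + i) * (√(k ! : ℝ) * √(i ! : ℝ)) := h _ _ _
          _ ≤ K * A ^ (k + i) * (√(k ! : ℝ) * √(n ! : ℝ)) := by gcongr
          _ = A ^ i * (1 * K * A ^ k * 1 * (√(k ! : ℝ) * √(n ! : ℝ))) := by ring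
          _ ≤ _ := by
            gcongr
            · linarith
            · exact one_le_pow₀ (by norm_num)
    calc _ ≤ ‖x‖ ^ k * ((n.choose i : ℝ) * ‖iteratedFDeriv ℝ i g x‖ *
          (‖v‖ * (if n - i = 0 then ‖x‖ else 1))) := by gcongr; exact hd _
      _ = (n.choose i : ℝ) * ‖v‖ *
          (‖x‖ ^ k * (‖iteratedFDeriv ℝ i g x‖ * (if n - i = 0 then ‖x‖ else 1))) := by ring
      _ ≤ (n.choose i : ℝ) * ‖v‖ * (A ^ i * ((A + 1) * K * A ^ k * 2 ^ k * (√(k ! : ℝ) * √(n ! : ℝ)))) := by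
          gcongr
      _ = _ := by rw [one_pow]; ring
  calc ‖x‖ ^ k * ‖iteratedFDeriv ℝ n (fun x => g x * (character v x - 1)) x‖
      ≤ ‖x‖ ^ k * _ := by gcongr
    _ = _ := Finset.mul_sum _ _ _
    _ ≤ _ := Finset.sum_le_sum hterm
    _ = (A + 1) ^ n * (‖v‖ * ((A + 1) * K * A ^ k * 2 ^ k * (√(k ! : ℝ) * √(n ! : ℝ)))) := by
        rw [← Finset.sum_mul, add_pow]
        congr 1
        exact Finset.sum_congr rfl fun i _ => by ring
    _ ≤ (2 * (A + 1)) ^ n * (‖v‖ * ((A + 1) * K * (A + 1) ^ k * 2 ^ k * (√(k ! : ℝ) * √(n ! : ℝ)))) := by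
        gcongr <;> linarith
    _ = _ := by rw [pow_add, mul_pow 2 (A + 1) k]; ring

theorem exists_GSBound_gaussianWave_sub {d : ℕ} (x₀ : Rd d) (M : ℕ+) {ε : ℝ} (hε : 0 < ε) :
    ∃ A C : ℝ, 0 < A ∧ 0 ≤ C ∧
      (∀ ξ, GSBound A (C * Real.exp (ε * ‖ξ‖ ^ 2)) (gaussianWave x₀ M ξ)) ∧
      ∀ ξ ξ', ‖ξ' - ξ‖ ≤ 1 → GSBound A (C * Real.exp (ε * ‖ξ‖ ^ 2) * ‖ξ' - ξ‖)
        (gaussianWave x₀ M ξ' - gaussianWave x₀ M ξ) := by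
  obtain ⟨A, C, hA, hC, h⟩ := exists_GSBound_gaussianWave x₀ M hε
  refine ⟨2 * (A + 1), (A + 1) * C, by positivity, by positivity, fun ξ => ?_, fun ξ ξ' hξ => ?_⟩
  · refine (h ξ).mono hA.le (by linarith) (by positivity) ?_
    gcongr
    nlinarith
  · have := GSBound.mul_character_sub_one hA (by positivity) (contDiff_gaussianWave x₀ M ξ) (h ξ) hξ
    have e : gaussianWave x₀ M ξ' - gaussianWave x₀ M ξ =
        fun x => gaussianWave x₀ M ξ x * (character (ξ' - ξ) x - 1) := by
      have := gaussianWave_add x₀ M ξ (ξ' - ξ)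
      rw [add_sub_cancel] at this
      rw [this]
      funext x
      simp [mul_sub]
    rw [e, mul_assoc (A + 1) C]
    exact this

/-! ### Functionals on the Gelfand–Shilov space commute with integrals -/

theorem integral_linearIsometryEquiv_comp {G H α : Type*} [NormedAddCommGroup G] [NormedSpace ℝ G]
    [NormedAddCommGroup H] [NormedSpace ℝ H] [MeasurableSpace α] {μ : Measure α} (Φ : G ≃ₗᵢ[ℝ] H)
    (f : α → G) : ∫ a, Φ (f a) ∂μ = Φ (∫ a, f a ∂μ) :=
  Φ.toContinuousLinearEquiv.integral_comp_comm f

/-- The integrated derivatives form a Taylor series of the integral: each one is the derivative of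
the preceding one by domination with `bound (m + 1)`, and Taylor series are unique. -/
theorem iteratedFDeriv_integral {E F α : Type*} [NormedAddCommGroup E] [NormedSpace ℝ E]
    [NormedAddCommGroup F] [NormedSpace ℝ F] [CompleteSpace F]
    [MeasurableSpace α] {μ : Measure α} {g : α → E → F}
    (hg : ∀ a, ContDiff ℝ ∞ (g a))
    (hm : ∀ n x, AEStronglyMeasurable (fun a => iteratedFDeriv ℝ n (g a) x) μ) {bound : ℕ → α → ℝ}
    (hb : ∀ n a x, ‖iteratedFDeriv ℝ n (g a) x‖ ≤ bound n a) (hi : ∀ n, Integrable (bound n) μ)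
    (n : ℕ) (x : E) :
    iteratedFDeriv ℝ n (fun x => ∫ a, g a x ∂μ) x = ∫ a, iteratedFDeriv ℝ n (g a) x ∂μ := by
  have hint : ∀ n x, Integrable (fun a => iteratedFDeriv ℝ n (g a) x) μ := fun n x =>
    (hi n).mono' (hm n x) (Eventually.of_forall fun a => hb n a x)
  have key : HasFTaylorSeriesUpTo ∞ (fun x => ∫ a, g a x ∂μ)
      (fun x => fun n => ∫ a, iteratedFDeriv ℝ n (g a) x ∂μ) := by
    refine (hasFTaylorSeriesUpTo_top_iff' le_rfl).2 ⟨?_, ?_⟩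
    · intro x
      rw [ContinuousMultilinearMap.curry0, ContinuousMultilinearMap.integral_apply (hint 0 x)]
      simp
    · intro m x
      have e : (∫ a, iteratedFDeriv ℝ m.succ (g a) x ∂μ).curryLeft =
          ∫ a, (iteratedFDeriv ℝ m.succ (g a) x).curryLeft ∂μ := by
        have e0 := integral_linearIsometryEquiv_comp (μ := μ)
          (H := E →L[ℝ] ContinuousMultilinearMap ℝ (fun _ : Fin m => E) F) (continuousMultilinearCurryLeftEquiv ℝ
          (fun _ : Fin m.succ => E) F) (fun a => iteratedFDeriv ℝ m.succ (g a) x)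
        exact e0.symm
      rw [e]
      refine hasFDerivAt_integral_of_dominated_of_fderiv_le (s := Set.univ)
        (F := fun x a => iteratedFDeriv ℝ m (g a) x)
        (F' := fun x a => (iteratedFDeriv ℝ m.succ (g a) x).curryLeft)
        (bound := bound (m + 1)) univ_mem
        (Eventually.of_forall fun x => hm m x) (hint m x) ?_ ?_ (hi _) ?_
      · exact ((continuousMultilinearCurryLeftEquiv ℝ (fun _ : Fin m.succ => E)
          F).continuous.comp_aestronglyMeasurable (hm m.succ x))
      · refine Eventually.of_forall fun a y _ => ?_
        rw [ContinuousMultilinearMap.curryLeft_norm]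
        exact hb _ _ _
      · refine Eventually.of_forall fun a y _ => ?_
        exact ((hasFTaylorSeriesUpTo_top_iff' (N := ∞) le_rfl).1
          (contDiff_iff_ftaylorSeries.1 (hg a))).2 m y
  exact (key.eq_iteratedFDeriv (mod_cast le_top) x).symm

/-- The weight that turns the bounds of the step `A` into a sup norm. -/
noncomputable def gsWeight {d : ℕ} (A : ℝ) (i : ℕ × ℕ × Rd d) : ℝ :=
  ‖i.2.2‖ ^ i.1 * (A ^ (i.1 + i.2.1) * (√(i.1 ! : ℝ) * √(i.2.1 ! : ℝ)))⁻¹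

theorem gsWeight_nonneg {d : ℕ} {A : ℝ} (hA : 0 < A) (i : ℕ × ℕ × Rd d) : 0 ≤ gsWeight A i := by
  unfold gsWeight; positivity

theorem gsBound_iff {d : ℕ} {A : ℝ} (hA : 0 < A) {f : Rd d → ℂ} {B : ℝ} :
    GSBound A B f ↔ ∀ i : ℕ × ℕ × Rd d,
      ‖gsWeight A i • iteratedFDeriv ℝ i.2.1 f i.2.2‖ ≤ B := by
  constructor
  · intro hf i
    rw [norm_smul, Real.norm_of_nonneg (gsWeight_nonneg hA i)]
    have := hf i.1 i.2.1 i.2.2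
    unfold gsWeight
    have hp : 0 < A ^ (i.1 + i.2.1) * (√(i.1 ! : ℝ) * √(i.2.1 ! : ℝ)) := by positivity
    rw [mul_right_comm, ← div_eq_mul_inv, div_le_iff₀ hp]
    linarith
  · intro hf k n x
    have := hf (k, n, x)
    rw [norm_smul, Real.norm_of_nonneg (gsWeight_nonneg hA _)] at this
    unfold gsWeight at this
    have hp : 0 < A ^ (k + n) * (√(k ! : ℝ) * √(n ! : ℝ)) := by positivity
    simp only at this
    rw [mul_right_comm, ← div_eq_mul_inv, div_le_iff₀ hp] at this
    linarith

/-- The step `A` of the inductive limit. -/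
def gsStep (d : ℕ) (A : ℝ) : Submodule ℂ (GS d) where
  carrier := {f | ∃ B, 0 ≤ B ∧ GSBound A B f.1}
  zero_mem' := ⟨0, le_rfl, fun k n x => by simp⟩
  add_mem' := by
    rintro f f' ⟨B, hB, h⟩ ⟨B', hB', h'⟩
    exact ⟨B + B', by positivity, GSBound.add f.2.1 f'.2.1 h h'⟩
  smul_mem' := by
    rintro c f ⟨B, hB, h⟩
    exact ⟨‖c‖ * B, by positivity, GSBound.smul f.2.1 h c⟩

/-- The space of bounded families of multilinear forms in which the steps embed. -/
abbrev GSSeq (d : ℕ) : Type :=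
  lp (fun i : ℕ × ℕ × Rd d => ContinuousMultilinearMap ℝ (fun _ : Fin i.2.1 => Rd d) ℂ) ⊤

/-- The isometric embedding of the step `A`. -/
noncomputable def gsEmbed {d : ℕ} {A : ℝ} (hA : 0 < A) : gsStep d A →ₗ[ℂ] GSSeq d where
  toFun f := ⟨fun i => gsWeight A i • iteratedFDeriv ℝ i.2.1 f.1.1 i.2.2, by
    obtain ⟨B, -, hB⟩ := f.2
    refine memℓp_infty ⟨B, ?_⟩
    rintro _ ⟨i, rfl⟩
    exact (gsBound_iff hA).1 hB i⟩
  map_add' := by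
    intro f f'
    ext i : 2
    have e : iteratedFDeriv ℝ i.2.1 (f.1.1 + f'.1.1) i.2.2 = iteratedFDeriv ℝ i.2.1 f.1.1 i.2.2 +
        iteratedFDeriv ℝ i.2.1 f'.1.1 i.2.2 :=
      iteratedFDeriv_add_apply (f.1.2.1.of_le (mod_cast le_top)).contDiffAt
        (f'.1.2.1.of_le (mod_cast le_top)).contDiffAt
    change gsWeight A i • iteratedFDeriv ℝ i.2.1 (f.1.1 + f'.1.1) i.2.2 = _
    rw [e, smul_add]
    rfl
  map_smul' := by
    intro c f
    ext i : 2
    have e : iteratedFDeriv ℝ i.2.1 (c • f.1.1) i.2.2 = c • iteratedFDeriv ℝ i.2.1 f.1.1 i.2.2 :=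
      iteratedFDeriv_const_smul_apply (f.1.2.1.of_le (mod_cast le_top)).contDiffAt
    change gsWeight A i • iteratedFDeriv ℝ i.2.1 (c • f.1.1) i.2.2 = _
    rw [e, smul_comm]
    rfl

theorem gsEmbed_apply {d : ℕ} {A : ℝ} (hA : 0 < A) (f : gsStep d A) (i : ℕ × ℕ × Rd d) :
    gsEmbed hA f i = gsWeight A i • iteratedFDeriv ℝ i.2.1 f.1.1 i.2.2 := rfl

theorem norm_gsEmbed_le {d : ℕ} {A : ℝ} (hA : 0 < A) (f : gsStep d A) {B : ℝ} (hB : 0 ≤ B)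
    (hf : GSBound A B f.1.1) : ‖gsEmbed hA f‖ ≤ B :=
  lp.norm_le_of_forall_le hB fun i => (gsBound_iff hA).1 hf i

theorem gsBound_norm_gsEmbed {d : ℕ} {A : ℝ} (hA : 0 < A) (f : gsStep d A) :
    GSBound A ‖gsEmbed hA f‖ f.1.1 :=
  (gsBound_iff hA).2 fun i => lp.norm_apply_le_norm ENNReal.top_ne_zero (gsEmbed hA f) i

theorem gsEmbed_injective {d : ℕ} {A : ℝ} (hA : 0 < A) :
    Function.Injective (gsEmbed (d := d) hA) := by
  intro f f' hf
  ext x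
  have h1 := congrArg (fun v : GSSeq d => (v (0, 0, x)) 0) hf
  simpa [gsEmbed_apply, gsWeight] using h1

theorem norm_gsEmbed_sub_le {d : ℕ} {A : ℝ} (hA : 0 < A) (f f' : gsStep d A) {B : ℝ} (hB : 0 ≤ B)
    (hf : GSBound A B (f.1.1 - f'.1.1)) : ‖gsEmbed hA f - gsEmbed hA f'‖ ≤ B := by
  refine lp.norm_le_of_forall_le hB fun i => ?_
  have e : iteratedFDeriv ℝ i.2.1 (f.1.1 - f'.1.1) i.2.2 = iteratedFDeriv ℝ i.2.1 f.1.1 i.2.2 -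
      iteratedFDeriv ℝ i.2.1 f'.1.1 i.2.2 :=
    iteratedFDeriv_sub_apply (f.1.2.1.of_le (mod_cast le_top)).contDiffAt
      (f'.1.2.1.of_le (mod_cast le_top)).contDiffAt
  have h1 := (gsBound_iff hA).1 hf i
  rw [e, smul_sub] at h1
  exact h1

/-- A continuous functional extends from a step to the ambient Banach space. -/
theorem GSContinuous.exists_extension {d : ℕ} {L : GS d →ₗ[ℂ] ℂ} (hL : GSContinuous L)
    {A : ℝ} (hA : 0 < A) :
    ∃ ℓ : StrongDual ℂ (GSSeq d), ∀ f : gsStep d A, ℓ (gsEmbed hA f) = L f.1 := by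
  obtain ⟨C, hC⟩ := hL A hA
  let e := LinearEquiv.ofInjective (gsEmbed hA) (gsEmbed_injective (d := d) hA)
  let ℓ : StrongDual ℂ (LinearMap.range (gsEmbed (d := d) hA)) :=
    LinearMap.mkContinuous ((L ∘ₗ (gsStep d A).subtype) ∘ₗ e.symm.toLinearMap) C (by
      intro y
      obtain ⟨f, rfl⟩ := e.surjective y
      simp only [LinearMap.comp_apply, LinearEquiv.coe_coe, LinearEquiv.symm_apply_apply]
      exact hC f.1 ‖gsEmbed hA f‖ (norm_nonneg _) (gsBound_norm_gsEmbed hA f))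
  obtain ⟨ℓ', hℓ', -⟩ := exists_extension_norm_eq (𝕜 := ℂ) _ ℓ
  refine ⟨ℓ', fun f => ?_⟩
  have h1 := hℓ' (e f)
  have h2 : ((e f : LinearMap.range (gsEmbed (d := d) hA)) : GSSeq d) = gsEmbed hA f := rfl
  rw [h2] at h1
  rw [h1]
  simp [ℓ, LinearMap.mkContinuous_apply]

theorem continuous_iteratedFDeriv_of_gsBound {d : ℕ} {A : ℝ} (hA : 0 < A) {α : Type*}
    [TopologicalSpace α] {g : α → GS d}
    (hcont : ∀ a, ∀ ε > 0, ∀ᶠ b in 𝓝 a, GSBound A ε ((g b).1 - (g a).1)) (n : ℕ) (x : Rd d) :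
    Continuous fun a => iteratedFDeriv ℝ n (g a).1 x := by
  rw [continuous_iff_continuousAt]
  intro a
  rw [ContinuousAt, Metric.tendsto_nhds]
  intro ε hε
  set w : ℝ := A ^ (0 + n) * (√(0 ! : ℝ) * √(n ! : ℝ)) with hw'
  have hw0 : 0 < w := by positivity
  filter_upwards [hcont a (ε / (2 * w)) (by positivity)] with b hb
  have h1 := hb 0 n x
  have e1 : iteratedFDeriv ℝ n ((g b).1 - (g a).1) x = iteratedFDeriv ℝ n (g b).1 x -
      iteratedFDeriv ℝ n (g a).1 x :=
    iteratedFDeriv_sub_apply ((g b).2.1.of_le (mod_cast le_top)).contDiffAt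
      ((g a).2.1.of_le (mod_cast le_top)).contDiffAt
  rw [e1, pow_zero, one_mul, mul_assoc, ← hw'] at h1
  rw [dist_eq_norm]
  refine h1.trans_lt ?_
  rw [div_mul_eq_mul_div, div_lt_iff₀ (by positivity)]
  nlinarith

theorem iteratedFDeriv_gs_integral {d : ℕ}
    {A : ℝ} (hA : 0 < A) {α : Type*} [TopologicalSpace α] [MeasurableSpace α] [BorelSpace α]
    [SecondCountableTopology α] {μ : Measure α} {g : α → GS d} {K : α → ℝ} {ψ : α → ℂ}
    (hψ : Continuous ψ)
    (hK : ∀ a, GSBound A (K a) (g a).1)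
    (hcont : ∀ a, ∀ ε > 0, ∀ᶠ b in 𝓝 a, GSBound A ε ((g b).1 - (g a).1))
    (hint : Integrable (fun a => ‖ψ a‖ * K a) μ) (n : ℕ) (x : Rd d) :
    iteratedFDeriv ℝ n (fun x => ∫ a, ψ a * (g a).1 x ∂μ) x =
      ∫ a, ψ a • iteratedFDeriv ℝ n (g a).1 x ∂μ := by
  have hDform : ∀ a n x, iteratedFDeriv ℝ n (fun x => ψ a * (g a).1 x) x =
      ψ a • iteratedFDeriv ℝ n (g a).1 x := fun a n x =>
    iteratedFDeriv_const_smul_apply (a := ψ a) ((g a).2.1.of_le (mod_cast le_top)).contDiffAt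
  rw [iteratedFDeriv_integral (fun a => contDiff_const.mul (g a).2.1)
    (bound := fun n a => (‖ψ a‖ * K a) * (A ^ (0 + n) * (√(0 ! : ℝ) * √(n ! : ℝ))))]
  · simp only [hDform]
  · intro n x
    simp only [hDform]
    exact (hψ.smul (continuous_iteratedFDeriv_of_gsBound hA hcont n x)).aestronglyMeasurable
  · intro n a x
    rw [hDform, norm_smul, mul_assoc]
    gcongr
    have := hK a 0 n x
    rw [pow_zero, one_mul] at this
    linarith
  · intro n
    exact hint.mul_const _

/-- The step `A` embeds isometrically in the Banach space `GSSeq d`, and `L` extends there by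
Hahn–Banach, so completeness of the step is not needed. The superposition is a Bochner integral in
`GSSeq d`; its strong measurability comes from the continuity of the family, as the target is not
separable. Reading off coordinates, which are weighted derivatives, shows that `h` lies in the step
and is represented by this integral. -/
theorem GSContinuous.apply_eq_integral {d : ℕ} {L : GS d →ₗ[ℂ] ℂ} (hL : GSContinuous L)
    {A : ℝ} (hA : 0 < A) {α : Type*} [TopologicalSpace α] [MeasurableSpace α] [BorelSpace α]
    [SecondCountableTopology α] {μ : Measure α} {g : α → GS d} {K : α → ℝ} {ψ : α → ℂ}
    (hψ : Continuous ψ) (hK0 : ∀ a, 0 ≤ K a)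
    (hK : ∀ a, GSBound A (K a) (g a).1)
    (hcont : ∀ a, ∀ ε > 0, ∀ᶠ b in 𝓝 a, GSBound A ε ((g b).1 - (g a).1))
    (hint : Integrable (fun a => ‖ψ a‖ * K a) μ)
    (h : GS d) (hh : ∀ x, h.1 x = ∫ a, ψ a * (g a).1 x ∂μ) :
    L h = ∫ a, ψ a * L (g a) ∂μ := by
  obtain ⟨ℓ, hℓ⟩ := hL.exists_extension hA
  have hgV : ∀ a, g a ∈ gsStep d A := fun a => ⟨K a, hK0 a, hK a⟩
  let G : α → GSSeq d := fun a => gsEmbed hA ⟨g a, hgV a⟩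
  have hGc : Continuous G := by
    rw [continuous_iff_continuousAt]
    intro a
    rw [ContinuousAt, Metric.tendsto_nhds]
    intro ε hε
    filter_upwards [hcont a (ε / 2) (by positivity)] with b hb
    rw [dist_eq_norm]
    exact (norm_gsEmbed_sub_le hA ⟨g b, hgV b⟩ ⟨g a, hgV a⟩ (half_pos hε).le hb).trans_lt
      (half_lt_self hε)
  have hGint : Integrable (fun a => ψ a • G a) μ := by
    refine hint.mono' (hψ.smul hGc).aestronglyMeasurable (Eventually.of_forall fun a => ?_)
    rw [norm_smul]
    exact mul_le_mul_of_nonneg_left (norm_gsEmbed_le hA _ (hK0 a) (hK a)) (norm_nonneg _)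
  have hD : ∀ n x, iteratedFDeriv ℝ n h.1 x = ∫ a, ψ a • iteratedFDeriv ℝ n (g a).1 x ∂μ := by
    intro n x
    rw [show h.1 = fun x => ∫ a, ψ a * (g a).1 x ∂μ from funext hh]
    exact iteratedFDeriv_gs_integral hA hψ hK hcont hint n x
  have hcoord : ∀ i : ℕ × ℕ × Rd d, (∫ a, ψ a • G a ∂μ : GSSeq d) i =
      gsWeight A i • iteratedFDeriv ℝ i.2.1 h.1 i.2.2 := by
    intro i
    have h1 := (lp.evalCLM ℂ (fun i : ℕ × ℕ × Rd d =>
      ContinuousMultilinearMap ℝ (fun _ : Fin i.2.1 => Rd d) ℂ) ⊤ i).integral_comp_comm hGint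
    have h2 : (∫ a, ψ a • G a ∂μ : GSSeq d) i =
      ∫ a, ψ a • (gsWeight A i • iteratedFDeriv ℝ i.2.1 (g a).1 i.2.2) ∂μ := h1.symm
    rw [h2, hD, ← integral_smul]
    refine integral_congr_ae (Eventually.of_forall fun a => ?_)
    exact smul_comm _ _ _
  have hhV : h ∈ gsStep d A := by
    refine ⟨‖(∫ a, ψ a • G a ∂μ : GSSeq d)‖, norm_nonneg _, (gsBound_iff hA).2 fun i => ?_⟩
    rw [← hcoord]
    exact lp.norm_apply_le_norm ENNReal.top_ne_zero _ i
  have hJh : gsEmbed hA ⟨h, hhV⟩ = ∫ a, ψ a • G a ∂μ := by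
    ext i : 2
    rw [hcoord]
    rfl
  calc L h = ℓ (gsEmbed hA ⟨h, hhV⟩) := (hℓ ⟨h, hhV⟩).symm
    _ = ∫ a, ℓ (ψ a • G a) ∂μ := by rw [hJh, ℓ.integral_comp_comm hGint]
    _ = _ := by
      refine integral_congr_ae (Eventually.of_forall fun a => ?_)
      change ℓ (ψ a • G a) = _
      rw [map_smul, smul_eq_mul, hℓ]

/-! ### The weight `⟨ξ⟩` -/

section bracket
variable {d : ℕ}

theorem bracket_sq (ξ : Rd d) : bracket ξ ^ 2 = 1 + ‖ξ‖ ^ 2 := Real.sq_sqrt (by positivity)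

theorem one_le_bracket (ξ : Rd d) : 1 ≤ bracket ξ :=
  Real.one_le_sqrt.2 (by nlinarith [sq_nonneg ‖ξ‖])

theorem bracket_pos (ξ : Rd d) : 0 < bracket ξ := one_pos.trans_le (one_le_bracket ξ)

theorem norm_le_bracket (ξ : Rd d) : ‖ξ‖ ≤ bracket ξ :=
  Real.le_sqrt_of_sq_le (by linarith)

theorem bracket_le_one_add_norm (ξ : Rd d) : bracket ξ ≤ 1 + ‖ξ‖ := by
  rw [bracket, Real.sqrt_le_left (by positivity)]
  nlinarith [norm_nonneg ξ]

theorem continuous_bracket : Continuous (bracket : Rd d → ℝ) := by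
  unfold bracket; fun_prop

theorem bracket_add_le (ξ η : Rd d) : bracket (ξ + η) ≤ 2 * (bracket ξ * bracket η) := by
  refine (abs_le_of_sq_le_sq' ?_ (by have := bracket_pos ξ; have := bracket_pos η; positivity)).2
  rw [mul_pow, mul_pow, bracket_sq, bracket_sq, bracket_sq]
  have h := norm_add_le ξ η
  have h2 : ‖ξ + η‖ ^ 2 ≤ (‖ξ‖ + ‖η‖) ^ 2 := by gcongr
  nlinarith [sq_nonneg (‖ξ‖ - ‖η‖), mul_nonneg (sq_nonneg ‖ξ‖) (sq_nonneg ‖η‖), sq_nonneg ‖ξ‖,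
    sq_nonneg ‖η‖]

theorem bracket_neg (ξ : Rd d) : bracket (-ξ) = bracket ξ := by simp [bracket]

theorem bracket_le_of_norm_le {k : ℝ} (hk : 1 ≤ k) {ξ η : Rd d} (h : ‖ξ‖ ≤ k * ‖η‖) :
    bracket ξ ≤ k * bracket η := by
  have h0 := bracket_pos η
  refine (abs_le_of_sq_le_sq' ?_ (by positivity)).2
  rw [mul_pow, bracket_sq, bracket_sq]
  have h2 : ‖ξ‖ ^ 2 ≤ (k * ‖η‖) ^ 2 := by gcongr
  nlinarith [norm_nonneg η]

theorem exists_bracket_pow_le_exp (n : ℕ) {κ : ℝ} (hκ : 0 < κ) :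
    ∃ C : ℝ, 0 < C ∧ ∀ ξ : Rd d, bracket ξ ^ n ≤ C * Real.exp (κ * ‖ξ‖ ^ 2) := by
  refine ⟨(n ! : ℝ) * κ⁻¹ ^ n * Real.exp κ, by positivity, fun ξ => ?_⟩
  have h := Real.pow_div_factorial_le_exp (κ * bracket ξ ^ 2)
    (by have := bracket_pos ξ; positivity) n
  rw [div_le_iff₀ (by positivity), mul_pow] at h
  have h1 : bracket ξ ^ n ≤ (bracket ξ ^ 2) ^ n := by
    rw [← pow_mul]
    exact pow_le_pow_right₀ (one_le_bracket ξ) (by omega)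
  have h2 : Real.exp (κ * bracket ξ ^ 2) = Real.exp κ * Real.exp (κ * ‖ξ‖ ^ 2) := by
    rw [← Real.exp_add, bracket_sq]; ring_nf
  rw [h2] at h
  have h3 : (bracket ξ ^ 2) ^ n = κ⁻¹ ^ n * (κ ^ n * (bracket ξ ^ 2) ^ n) := by
    rw [← mul_assoc, ← mul_pow, inv_mul_cancel₀ hκ.ne', one_pow, one_mul]
  calc bracket ξ ^ n ≤ κ⁻¹ ^ n * (κ ^ n * (bracket ξ ^ 2) ^ n) := h1.trans h3.le
    _ ≤ κ⁻¹ ^ n * (Real.exp κ * Real.exp (κ * ‖ξ‖ ^ 2) * (n ! : ℝ)) := by gcongr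
    _ = _ := by ring

theorem integrable_exp_neg_mul_sq_norm {b : ℝ} (hb : 0 < b) :
    Integrable fun x : Rd d => Real.exp (-b * ‖x‖ ^ 2) := by
  have h := (GaussianFourier.integrable_cexp_neg_mul_sq_norm_add (V := Rd d) (b := (b : ℂ))
    (by simpa using hb) 0 0).norm
  refine h.congr (Eventually.of_forall fun x => ?_)
  simp only [zero_mul, add_zero, Complex.norm_exp]
  congr 1
  rw [← Complex.ofReal_pow, ← Complex.ofReal_neg, ← Complex.ofReal_mul, Complex.ofReal_re]

end bracket

/-! ### Conic neighbourhoods -/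

/-- `Γ` is an open cone that contains `ξ₀`. -/
def IsConeNhd {d : ℕ} (Γ : Set (Rd d)) (ξ₀ : Rd d) : Prop :=
  IsOpen Γ ∧ (∀ ξ ∈ Γ, ∀ t : ℝ, 0 < t → t • ξ ∈ Γ) ∧ ξ₀ ∈ Γ

theorem IsConeNhd.inter {d : ℕ} {Γ Γ' : Set (Rd d)} {ξ₀ : Rd d} (h : IsConeNhd Γ ξ₀)
    (h' : IsConeNhd Γ' ξ₀) : IsConeNhd (Γ ∩ Γ') ξ₀ :=
  ⟨h.1.inter h'.1, fun ξ hξ t ht => ⟨h.2.1 ξ hξ.1 t ht, h'.2.1 ξ hξ.2 t ht⟩, h.2.2, h'.2.2⟩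

/-- The cone spanned by the ball of radius `r` around `e₀`. -/
def coneOver {d : ℕ} (e₀ : Rd d) (r : ℝ) : Set (Rd d) := {ξ | ∃ t : ℝ, 0 < t ∧ ‖ξ - t • e₀‖ < t * r}

theorem isConeNhd_coneOver {d : ℕ} (e₀ : Rd d) {r : ℝ} (hr : 0 < r) :
    IsConeNhd (coneOver e₀ r) e₀ := by
  refine ⟨?_, ?_, 1, one_pos, by simpa using hr⟩
  · have : coneOver e₀ r = ⋃ t ∈ Set.Ioi (0 : ℝ), Metric.ball (t • e₀) (t * r) := by
      ext ξ
      simp [coneOver, dist_eq_norm]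
    rw [this]
    exact isOpen_biUnion fun _ _ => Metric.isOpen_ball
  · rintro ξ ⟨s, hs, h⟩ t ht
    refine ⟨t * s, by positivity, ?_⟩
    rw [mul_smul, ← smul_sub, norm_smul, Real.norm_of_nonneg ht.le, mul_assoc]
    gcongr

/-- Over the ball of half the radius one has `‖ξ‖ ≤ t (‖ξ₀‖ + r)`, so a perturbation of relative
size `(r/2) / (‖ξ₀‖ + r)` is at most `t r / 2`. The requirement `c ≤ 1 / 2` serves later to compare
`⟨ξ⟩` with `⟨ξ - η⟩`. -/
theorem IsConeNhd.exists_shrink {d : ℕ} {Γ : Set (Rd d)} {ξ₀ : Rd d} (h : IsConeNhd Γ ξ₀) :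
    ∃ (Γ' : Set (Rd d)) (c : ℝ), IsConeNhd Γ' ξ₀ ∧ 0 < c ∧ c ≤ 1 / 2 ∧
      ∀ ξ ∈ Γ', ∀ η : Rd d, ‖η‖ ≤ c * ‖ξ‖ → ξ - η ∈ Γ := by
  obtain ⟨r, hr, hball⟩ := Metric.isOpen_iff.1 h.1 ξ₀ h.2.2
  have hc : 0 < min (1 / 2) (r / 2 / (‖ξ₀‖ + r)) := by
    have := norm_nonneg ξ₀
    positivity
  refine ⟨coneOver ξ₀ (r / 2), _, isConeNhd_coneOver ξ₀ (by positivity), hc, min_le_left _ _, ?_⟩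
  rintro ξ ⟨t, ht, hξ⟩ η hη
  have h0 := norm_nonneg ξ₀
  have h1 : ‖ξ‖ ≤ t * (‖ξ₀‖ + r) := by
    have : ‖ξ‖ ≤ ‖ξ - t • ξ₀‖ + ‖t • ξ₀‖ := by simpa using norm_add_le (ξ - t • ξ₀) (t • ξ₀)
    rw [norm_smul, Real.norm_of_nonneg ht.le] at this
    nlinarith
  have h2 : ‖η‖ ≤ t * (r / 2) := by
    calc ‖η‖ ≤ _ := hη
      _ ≤ r / 2 / (‖ξ₀‖ + r) * (t * (‖ξ₀‖ + r)) := by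
        gcongr
        exact min_le_right _ _
      _ = t * (r / 2) := by field_simp
  have h3 : ‖(ξ - η) - t • ξ₀‖ < t * r := by
    calc ‖(ξ - η) - t • ξ₀‖ = ‖(ξ - t • ξ₀) - η‖ := by congr 1; abel
      _ ≤ ‖ξ - t • ξ₀‖ + ‖η‖ := norm_sub_le _ _
      _ < t * r := by linarith
  have h4 : t⁻¹ • (ξ - η) ∈ Γ := by
    apply hball
    rw [Metric.mem_ball, dist_eq_norm]
    have e : t⁻¹ • (ξ - η) - ξ₀ = t⁻¹ • ((ξ - η) - t • ξ₀) := by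
      rw [smul_sub t⁻¹ (ξ - η), smul_smul, inv_mul_cancel₀ ht.ne', one_smul]
    rw [e, norm_smul, Real.norm_of_nonneg (by positivity), inv_mul_lt_iff₀ ht]
    exact h3
  have h5 := h.2.1 _ h4 t ht
  rwa [smul_smul, mul_inv_cancel₀ ht.ne', one_smul] at h5

/-- A function of subgaussian growth that decays in a cone still does so after averaging with a
Gaussian density. -/
theorem exists_gaussian_mul_shift_le {d : ℕ} {F : Rd d → ℂ} {Γ Γ' : Set (Rd d)} {c : ℝ}
    (hc : 0 < c) (hc2 : c ≤ 1 / 2) (hΓ : ∀ ξ ∈ Γ', ∀ η : Rd d, ‖η‖ ≤ c * ‖ξ‖ → ξ - η ∈ Γ)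
    (hgrowth : ∀ ε > 0, ∃ C, 0 ≤ C ∧ ∀ ξ, ‖F ξ‖ ≤ C * Real.exp (ε * ‖ξ‖ ^ 2)) {n : ℕ} {C₁ : ℝ}
    (hC₁ : 0 ≤ C₁) (hdecay : ∀ ξ ∈ Γ, ‖F ξ‖ * bracket ξ ^ n ≤ C₁) {b : ℝ} (hb : 0 < b) :
    ∃ C, 0 ≤ C ∧ ∀ ξ ∈ Γ', ∀ η, bracket ξ ^ n * (Real.exp (-b * ‖η‖ ^ 2) * ‖F (ξ - η)‖) ≤
      C * Real.exp (-(b / 2) * ‖η‖ ^ 2) := by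
  -- When `‖η‖ > c ‖ξ‖`, both `‖ξ - η‖ ≤ k ‖η‖` and `‖ξ‖ ≤ ‖η‖ / c` hold. The growth rate of `F` and
  -- that of `⟨ξ⟩^n` are chosen so that each costs at most `e^{b‖η‖²/4}`, which leaves half of the
  -- Gaussian.
  set k : ℝ := 1 + 1 / c with hk
  have hk0 : 0 < k := by positivity
  obtain ⟨C₂, hC₂, hF⟩ := hgrowth (b / (4 * k ^ 2)) (by positivity)
  obtain ⟨C₃, hC₃, hB⟩ := exists_bracket_pow_le_exp (d := d) n (κ := b / 4 * c ^ 2) (by positivity)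
  refine ⟨2 ^ n * C₁ + C₃ * C₂, by positivity, fun ξ hξ η => ?_⟩
  have hbr := bracket_pos ξ
  rcases le_or_gt ‖η‖ (c * ‖ξ‖) with h | h
  · have h1 := hdecay _ (hΓ ξ hξ η h)
    have h2 : bracket ξ ≤ 2 * bracket (ξ - η) := by
      apply bracket_le_of_norm_le (by norm_num)
      have : ‖ξ‖ ≤ ‖ξ - η‖ + ‖η‖ := by simpa using norm_add_le (ξ - η) η
      nlinarith [norm_nonneg ξ]
    calc bracket ξ ^ n * (Real.exp (-b * ‖η‖ ^ 2) * ‖F (ξ - η)‖)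
        ≤ (2 * bracket (ξ - η)) ^ n * (Real.exp (-b * ‖η‖ ^ 2) * ‖F (ξ - η)‖) := by gcongr
      _ = 2 ^ n * (‖F (ξ - η)‖ * bracket (ξ - η) ^ n) * Real.exp (-b * ‖η‖ ^ 2) := by
          rw [mul_pow]; ring
      _ ≤ 2 ^ n * C₁ * Real.exp (-(b / 2) * ‖η‖ ^ 2) := by
          gcongr
          nlinarith [sq_nonneg ‖η‖]
      _ ≤ _ := by
          gcongr
          nlinarith
  · have h1 : ‖ξ - η‖ ≤ k * ‖η‖ := by
      have h2 : ‖ξ‖ ≤ 1 / c * ‖η‖ := by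
        rw [div_mul_eq_mul_div, one_mul, le_div_iff₀ hc]; linarith
      calc ‖ξ - η‖ ≤ ‖ξ‖ + ‖η‖ := norm_sub_le _ _
        _ ≤ _ := by rw [hk]; linarith
    have h3 : b / (4 * k ^ 2) * ‖ξ - η‖ ^ 2 ≤ b / 4 * ‖η‖ ^ 2 := by
      calc b / (4 * k ^ 2) * ‖ξ - η‖ ^ 2 ≤ b / (4 * k ^ 2) * (k * ‖η‖) ^ 2 := by gcongr
        _ = _ := by field_simp
    have h4 : b / 4 * c ^ 2 * ‖ξ‖ ^ 2 ≤ b / 4 * ‖η‖ ^ 2 := by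
      have : (c * ‖ξ‖) ^ 2 ≤ ‖η‖ ^ 2 := by gcongr
      nlinarith
    calc bracket ξ ^ n * (Real.exp (-b * ‖η‖ ^ 2) * ‖F (ξ - η)‖)
        ≤ (C₃ * Real.exp (b / 4 * ‖η‖ ^ 2)) * (Real.exp (-b * ‖η‖ ^ 2) *
          (C₂ * Real.exp (b / 4 * ‖η‖ ^ 2))) := by
          gcongr
          · exact (hB ξ).trans (by gcongr)
          · exact (hF _).trans (by gcongr)
      _ = C₃ * C₂ * Real.exp (-(b / 2) * ‖η‖ ^ 2) := by
          have : Real.exp (-(b / 2) * ‖η‖ ^ 2) = Real.exp (b / 4 * ‖η‖ ^ 2) *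
              (Real.exp (-b * ‖η‖ ^ 2) * Real.exp (b / 4 * ‖η‖ ^ 2)) := by
            rw [← Real.exp_add, ← Real.exp_add]; ring_nf
          rw [this]; ring
      _ ≤ _ := by
          gcongr
          have : (0 : ℝ) ≤ 2 ^ n * C₁ := by positivity
          linarith

/-! ### Changing the width of the Gaussian window -/

theorem gaussianSTFT_growth {d : ℕ} {L : GS d →ₗ[ℂ] ℂ} (hL : GSContinuous L) (x₀ : Rd d) (M : ℕ+) :
    ∀ ε > 0, ∃ C, 0 ≤ C ∧ ∀ ξ, ‖gaussianSTFT L x₀ M ξ‖ ≤ C * Real.exp (ε * ‖ξ‖ ^ 2) := by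
  intro ε hε
  obtain ⟨A, C, hA, hC, h⟩ := exists_GSBound_gaussianWave x₀ M hε
  obtain ⟨C', hC'⟩ := hL A hA
  refine ⟨|C'| * C, by positivity, fun ξ => ?_⟩
  refine (hC' ⟨_, gaussianWave_mem x₀ M ξ⟩ _ (by positivity) (h ξ)).trans ?_
  rw [mul_assoc]
  gcongr
  exact le_abs_self _

theorem eventually_GSBound_gaussianWave_sub {d : ℕ} {x₀ : Rd d} {M : ℕ+} {A C ε : ℝ} (hA : 0 < A)
    (hC : 0 ≤ C)
    (h : ∀ ξ ξ' : Rd d, ‖ξ' - ξ‖ ≤ 1 → GSBound A (C * Real.exp (ε * ‖ξ‖ ^ 2) * ‖ξ' - ξ‖)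
        (gaussianWave x₀ M ξ' - gaussianWave x₀ M ξ)) (ξ : Rd d) {δ : ℝ} (hδ : 0 < δ) :
    ∀ᶠ ξ' in 𝓝 ξ, GSBound A δ (gaussianWave x₀ M ξ' - gaussianWave x₀ M ξ) := by
  have h1 : Tendsto (fun ξ' => C * Real.exp (ε * ‖ξ‖ ^ 2) * ‖ξ' - ξ‖) (𝓝 ξ) (𝓝 0) := by
    have : Continuous fun ξ' => C * Real.exp (ε * ‖ξ‖ ^ 2) * ‖ξ' - ξ‖ := by fun_prop
    simpa using this.tendsto ξ
  filter_upwards [h1.eventually_lt_const hδ, Metric.ball_mem_nhds ξ one_pos] with ξ' h2 h3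
  rw [Metric.mem_ball, dist_eq_norm] at h3
  exact (h ξ ξ' h3.le).mono hA.le le_rfl (by positivity) h2.le

theorem continuous_gaussianSTFT {d : ℕ} {L : GS d →ₗ[ℂ] ℂ} (hL : GSContinuous L) (x₀ : Rd d)
    (M : ℕ+) : Continuous (gaussianSTFT L x₀ M) := by
  obtain ⟨A, C, hA, hC, -, h⟩ := exists_GSBound_gaussianWave_sub x₀ M one_pos
  obtain ⟨C', hC'⟩ := hL A hA
  rw [continuous_iff_continuousAt]
  intro ξ
  rw [ContinuousAt, Metric.tendsto_nhds]
  intro δ hδ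
  filter_upwards [eventually_GSBound_gaussianWave_sub hA hC h ξ
    (δ := δ / (|C'| + 1)) (by positivity)] with ξ' h'
  let g : Rd d → GS d := fun ξ => ⟨gaussianWave x₀ M ξ, gaussianWave_mem x₀ M ξ⟩
  have e : gaussianSTFT L x₀ M ξ' - gaussianSTFT L x₀ M ξ = L (g ξ' - g ξ) :=
    (L.map_sub (g ξ') (g ξ)).symm
  have hb : ‖L (g ξ' - g ξ)‖ ≤ C' * (δ / (|C'| + 1)) :=
    hC' (g ξ' - g ξ) (δ / (|C'| + 1)) (by positivity) h'
  rw [dist_eq_norm, e]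
  refine hb.trans_lt ?_
  calc C' * (δ / (|C'| + 1)) ≤ |C'| * (δ / (|C'| + 1)) := by gcongr; exact le_abs_self _
    _ < (|C'| + 1) * (δ / (|C'| + 1)) := by gcongr; linarith
    _ = δ := by field_simp

/-- The modulated Gaussian probability density whose Fourier transform is a Gaussian centred at
`x₀`. -/
noncomputable def gaussDensity {d : ℕ} (b : ℝ) (x₀ η : Rd d) : ℂ :=
  ((Real.pi / b : ℂ) ^ (d / 2 : ℂ))⁻¹ *
    Complex.exp (-(b : ℂ) * (‖η‖ : ℂ) ^ 2 - Complex.I * ((inner ℝ x₀ η : ℝ) : ℂ))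

theorem continuous_gaussDensity {d : ℕ} (b : ℝ) (x₀ : Rd d) : Continuous (gaussDensity b x₀) := by
  unfold gaussDensity; fun_prop

theorem norm_gaussDensity {d : ℕ} (b : ℝ) (x₀ η : Rd d) :
    ‖gaussDensity b x₀ η‖ = ‖((Real.pi / b : ℂ) ^ (d / 2 : ℂ))⁻¹‖ * Real.exp (-b * ‖η‖ ^ 2) := by
  rw [gaussDensity, norm_mul, Complex.norm_exp]
  congr 2
  rw [← Complex.ofReal_pow, ← Complex.ofReal_neg, ← Complex.ofReal_mul, Complex.sub_re,
    Complex.ofReal_re]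
  simp

theorem gaussianWave_sub {d : ℕ} (x₀ : Rd d) (M : ℕ+) (ξ η x : Rd d) :
    gaussianWave x₀ M (ξ - η) x =
      gaussianWave x₀ M ξ x * Complex.exp (Complex.I * ((inner ℝ x η : ℝ) : ℂ)) := by
  unfold gaussianWave
  rw [← Complex.exp_add, inner_sub_right]
  push_cast
  ring_nf

/-- The narrower window factors as `E_{x₀,M'} = E_{x₀,M} · e^{-|x-x₀|²/(4b)}` with `1/b = 1/M' -
1/M`, and the last factor is the Fourier transform of `gaussDensity b x₀`. This transfers
information from large widths to smaller ones. -/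
theorem gaussianWave_eq_integral {d : ℕ} (x₀ : Rd d) {M M' : ℕ+} (hM : M' < M) {b : ℝ}
    (hb : b = ((M' : ℝ)⁻¹ - (M : ℝ)⁻¹)⁻¹) (ξ x : Rd d) :
    gaussianWave x₀ M' ξ x = ∫ η, gaussDensity b x₀ η * gaussianWave x₀ M (ξ - η) x := by
  have hM0 : (0 : ℝ) < M' := by exact_mod_cast M'.pos
  have hM1 : (0 : ℝ) < M := by exact_mod_cast M.pos
  have hMM : (M' : ℝ) < M := by exact_mod_cast hM
  have hinv : (M : ℝ)⁻¹ < (M' : ℝ)⁻¹ := by gcongr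
  have hb0 : 0 < b := by rw [hb]; exact inv_pos.2 (by linarith)
  have h1 := GaussianFourier.integral_cexp_neg_mul_sq_norm_add (V := Rd d) (b := (b : ℂ))
    (by simpa using hb0) Complex.I (x - x₀)
  have hne : ((Real.pi / b : ℂ) ^ (d / 2 : ℂ)) ≠ 0 := by
    rw [Ne, Complex.cpow_eq_zero_iff, not_and_or]
    left
    have : (b : ℂ) ≠ 0 := by exact_mod_cast hb0.ne'
    exact div_ne_zero (by exact_mod_cast Real.pi_ne_zero) this
  have h2 : ∀ η, gaussDensity b x₀ η * gaussianWave x₀ M (ξ - η) x =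
      (((Real.pi / b : ℂ) ^ (d / 2 : ℂ))⁻¹ * gaussianWave x₀ M ξ x) *
        Complex.exp (-(b : ℂ) * (‖η‖ : ℂ) ^ 2 + Complex.I * ((inner ℝ (x - x₀) η : ℝ) : ℂ)) := by
    intro η
    rw [gaussianWave_sub, gaussDensity]
    have : Complex.exp (-(b : ℂ) * (‖η‖ : ℂ) ^ 2 - Complex.I * ((inner ℝ x₀ η : ℝ) : ℂ)) *
        Complex.exp (Complex.I * ((inner ℝ x η : ℝ) : ℂ)) =
        Complex.exp (-(b : ℂ) * (‖η‖ : ℂ) ^ 2 + Complex.I * ((inner ℝ (x - x₀) η : ℝ) : ℂ)) := by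
      rw [← Complex.exp_add, inner_sub_left]
      push_cast
      ring_nf
    rw [← this]
    ring
  simp_rw [h2]
  rw [integral_const_mul, h1, finrank_euclideanSpace, Fintype.card_fin]
  rw [mul_right_comm, ← mul_assoc, inv_mul_cancel₀ hne, one_mul]
  unfold gaussianWave
  rw [← Complex.exp_add]
  congr 1
  have hbi : (b : ℂ)⁻¹ = (M' : ℂ)⁻¹ - (M : ℂ)⁻¹ := by rw [hb]; push_cast; rw [inv_inv]
  rw [Complex.I_sq]
  have e1 : (-1 * (‖x - x₀‖ : ℂ) ^ 2 / (4 * b)) = -(‖x - x₀‖ : ℂ) ^ 2 / 4 * (b : ℂ)⁻¹ := by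
    rw [div_eq_mul_inv, mul_inv]; ring
  rw [e1, hbi]
  push_cast
  have h3 : (M : ℂ) ≠ 0 := by exact_mod_cast hM1.ne'
  have h4 : (M' : ℂ) ≠ 0 := by exact_mod_cast hM0.ne'
  field_simp
  ring

theorem norm_gaussianWave_le_one {d : ℕ} (x₀ : Rd d) (M : ℕ+) (ξ x : Rd d) :
    ‖gaussianWave x₀ M ξ x‖ ≤ 1 := by
  rw [norm_gaussianWave, Real.exp_le_one_iff]
  have : (0 : ℝ) < (M : ℝ) := by exact_mod_cast M.pos
  have : 0 ≤ ‖x - x₀‖ ^ 2 / (4 * (M : ℝ)) := by positivity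
  linarith

theorem fderiv_gaussianWave_single {d : ℕ} (x₀ : Rd d) (M : ℕ+) (ξ x : Rd d) (j : Fin d) :
    fderiv ℝ (gaussianWave x₀ M ξ) x (EuclideanSpace.single j 1) =
      -((1 / (2 * (M : ℂ))) * (x j - x₀ j : ℝ) + Complex.I * (ξ j : ℝ)) * gaussianWave x₀ M ξ x := by
  rw [fderiv_gaussianWave]
  have h : ∀ v : Rd d, inner ℝ v (EuclideanSpace.single j (1 : ℝ)) = v j := by
    intro v
    rw [EuclideanSpace.inner_single_right]
    simp
  simp only [smul_apply, add_apply, sub_apply, innerCBilin_apply, innerC_apply, h, smul_eq_mul,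
    Complex.real_smul]
  push_cast
  ring

theorem norm_coord_le {d : ℕ} (η : Rd d) (j : Fin d) : ‖((η j : ℝ) : ℂ)‖ ≤ ‖η‖ := by
  rw [Complex.norm_real]
  exact PiLp.norm_apply_le η j

theorem exists_norm_le_exp {d : ℕ} {κ : ℝ} (hκ : 0 < κ) :
    ∃ C, 0 < C ∧ ∀ η : Rd d, ‖η‖ ≤ C * Real.exp (κ * ‖η‖ ^ 2) := by
  obtain ⟨C, hC, h⟩ := exists_bracket_pow_le_exp (d := d) 1 hκ
  exact ⟨C, hC, fun η => (norm_le_bracket η).trans (by simpa using h η)⟩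

theorem integrable_gaussDensity_mul {d : ℕ} {b : ℝ} (x₀ : Rd d) {f : Rd d → ℂ}
    (hf : Continuous f) {C κ : ℝ} (hκ : κ < b) (h : ∀ η, ‖f η‖ ≤ C * Real.exp (κ * ‖η‖ ^ 2)) :
    Integrable fun η => gaussDensity b x₀ η * f η := by
  refine ((integrable_exp_neg_mul_sq_norm (d := d) (b := b - κ) (by linarith)).const_mul
    (‖((Real.pi / b : ℂ) ^ (d / 2 : ℂ))⁻¹‖ * C)).mono'
    ((continuous_gaussDensity b x₀).mul hf).aestronglyMeasurable (Eventually.of_forall fun η => ?_)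
  rw [norm_mul, norm_gaussDensity]
  calc _ ≤ ‖((Real.pi / b : ℂ) ^ (d / 2 : ℂ))⁻¹‖ * Real.exp (-b * ‖η‖ ^ 2) *
        (C * Real.exp (κ * ‖η‖ ^ 2)) := by gcongr; exact h η
    _ = ‖((Real.pi / b : ℂ) ^ (d / 2 : ℂ))⁻¹‖ * C *
        (Real.exp (-b * ‖η‖ ^ 2) * Real.exp (κ * ‖η‖ ^ 2)) := by ring
    _ = _ := by rw [← Real.exp_add]; ring_nf

theorem continuous_coord {d : ℕ} (j : Fin d) : Continuous fun η : Rd d => ((η j : ℝ) : ℂ) := by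
  fun_prop

/-- The derivative of a Gaussian wave as a superposition of waves with a wider window. -/
theorem partial_gaussianWave_eq_integral {d : ℕ} (x₀ : Rd d) {M M' : ℕ+} (hM : M' < M) {b : ℝ}
    (hb : b = ((M' : ℝ)⁻¹ - (M : ℝ)⁻¹)⁻¹) (ξ x : Rd d) (j : Fin d) :
    fderiv ℝ (gaussianWave x₀ M' ξ) x (EuclideanSpace.single j 1) =
      ∫ η, (Complex.I * ((b / M' : ℂ) * (η j : ℝ) - (ξ j : ℝ)) * gaussDensity b x₀ η) *
        gaussianWave x₀ M (ξ - η) x := by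
  have hM0 : (0 : ℝ) < M' := by exact_mod_cast M'.pos
  have hM1 : (0 : ℝ) < M := by exact_mod_cast M.pos
  have hMM : (M' : ℝ) < M := by exact_mod_cast hM
  have hinv : (M : ℝ)⁻¹ < (M' : ℝ)⁻¹ := by gcongr
  have hb0 : 0 < b := by rw [hb]; exact inv_pos.2 (by linarith)
  obtain ⟨A, C, hA, hC, hK, hK'⟩ := exists_GSBound_gaussianWave_sub x₀ M (ε := b / 4) (by positivity)
  let g : Rd d → GS d := fun η => ⟨gaussianWave x₀ M (ξ - η), gaussianWave_mem x₀ M (ξ - η)⟩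
  have hcont : ∀ a, ∀ ε > 0, ∀ᶠ η in 𝓝 a, GSBound A ε ((g η).1 - (g a).1) := by
    intro a ε hε
    have h1 : Tendsto (fun η : Rd d => ξ - η) (𝓝 a) (𝓝 (ξ - a)) := by
      have : Continuous fun η : Rd d => ξ - η := by fun_prop
      exact this.tendsto a
    exact h1.eventually (eventually_GSBound_gaussianWave_sub hA hC hK' (ξ - a) hε)
  have hint : Integrable (fun η => ‖gaussDensity b x₀ η‖ * (C * Real.exp (b / 4 * ‖ξ - η‖ ^ 2))) := by
    have h1 := (integrable_gaussDensity_mul x₀ (b := b) (κ := b / 2)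
      (f := fun η => ((C * Real.exp (b / 4 * ‖ξ - η‖ ^ 2) : ℝ) : ℂ)) (by fun_prop) (by linarith)
      (C := C * Real.exp (b / 2 * ‖ξ‖ ^ 2)) ?_).norm
    · refine h1.congr (Eventually.of_forall fun η => ?_)
      simp only [norm_mul, Complex.norm_real]
      rw [Real.norm_of_nonneg hC, Real.norm_of_nonneg (Real.exp_pos _).le]
    · intro η
      rw [Complex.norm_real, Real.norm_of_nonneg (by positivity), mul_assoc, ← Real.exp_add]
      gcongr
      have h2 : ‖ξ - η‖ ^ 2 ≤ (‖ξ‖ + ‖η‖) ^ 2 := by gcongr; exact norm_sub_le _ _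
      nlinarith [sq_nonneg (‖ξ‖ - ‖η‖), mul_le_mul_of_nonneg_left h2 hb0.le]
  -- Differentiating the superposition formula itself yields the first Gaussian moment: comparing
  -- the derivatives of the two sides expresses the integral with the weight `η j` through `(x j -
  -- x₀ j)` times the wave.
  have hfd := iteratedFDeriv_gs_integral hA (continuous_gaussDensity b x₀) (g := g)
    (fun η => hK (ξ - η)) hcont hint 1 x
  have hwave : (fun x => ∫ η, gaussDensity b x₀ η * (g η).1 x) = gaussianWave x₀ M' ξ :=
    funext fun y => (gaussianWave_eq_integral x₀ hM hb ξ y).symm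
  rw [hwave] at hfd
  have hi : Integrable fun η => gaussDensity b x₀ η • iteratedFDeriv ℝ 1 (g η).1 x := by
    refine (hint.mul_const (A ^ (0 + 1) * (√(0 ! : ℝ) * √(1 ! : ℝ)))).mono'
      ((continuous_gaussDensity b x₀).smul
        (continuous_iteratedFDeriv_of_gsBound hA hcont 1 x)).aestronglyMeasurable
      (Eventually.of_forall fun η => ?_)
    rw [norm_smul, mul_assoc]
    gcongr
    have := hK (ξ - η) 0 1 x
    rw [pow_zero, one_mul] at this
    change ‖iteratedFDeriv ℝ 1 (gaussianWave x₀ M (ξ - η)) x‖ ≤ _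
    linarith
  have h3 := congrArg (fun T : ContinuousMultilinearMap ℝ (fun _ : Fin 1 => Rd d) ℂ =>
    T (fun _ => EuclideanSpace.single j 1)) hfd
  rw [ContinuousMultilinearMap.integral_apply hi] at h3
  simp only [iteratedFDeriv_one_apply, smul_apply, smul_eq_mul, g] at h3
  have hI0 : Integrable fun η => gaussDensity b x₀ η * gaussianWave x₀ M (ξ - η) x := by
    refine integrable_gaussDensity_mul x₀ (κ := 0) (C := 1) ?_ hb0 fun η => ?_
    · simp_rw [gaussianWave_sub]; fun_prop
    · simpa using norm_gaussianWave_le_one x₀ M (ξ - η) x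
  have hI1 : Integrable fun η => gaussDensity b x₀ η * (((η j : ℝ) : ℂ) * gaussianWave x₀ M (ξ - η) x) := by
    obtain ⟨C', hC', h'⟩ := exists_norm_le_exp (d := d) (κ := b / 2) (by positivity)
    refine integrable_gaussDensity_mul x₀ (κ := b / 2) (C := C') ?_ (by linarith) fun η => ?_
    · simp_rw [gaussianWave_sub]; fun_prop
    · rw [norm_mul]
      calc _ ≤ ‖η‖ * 1 := by
            gcongr
            · exact norm_coord_le η j
            · exact norm_gaussianWave_le_one _ _ _ _
        _ ≤ _ := by simpa using h' η
  set S0 := ∫ η, gaussDensity b x₀ η * gaussianWave x₀ M (ξ - η) x with hS0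
  set S1 := ∫ η, gaussDensity b x₀ η * (((η j : ℝ) : ℂ) * gaussianWave x₀ M (ξ - η) x) with hS1
  have hg : gaussianWave x₀ M' ξ x = S0 := gaussianWave_eq_integral x₀ hM hb ξ x
  have h4 : (∫ η, gaussDensity b x₀ η * fderiv ℝ (gaussianWave x₀ M (ξ - η)) x
      (EuclideanSpace.single j 1)) =
      -((1 / (2 * (M : ℂ))) * (x j - x₀ j : ℝ) + Complex.I * (ξ j : ℝ)) * S0 + Complex.I * S1 := by
    rw [hS0, hS1, ← integral_const_mul, ← integral_const_mul, ← integral_add (hI0.const_mul _)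
      (hI1.const_mul _)]
    refine integral_congr_ae (Eventually.of_forall fun η => ?_)
    simp only [fderiv_gaussianWave_single, PiLp.sub_apply]
    push_cast
    ring
  have h5 : (∫ η, (Complex.I * ((b / M' : ℂ) * (η j : ℝ) - (ξ j : ℝ)) * gaussDensity b x₀ η) *
        gaussianWave x₀ M (ξ - η) x) =
      (Complex.I * (b / M' : ℂ)) * S1 - (Complex.I * (ξ j : ℝ)) * S0 := by
    rw [hS0, hS1, ← integral_const_mul, ← integral_const_mul, ← integral_sub (hI1.const_mul _)
      (hI0.const_mul _)]
    refine integral_congr_ae (Eventually.of_forall fun η => ?_)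
    simp only
    ring
  rw [h4, fderiv_gaussianWave_single, hg] at h3
  rw [h5, fderiv_gaussianWave_single, hg]
  have hbc : (b : ℂ) * ((M' : ℂ)⁻¹ - (M : ℂ)⁻¹) = 1 := by
    have : b * ((M' : ℝ)⁻¹ - (M : ℝ)⁻¹) = 1 := by
      rw [hb]; exact inv_mul_cancel₀ (by linarith)
    have h7 := congrArg (fun r : ℝ => (r : ℂ)) this
    push_cast at h7
    exact h7
  have hM0' : (M' : ℂ) ≠ 0 := by exact_mod_cast hM0.ne'
  have hM1' : (M : ℂ) ≠ 0 := by exact_mod_cast hM1.ne'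
  -- `h3` expresses `S1` through `(x j - x₀ j) S0`
  have h6 : Complex.I * S1 = -((2 : ℂ)⁻¹ * ((M' : ℂ)⁻¹ - (M : ℂ)⁻¹) * (x j - x₀ j : ℝ)) * S0 := by
    rw [show (1 : ℂ) / (2 * (M : ℂ)) = 2⁻¹ * (M : ℂ)⁻¹ by rw [one_div, mul_inv],
      show (1 : ℂ) / (2 * (M' : ℂ)) = 2⁻¹ * (M' : ℂ)⁻¹ by rw [one_div, mul_inv]] at h3
    linear_combination -h3
  rw [show Complex.I * (b / M' : ℂ) * S1 = (b : ℂ) * (M' : ℂ)⁻¹ * (Complex.I * S1) by ring, h6,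
    show (1 : ℂ) / (2 * (M' : ℂ)) = 2⁻¹ * (M' : ℂ)⁻¹ by rw [one_div, mul_inv]]
  linear_combination ((M' : ℂ)⁻¹ * 2⁻¹ * (x j - x₀ j : ℝ) * S0) * hbc

/-! ### Rapid decay of the Gaussian transform in a cone -/

/-- The Gaussian transforms of `L` at `x₀`, for every width, decay rapidly in a cone around `ξ₀`
(without any uniformity in the width). -/
def RapidAt {d : ℕ} (L : GS d →ₗ[ℂ] ℂ) (x₀ ξ₀ : Rd d) : Prop :=
  ∃ Γ : Set (Rd d), IsConeNhd Γ ξ₀ ∧ ∀ (M : ℕ+) (n : ℕ), ∃ C : ℝ, ∀ ξ ∈ Γ,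
    ‖gaussianSTFT L x₀ M ξ‖ * bracket ξ ^ n ≤ C

/-- Waves have growth `e^{b‖ξ-η‖²/4} ≤ e^{b‖ξ‖²/2} e^{b‖η‖²/2}` in a fixed step, which a density of
size `e^{-b‖η‖²}` makes integrable. -/
theorem GSContinuous.apply_superposition {d : ℕ} {L : GS d →ₗ[ℂ] ℂ} (hL : GSContinuous L)
    {x₀ : Rd d} {M : ℕ+} {b : ℝ} (hb : 0 < b) {Ψ : Rd d → ℂ} (hΨ : Continuous Ψ) {C : ℝ}
    (hC : ∀ η, ‖Ψ η‖ ≤ C * Real.exp (-b * ‖η‖ ^ 2)) (ξ : Rd d) (h : GS d)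
    (hh : ∀ x, h.1 x = ∫ η, Ψ η * gaussianWave x₀ M (ξ - η) x) :
    L h = ∫ η, Ψ η * gaussianSTFT L x₀ M (ξ - η) := by
  obtain ⟨A, C', hA, hC', hK, hK'⟩ :=
    exists_GSBound_gaussianWave_sub x₀ M (ε := b / 4) (by positivity)
  refine hL.apply_eq_integral hA hΨ (g := fun η => ⟨gaussianWave x₀ M (ξ - η),
    gaussianWave_mem x₀ M (ξ - η)⟩) (K := fun η => C' * Real.exp (b / 4 * ‖ξ - η‖ ^ 2))
    (fun η => by positivity) (fun η => hK (ξ - η)) ?_ ?_ h hh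
  · intro a ε hε
    have h1 : Tendsto (fun η : Rd d => ξ - η) (𝓝 a) (𝓝 (ξ - a)) := by
      have : Continuous fun η : Rd d => ξ - η := by fun_prop
      exact this.tendsto a
    exact h1.eventually (eventually_GSBound_gaussianWave_sub hA hC' hK' (ξ - a) hε)
  · refine ((integrable_exp_neg_mul_sq_norm (d := d) (b := b / 2) (by linarith)).const_mul
      (C * C' * Real.exp (b / 2 * ‖ξ‖ ^ 2))).mono' (by fun_prop) (Eventually.of_forall fun η => ?_)
    have hC0 : 0 ≤ C := by
      have := (norm_nonneg _).trans (hC 0)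
      simpa using this
    rw [Real.norm_of_nonneg (by positivity)]
    have h2 : b / 4 * ‖ξ - η‖ ^ 2 ≤ b / 2 * ‖ξ‖ ^ 2 + b / 2 * ‖η‖ ^ 2 := by
      have h2 : ‖ξ - η‖ ^ 2 ≤ (‖ξ‖ + ‖η‖) ^ 2 := by gcongr; exact norm_sub_le _ _
      nlinarith [sq_nonneg (‖ξ‖ - ‖η‖), mul_le_mul_of_nonneg_left h2 hb.le]
    calc ‖Ψ η‖ * (C' * Real.exp (b / 4 * ‖ξ - η‖ ^ 2))
        ≤ (C * Real.exp (-b * ‖η‖ ^ 2)) *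
          (C' * Real.exp (b / 2 * ‖ξ‖ ^ 2 + b / 2 * ‖η‖ ^ 2)) := by
          gcongr
          exact hC η
      _ = C * C' * Real.exp (b / 2 * ‖ξ‖ ^ 2) *
          (Real.exp (-b * ‖η‖ ^ 2) * Real.exp (b / 2 * ‖η‖ ^ 2)) := by rw [Real.exp_add]; ring
      _ = _ := by rw [← Real.exp_add]; ring_nf

/-- Superpositions inherit the decay of the transform in a smaller cone. -/
theorem exists_superposition_bound {d : ℕ} {L : GS d →ₗ[ℂ] ℂ} (hL : GSContinuous L)
    {x₀ : Rd d} {M : ℕ+} {Γ Γ' : Set (Rd d)} {c : ℝ}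
    (hc : 0 < c) (hc2 : c ≤ 1 / 2) (hΓ : ∀ ξ ∈ Γ', ∀ η : Rd d, ‖η‖ ≤ c * ‖ξ‖ → ξ - η ∈ Γ)
    {n : ℕ} {C₁ : ℝ} (hdecay : ∀ ξ ∈ Γ, ‖gaussianSTFT L x₀ M ξ‖ * bracket ξ ^ (n + 1) ≤ C₁)
    {b : ℝ} (hb : 0 < b) {Ψ : Rd d → Rd d → ℂ} (hΨ : ∀ ξ, Continuous (Ψ ξ)) {C : ℝ} (hC0 : 0 ≤ C)
    (hC : ∀ ξ η, ‖Ψ ξ η‖ ≤ C * bracket ξ * Real.exp (-b * ‖η‖ ^ 2)) (h : Rd d → GS d)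
    (hh : ∀ ξ x, (h ξ).1 x = ∫ η, Ψ ξ η * gaussianWave x₀ M (ξ - η) x) :
    ∃ C', ∀ ξ ∈ Γ', ‖L (h ξ)‖ * bracket ξ ^ n ≤ C' := by
  -- The order `n + 1` is needed for the conclusion of order `n`, because the density may grow like
  -- `⟨ξ⟩`; this happens when the wave is differentiated.
  obtain ⟨C₂, hC₂, hb2⟩ := exists_gaussian_mul_shift_le hc hc2 hΓ (gaussianSTFT_growth hL x₀ M)
    (n := n + 1) (C₁ := max C₁ 0) (le_max_right _ _) (fun ξ hξ => (hdecay ξ hξ).trans (le_max_left _ _)) hb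
  refine ⟨C * C₂ * ∫ η : Rd d, Real.exp (-(b / 2) * ‖η‖ ^ 2), fun ξ hξ => ?_⟩
  rw [hL.apply_superposition hb (hΨ ξ) (hC ξ) ξ (h ξ) (hh ξ)]
  have hbr := bracket_pos ξ
  rw [mul_comm, ← integral_const_mul]
  have h1 : ‖∫ η, Ψ ξ η * gaussianSTFT L x₀ M (ξ - η)‖ ≤
      ∫ η : Rd d, (C * C₂ * Real.exp (-(b / 2) * ‖η‖ ^ 2)) * (bracket ξ ^ n)⁻¹ := by
    refine norm_integral_le_of_norm_le
      (((integrable_exp_neg_mul_sq_norm (by linarith)).const_mul _).mul_const _)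
      (Eventually.of_forall fun η => ?_)
    rw [norm_mul, le_mul_inv_iff₀ (by positivity)]
    calc ‖Ψ ξ η‖ * ‖gaussianSTFT L x₀ M (ξ - η)‖ * bracket ξ ^ n
        ≤ C * bracket ξ * Real.exp (-b * ‖η‖ ^ 2) * ‖gaussianSTFT L x₀ M (ξ - η)‖ *
          bracket ξ ^ n := by gcongr; exact hC ξ η
      _ = C * (bracket ξ ^ (n + 1) * (Real.exp (-b * ‖η‖ ^ 2) *
          ‖gaussianSTFT L x₀ M (ξ - η)‖)) := by ring
      _ ≤ C * (C₂ * Real.exp (-(b / 2) * ‖η‖ ^ 2)) :=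
        mul_le_mul_of_nonneg_left (hb2 ξ hξ η) hC0
      _ = _ := by ring
  rw [integral_mul_const] at h1
  calc _ ≤ bracket ξ ^ n * ((∫ η : Rd d, C * C₂ * Real.exp (-(b / 2) * ‖η‖ ^ 2)) * (bracket ξ ^ n)⁻¹) := by
        gcongr
    _ = _ := by field_simp

theorem width_pos {M M' : ℕ+} (hM : M' < M) : 0 < ((M' : ℝ)⁻¹ - (M : ℝ)⁻¹)⁻¹ := by
  have hM0 : (0 : ℝ) < M' := by exact_mod_cast M'.pos
  have hMM : (M' : ℝ) < M := by exact_mod_cast hM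
  have hinv : (M : ℝ)⁻¹ < (M' : ℝ)⁻¹ := by gcongr
  exact inv_pos.2 (by linarith)

/-- The estimate speaks of widths `vN` only for large `N`. A given width `M'` is reached from above
by superposition, with one `N` so large that `vN > M'` and the order `n + 1` is allowed. -/
theorem GevreyEstimate.rapidAt {d : ℕ} {s : ℝ} {L : GS d →ₗ[ℂ] ℂ} (hL : GSContinuous L)
    {x₀ ξ₀ : Rd d} (h : GevreyEstimate s L x₀ ξ₀) : RapidAt L x₀ ξ₀ := by
  obtain ⟨Γ, hΓ1, hΓ2, hΓ3, v, N₀, C, hC, hest⟩ := h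
  obtain ⟨Γ', c, hΓ', hc, hc2, hsub⟩ := IsConeNhd.exists_shrink ⟨hΓ1, hΓ2, hΓ3⟩
  refine ⟨Γ', hΓ', fun M' n => ?_⟩
  let N : ℕ+ := N₀ + M' + ⟨n + 1, Nat.succ_pos n⟩
  have hN : (N : ℕ) = N₀ + M' + (n + 1) := rfl
  have hN0 : N₀ < N := by
    rw [← PNat.coe_lt_coe, hN]; omega
  have hNv : M' < v * N := by
    rw [← PNat.coe_lt_coe, PNat.mul_coe]
    have hv : 1 ≤ (v : ℕ) := v.pos
    nlinarith
  set b : ℝ := ((M' : ℝ)⁻¹ - ((v * N : ℕ+) : ℝ)⁻¹)⁻¹ with hb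
  have hb0 : 0 < b := width_pos hNv
  refine exists_superposition_bound hL (M := v * N) hc hc2 hsub (n := n)
    (C₁ := C ^ (n + 1 + 1) * ((n + 1 : ℕ) : ℝ) ^ (s * ((n + 1 : ℕ) : ℝ))) (fun ξ hξ => ?_) hb0
    (Ψ := fun _ => gaussDensity b x₀) (fun _ => continuous_gaussDensity b x₀)
    (C := ‖((Real.pi / b : ℂ) ^ (d / 2 : ℂ))⁻¹‖) (norm_nonneg _) (fun ξ η => ?_)
    (fun ξ => ⟨gaussianWave x₀ M' ξ, gaussianWave_mem x₀ M' ξ⟩)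
    (fun ξ x => gaussianWave_eq_integral x₀ hNv hb ξ x)
  · have h1 := hest ξ hξ N hN0 (n + 1) (by rw [hN]; omega)
    rwa [le_div_iff₀ (pow_pos (bracket_pos ξ) _)] at h1
  · rw [norm_gaussDensity]
    gcongr
    exact le_mul_of_one_le_right (norm_nonneg _) (one_le_bracket ξ)

theorem GSContinuous.gsD {d : ℕ} {L : GS d →ₗ[ℂ] ℂ} (hL : GSContinuous L) (j : Fin d) :
    GSContinuous (gsD j L) := by
  intro A hA
  obtain ⟨C, hC⟩ := hL (2 * A) (by positivity)
  refine ⟨|C| * (A * 1), fun g K hK hg => ?_⟩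
  have h1 : ‖_root_.gsD j L g‖ = ‖L (GS.partial j g)‖ := by
    simp [_root_.gsD]
  have h2 : GSBound (2 * A) (A * K) (GS.partial j g).1 := by
    intro k n x
    have hf : ContDiff ℝ ∞ (fderiv ℝ g.1) := g.2.1.fderiv_right (by simp)
    have h1 : ‖iteratedFDeriv ℝ n (fun y => fderiv ℝ g.1 y (EuclideanSpace.single j 1)) x‖
        ≤ ‖iteratedFDeriv ℝ (n + 1) g.1 x‖ := by
      rw [← norm_iteratedFDeriv_fderiv]
      refine (norm_iteratedFDeriv_clm_apply_const (hf.contDiffAt (x := x)) (mod_cast le_top)).trans ?_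
      simp
    have h2 : √((n + 1)! : ℝ) ≤ 2 ^ (k + n) * √(n ! : ℝ) := by
      have h3 : ((n + 1 : ℕ) : ℝ) ≤ (2 ^ (k + n)) ^ 2 := by
        have ha : n + 1 ≤ 2 ^ (k + n) :=
          (Nat.lt_two_pow_self (n := n)).trans_le (Nat.pow_le_pow_right (by norm_num) (by omega))
        have hc : ((n + 1 : ℕ) : ℝ) ≤ 2 ^ (k + n) := by exact_mod_cast ha
        have hd : (1 : ℝ) ≤ 2 ^ (k + n) := one_le_pow₀ (by norm_num)
        nlinarith
      rw [Nat.factorial_succ]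
      push_cast at h3 ⊢
      rw [Real.sqrt_mul (by positivity)]
      gcongr
      exact (Real.sqrt_le_left (by positivity)).2 h3
    calc ‖x‖ ^ k * ‖iteratedFDeriv ℝ n (fun y => fderiv ℝ g.1 y (EuclideanSpace.single j 1)) x‖
        ≤ ‖x‖ ^ k * ‖iteratedFDeriv ℝ (n + 1) g.1 x‖ := by gcongr
      _ ≤ K * A ^ (k + (n + 1)) * (√(k ! : ℝ) * √((n + 1)! : ℝ)) := hg k (n + 1) x
      _ ≤ K * A ^ (k + (n + 1)) * (√(k ! : ℝ) * (2 ^ (k + n) * √(n ! : ℝ))) := by gcongr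
      _ = A * K * (2 * A) ^ (k + n) * (√(k ! : ℝ) * √(n ! : ℝ)) := by
          rw [mul_pow]; ring
  rw [h1]
  refine (hC _ _ (by positivity) h2).trans ?_
  calc C * (A * K) ≤ |C| * (A * K) := by gcongr; exact le_abs_self _
    _ = _ := by ring

/-- Differentiating the window produces a factor `x - x₀`, which is not a wave. In the superposition
over the next width it becomes a linear weight in `η`, and differentiating the exponential
contributes `ξ j`; the decay of one higher order pays for the latter. -/
theorem RapidAt.gsD {d : ℕ} {L : GS d →ₗ[ℂ] ℂ} (hL : GSContinuous L) {x₀ ξ₀ : Rd d}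
    (h : RapidAt L x₀ ξ₀) (j : Fin d) : RapidAt (gsD j L) x₀ ξ₀ := by
  obtain ⟨Γ, hΓ, hest⟩ := h
  obtain ⟨Γ', c, hΓ', hc, hc2, hsub⟩ := hΓ.exists_shrink
  refine ⟨Γ', hΓ', fun M' n => ?_⟩
  have hM : M' < M' + 1 := PNat.lt_add_right M' 1
  set b : ℝ := ((M' : ℝ)⁻¹ - ((M' + 1 : ℕ+) : ℝ)⁻¹)⁻¹ with hb
  have hb0 : 0 < b := width_pos hM
  obtain ⟨C₁, hC₁⟩ := hest (M' + 1) (n + 1)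
  -- Half of the Gaussian density is spent on the linear weight in `η`, so the superposition bound
  -- is applied with rate `b / 2`.
  obtain ⟨C₂, hC₂, hn⟩ := exists_bracket_pow_le_exp (d := d) 1 (κ := b / 2) (by positivity)
  have hM0 : (0 : ℝ) < M' := by exact_mod_cast M'.pos
  set k : ℝ := ‖((Real.pi / b : ℂ) ^ (d / 2 : ℂ))⁻¹‖ with hk
  have := exists_superposition_bound hL (x₀ := x₀) (M := M' + 1) hc hc2 hsub (n := n) hC₁
    (b := b / 2) (by positivity)
    (Ψ := fun ξ η => Complex.I * ((b / M' : ℂ) * (η j : ℝ) - (ξ j : ℝ)) * gaussDensity b x₀ η)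
    (fun ξ => by have := continuous_gaussDensity b x₀; fun_prop)
    (C := (b / M' + 1) * k * C₂) (by positivity) (fun ξ η => ?_)
    (fun ξ => GS.partial j ⟨gaussianWave x₀ M' ξ, gaussianWave_mem x₀ M' ξ⟩)
    (fun ξ x => partial_gaussianWave_eq_integral x₀ hM hb ξ x j)
  · obtain ⟨C', h'⟩ := this
    refine ⟨C', fun ξ hξ => ?_⟩
    have e : ‖gaussianSTFT (_root_.gsD j L) x₀ M' ξ‖ =
        ‖L (GS.partial j ⟨gaussianWave x₀ M' ξ, gaussianWave_mem x₀ M' ξ⟩)‖ := by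
      simp [gaussianSTFT, _root_.gsD]
    rw [e]
    exact h' ξ hξ
  · rw [norm_mul, norm_mul, Complex.norm_I, one_mul, norm_gaussDensity, ← hk]
    have hbM : ‖(b / M' : ℂ)‖ = b / M' := by
      rw [norm_div, Complex.norm_real, Real.norm_of_nonneg hb0.le]
      simp
    have h1 : ‖(b / M' : ℂ) * (η j : ℝ) - (ξ j : ℝ)‖ ≤ (b / M' + 1) * bracket ξ * bracket η := by
      refine (norm_sub_le _ _).trans ?_
      rw [norm_mul, hbM]
      have h2 := (norm_coord_le η j).trans (norm_le_bracket η)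
      have h3 := (norm_coord_le ξ j).trans (norm_le_bracket ξ)
      have h4 := one_le_bracket ξ
      have h5 := one_le_bracket η
      calc _ ≤ b / M' * bracket η + bracket ξ := by gcongr
        _ ≤ b / M' * (bracket ξ * bracket η) + bracket ξ * bracket η := by
          gcongr
          · exact le_mul_of_one_le_left (by linarith) h4
          · exact le_mul_of_one_le_right (by linarith) h5
        _ = _ := by ring
    have h6 : bracket η * Real.exp (-b * ‖η‖ ^ 2) ≤ C₂ * Real.exp (-(b / 2) * ‖η‖ ^ 2) := by
      calc bracket η * Real.exp (-b * ‖η‖ ^ 2)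
          ≤ (C₂ * Real.exp (b / 2 * ‖η‖ ^ 2)) * Real.exp (-b * ‖η‖ ^ 2) := by
            gcongr
            simpa using hn η
        _ = _ := by rw [mul_assoc, ← Real.exp_add]; ring_nf
    have hbr := bracket_pos ξ
    calc ‖(b / M' : ℂ) * (η j : ℝ) - (ξ j : ℝ)‖ * (k * Real.exp (-b * ‖η‖ ^ 2))
        ≤ (b / M' + 1) * bracket ξ * bracket η * (k * Real.exp (-b * ‖η‖ ^ 2)) := by gcongr
      _ = (b / M' + 1) * bracket ξ * k * (bracket η * Real.exp (-b * ‖η‖ ^ 2)) := by ring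
      _ ≤ (b / M' + 1) * bracket ξ * k * (C₂ * Real.exp (-(b / 2) * ‖η‖ ^ 2)) := by gcongr
      _ = _ := by ring

theorem RapidAt.add {d : ℕ} {L L' : GS d →ₗ[ℂ] ℂ} {x₀ ξ₀ : Rd d}
    (h : RapidAt L x₀ ξ₀) (h' : RapidAt L' x₀ ξ₀) : RapidAt (L + L') x₀ ξ₀ := by
  obtain ⟨Γ, hΓ, hest⟩ := h
  obtain ⟨Γ', hΓ', hest'⟩ := h'
  refine ⟨Γ ∩ Γ', hΓ.inter hΓ', fun M n => ?_⟩
  obtain ⟨C, hC⟩ := hest M n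
  obtain ⟨C', hC'⟩ := hest' M n
  refine ⟨C + C', fun ξ hξ => ?_⟩
  have e : gaussianSTFT (L + L') x₀ M ξ = gaussianSTFT L x₀ M ξ + gaussianSTFT L' x₀ M ξ := rfl
  have hp : 0 < bracket ξ ^ n := pow_pos (bracket_pos ξ) n
  calc _ ≤ (‖gaussianSTFT L x₀ M ξ‖ + ‖gaussianSTFT L' x₀ M ξ‖) * bracket ξ ^ n := by
        rw [e]; gcongr; exact norm_add_le _ _
    _ ≤ _ := by rw [add_mul]; exact add_le_add (hC ξ hξ.1) (hC' ξ hξ.2)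

theorem RapidAt.smul {d : ℕ} {L : GS d →ₗ[ℂ] ℂ} {x₀ ξ₀ : Rd d}
    (h : RapidAt L x₀ ξ₀) (c : ℂ) : RapidAt (c • L) x₀ ξ₀ := by
  obtain ⟨Γ, hΓ, hest⟩ := h
  refine ⟨Γ, hΓ, fun M n => ?_⟩
  obtain ⟨C, hC⟩ := hest M n
  refine ⟨‖c‖ * C, fun ξ hξ => ?_⟩
  have e : gaussianSTFT (c • L) x₀ M ξ = c * gaussianSTFT L x₀ M ξ := rfl
  rw [e, norm_mul, mul_assoc]
  exact mul_le_mul_of_nonneg_left (hC ξ hξ) (norm_nonneg _)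

theorem RapidAt.zero {d : ℕ} (x₀ ξ₀ : Rd d) : RapidAt (0 : GS d →ₗ[ℂ] ℂ) x₀ ξ₀ :=
  ⟨Set.univ, ⟨isOpen_univ, fun _ _ _ _ => trivial, trivial⟩, fun M n => ⟨0, fun ξ _ => by
    simp [gaussianSTFT]⟩⟩

/-! ### Differential operators acting on suitable extensions -/

/-- A relation stable under linear combinations and under `D_j` is stable under `P(D)`. -/
theorem polyOp_rel {d : ℕ} {V W : Type*} [AddCommGroup V] [Module ℂ V] [AddCommGroup W] [Module ℂ W]
    {D : Fin d → Module.End ℂ V} {D' : Fin d → Module.End ℂ W} (R : V → W → Prop) (h0 : R 0 0)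
    (hadd : ∀ v w v' w', R v w → R v' w' → R (v + v') (w + w'))
    (hsmul : ∀ (c : ℂ) v w, R v w → R (c • v) (c • w))
    (hD : ∀ j v w, R v w → R (D j v) (D' j w)) (P : MvPolynomial (Fin d) ℂ) {v : V} {w : W}
    (h : R v w) : R (polyOp D P v) (polyOp D' P w) := by
  have hpow : ∀ (j : Fin d) (n : ℕ) (v : V) (w : W), R v w → R ((D j ^ n) v) ((D' j ^ n) w) := by
    intro j n
    induction n with
    | zero => intro v w h; simpa using h
    | succ n ih =>
      intro v w h
      rw [pow_succ', pow_succ']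
      exact hD _ _ _ (ih v w h)
  have hlist : ∀ (α : Fin d →₀ ℕ) (l : List (Fin d)),
      R ((l.map fun j => D j ^ α j).prod v) ((l.map fun j => D' j ^ α j).prod w) := by
    intro α l
    induction l with
    | nil => simpa using h
    | cons j l ih =>
      rw [List.map_cons, List.prod_cons, List.map_cons, List.prod_cons]
      exact hpow _ _ _ _ ih
  unfold polyOp
  rw [LinearMap.sum_apply, LinearMap.sum_apply]
  induction P.support using Finset.induction_on with
  | empty => simpa using h0
  | insert α S hα ih =>
    rw [Finset.sum_insert hα, Finset.sum_insert hα]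
    refine hadd _ _ _ _ (hsmul _ _ _ ?_) ih
    rw [List.ofFn_eq_map, List.ofFn_eq_map]
    exact hlist α _

theorem Distr.pair_add {d : ℕ} (u : Distr d) (ψ ψ' : CplxTest d) :
    u.pair (ψ + ψ') = u.pair ψ + u.pair ψ' := by
  unfold Distr.pair
  rw [map_add, map_add, map_add, map_add]
  ring

theorem Distr.pair_real_smul {d : ℕ} (u : Distr d) (c : ℝ) (ψ : CplxTest d) :
    u.pair (c • ψ) = c * u.pair ψ := by
  unfold Distr.pair
  rw [map_smul, map_smul, map_smul, map_smul]
  simp only [Complex.real_smul]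
  ring

theorem Distr.add_pair {d : ℕ} (u v : Distr d) (ψ : CplxTest d) :
    (u + v).pair ψ = u.pair ψ + v.pair ψ := by
  unfold Distr.pair
  simp only [add_apply]
  ring

theorem Distr.smul_pair {d : ℕ} (c : ℂ) (u : Distr d) (ψ : CplxTest d) :
    (c • u).pair ψ = c * u.pair ψ := by
  unfold Distr.pair
  simp only [smul_apply, smul_eq_mul]
  ring

theorem Distr.zero_pair {d : ℕ} (ψ : CplxTest d) : (0 : Distr d).pair ψ = 0 := by
  unfold Distr.pair
  simp

theorem distrD_apply {d : ℕ} (j : Fin d) (T : Distr d) (ψ : RealTest d) :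
    distrD j T ψ =
      Complex.I * T (TestFunction.lineDerivCLM ℝ (EuclideanSpace.single j (1 : ℝ)) ψ) := by
  change -Complex.I * -(T (TestFunction.lineDerivCLM ℝ (EuclideanSpace.single j (1 : ℝ)) ψ)) = _
  ring

theorem testFunction_lineDeriv_apply {d : ℕ} {F : Type*} [NormedAddCommGroup F] [NormedSpace ℝ F]
    (ψ : 𝓓((⊤ : TopologicalSpace.Opens (Rd d)), F)) (v x : Rd d) :
    (TestFunction.lineDerivCLM ℝ v ψ : 𝓓((⊤ : TopologicalSpace.Opens (Rd d)), F)) x =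
      fderiv ℝ ψ x v := by
  rw [TestFunction.lineDerivCLM_eq_fderivCLM, TestFunction.fderivCLM_apply_of_le]
  simp

theorem distrD_pair {d : ℕ} (j : Fin d) (T : Distr d) (ψ : CplxTest d) :
    (distrD j T).pair ψ =
      Complex.I * T.pair (TestFunction.lineDerivCLM ℝ (EuclideanSpace.single j (1 : ℝ)) ψ) := by
  have key : ∀ ℓ : ℂ →L[ℝ] ℝ, TestFunction.lineDerivCLM ℝ (EuclideanSpace.single j (1 : ℝ))
      (TestFunction.postcompCLM (𝕜 := ℝ) ℓ ψ) = (TestFunction.postcompCLM (𝕜 := ℝ) ℓ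
        (TestFunction.lineDerivCLM ℝ (EuclideanSpace.single j (1 : ℝ)) ψ : CplxTest d) :
          RealTest d) := by
    intro ℓ
    ext x
    rw [testFunction_lineDeriv_apply, TestFunction.postcompCLM_apply,
      TestFunction.postcompCLM_apply, Function.comp_apply, testFunction_lineDeriv_apply,
      fderiv_comp _ ℓ.differentiableAt (ψ.contDiff.differentiable (by simp)).differentiableAt]
    simp
  unfold Distr.pair
  rw [distrD_apply, distrD_apply, key, key]
  ring

theorem truncate_apply {d : ℕ} (χ : RealTest d) (g : GS d) (k : ℕ) (x : Rd d) :
    truncate χ g k x = ((χ (((k : ℝ) + 1)⁻¹ • x) : ℝ) : ℂ) * g.1 x := rfl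

theorem truncate_add {d : ℕ} (χ χ' : RealTest d) (g : GS d) (k : ℕ) :
    truncate (χ + χ') g k = truncate χ g k + truncate χ' g k := by
  ext x
  simp only [truncate_apply, add_apply]
  push_cast
  ring

theorem lineDeriv_truncate {d : ℕ} (χ : RealTest d) (g : GS d) (k : ℕ) (j : Fin d) :
    TestFunction.lineDerivCLM ℝ (EuclideanSpace.single j (1 : ℝ)) (truncate χ g k) =
      truncate χ (GS.partial j g) k + (((k : ℝ) + 1)⁻¹) •
        truncate (TestFunction.lineDerivCLM ℝ (EuclideanSpace.single j (1 : ℝ)) χ) g k := by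
  ext x
  rw [testFunction_lineDeriv_apply]
  rw [add_apply, smul_apply, truncate_apply, truncate_apply, testFunction_lineDeriv_apply]
  set a := ((k : ℝ) + 1)⁻¹
  have h1 : HasFDerivAt (fun x : Rd d => χ (a • x)) (a • fderiv ℝ χ (a • x)) x := by
    have hχ : DifferentiableAt ℝ χ (a • x) :=
      (χ.contDiff.differentiable (by simp)).differentiableAt
    have e : fderiv ℝ χ (a • x) ∘SL (a • ContinuousLinearMap.id ℝ (Rd d)) =
        a • fderiv ℝ χ (a • x) := by
      ext w
      simp
    rw [← e]
    exact hχ.hasFDerivAt.comp x ((hasFDerivAt_id x).const_smul a)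
  have h2 : HasFDerivAt (fun x : Rd d => ((χ (a • x) : ℝ) : ℂ))
      (Complex.ofRealCLM.comp (a • fderiv ℝ χ (a • x))) x :=
    Complex.ofRealCLM.hasFDerivAt.comp x h1
  have h3 : HasFDerivAt g.1 (fderiv ℝ g.1 x) x :=
    ((g.2.1.differentiable (by simp)) x).hasFDerivAt
  have h4 := (h2.mul h3).fderiv
  have e : (truncate χ g k : Rd d → ℂ) = (fun x : Rd d => ((χ (a • x) : ℝ) : ℂ)) * g.1 := rfl
  rw [e, h4]
  simp [GS.partial]
  ring

/-- By the product rule, moving `∂_j` past the truncation leaves an error `(k+1)⁻¹ ⟨T, (∂_j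
χ)(·/(k+1)) g⟩`. The pairing is controlled although `∂_j χ` is not a cut-off. -/
theorem BelongsToGSDual.distrD {d : ℕ} {T : Distr d} {L : GS d →ₗ[ℂ] ℂ} (h : BelongsToGSDual T L)
    (j : Fin d) : BelongsToGSDual (distrD j T) (gsD j L) := by
  refine ⟨h.1.gsD j, fun χ hχ g => ?_⟩
  set χ' : RealTest d := TestFunction.lineDerivCLM ℝ (EuclideanSpace.single j (1 : ℝ)) χ with hχ'
  -- Since `∂_j χ` vanishes near the origin, `χ + ∂_j χ` is an admissible cut-off too. Both cut-offs
  -- give the same limit, so the pairings with `∂_j χ` tend to `0`.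
  have hz : ∀ᶠ x in 𝓝 (0 : Rd d), (χ + χ') x = 1 := by
    filter_upwards [hχ, hχ.eventually_nhds] with x hx hx'
    have : fderiv ℝ χ x = 0 := by
      have h1 : (χ : Rd d → ℝ) =ᶠ[𝓝 x] fun _ => (1 : ℝ) := hx'
      rw [h1.fderiv_eq]
      simp
    rw [add_apply, hx, hχ', testFunction_lineDeriv_apply, this]
    simp
  have t1 := h.2 χ hχ g
  have t2 := h.2 _ hz g
  have t3 : Tendsto (fun k : ℕ => T.pair (truncate χ' g k)) atTop (𝓝 0) := by
    have := t2.sub t1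
    rw [sub_self] at this
    refine this.congr fun k => ?_
    rw [truncate_add, Distr.pair_add]
    ring
  have t4 : Tendsto (fun k : ℕ => ((((k : ℝ) + 1)⁻¹ : ℝ) : ℂ)) atTop (𝓝 0) := by
    have := tendsto_one_div_add_atTop_nhds_zero_nat (𝕜 := ℝ)
    simp only [one_div] at this
    exact (Complex.continuous_ofReal.tendsto' 0 0 Complex.ofReal_zero).comp this
  have t5 := ((h.2 χ hχ (GS.partial j g)).add (t4.mul t3)).const_mul Complex.I
  have e : Complex.I * (L (GS.partial j g) + 0 * 0) = _root_.gsD j L g := by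
    change _ = -Complex.I * -(L _)
    ring
  rw [e] at t5
  refine t5.congr fun k => ?_
  rw [distrD_pair, lineDeriv_truncate, Distr.pair_add, Distr.pair_real_smul]

theorem GSContinuous.zero {d : ℕ} : GSContinuous (0 : GS d →ₗ[ℂ] ℂ) :=
  fun _ _ => ⟨0, fun _ _ _ _ => by simp⟩

theorem GSContinuous.add {d : ℕ} {L L' : GS d →ₗ[ℂ] ℂ} (h : GSContinuous L)
    (h' : GSContinuous L') : GSContinuous (L + L') := by
  intro A hA
  obtain ⟨C, hC⟩ := h A hA
  obtain ⟨C', hC'⟩ := h' A hA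
  refine ⟨C + C', fun g K hK hg => ?_⟩
  rw [LinearMap.add_apply, add_mul]
  exact (norm_add_le _ _).trans (add_le_add (hC g K hK hg) (hC' g K hK hg))

theorem GSContinuous.smul {d : ℕ} {L : GS d →ₗ[ℂ] ℂ} (h : GSContinuous L) (c : ℂ) :
    GSContinuous (c • L) := by
  intro A hA
  obtain ⟨C, hC⟩ := h A hA
  refine ⟨‖c‖ * C, fun g K hK hg => ?_⟩
  rw [LinearMap.smul_apply, norm_smul, mul_assoc]
  exact mul_le_mul_of_nonneg_left (hC g K hK hg) (norm_nonneg _)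

theorem BelongsToGSDual.zero {d : ℕ} : BelongsToGSDual (0 : Distr d) 0 :=
  ⟨GSContinuous.zero, fun χ _ g => by
    simp only [Distr.zero_pair]
    exact tendsto_const_nhds⟩

theorem BelongsToGSDual.add {d : ℕ} {T T' : Distr d} {L L' : GS d →ₗ[ℂ] ℂ}
    (h : BelongsToGSDual T L) (h' : BelongsToGSDual T' L') : BelongsToGSDual (T + T') (L + L') :=
  ⟨h.1.add h'.1, fun χ hχ g => ((h.2 χ hχ g).add (h'.2 χ hχ g)).congr fun k => by
    rw [Distr.add_pair]⟩

theorem BelongsToGSDual.smul {d : ℕ} {T : Distr d} {L : GS d →ₗ[ℂ] ℂ}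
    (h : BelongsToGSDual T L) (c : ℂ) : BelongsToGSDual (c • T) (c • L) :=
  ⟨h.1.smul c, fun χ hχ g => ((h.2 χ hχ g).const_mul c).congr fun k => by
    rw [Distr.smul_pair]⟩

/-- Suitable extensions and rapid decay pass from `u` to `P(D)u`. -/
theorem IsSuitableExtension.PDu {d : ℕ} {u T : Distr d} {L : GS d →ₗ[ℂ] ℂ} {x₀ ξ₀ : Rd d}
    (P : MvPolynomial (Fin d) ℂ) (h : IsSuitableExtension u x₀ T L) (hr : RapidAt L x₀ ξ₀) :
    IsSuitableExtension (PDu P u) x₀ (PDu P T) (polyOp gsD P L) ∧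
      RapidAt (polyOp gsD P L) x₀ ξ₀ := by
  obtain ⟨hT, r, hr0, hloc⟩ := h
  have h1 := polyOp_rel (D := _root_.distrD) (D' := _root_.gsD)
    (fun (T : Distr d) (L : GS d →ₗ[ℂ] ℂ) => BelongsToGSDual T L ∧ RapidAt L x₀ ξ₀)
    ⟨BelongsToGSDual.zero, RapidAt.zero x₀ ξ₀⟩
    (fun v w v' w' h h' => ⟨h.1.add h'.1, h.2.add h'.2⟩)
    (fun c v w h => ⟨h.1.smul c, h.2.smul c⟩)
    (fun j v w h => ⟨h.1.distrD j, h.2.gsD h.1.1 j⟩) P ⟨hT, hr⟩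
  have h2 := polyOp_rel (D := _root_.distrD) (D' := _root_.distrD)
    (fun (T u : Distr d) => ∀ ψ : RealTest d, tsupport ψ ⊆ Metric.ball x₀ r → T ψ = u ψ)
    (fun ψ _ => rfl)
    (fun v w v' w' h h' ψ hψ => by rw [add_apply, add_apply, h ψ hψ, h' ψ hψ])
    (fun c v w h ψ hψ => by rw [smul_apply, smul_apply, h ψ hψ])
    (fun j v w h ψ hψ => by
      rw [distrD_apply, distrD_apply, h]
      refine (closure_minimal ?_ (isClosed_tsupport ψ)).trans hψ
      intro x hx
      by_contra hx'
      refine hx ?_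
      rw [testFunction_lineDeriv_apply]
      have : (ψ : Rd d → ℝ) =ᶠ[𝓝 x] fun _ => (0 : ℝ) :=
        notMem_tsupport_iff_eventuallyEq.1 hx'
      rw [this.fderiv_eq]
      simp) P hloc
  exact ⟨⟨h1.1, r, hr0, h2⟩, h1.2⟩

/-! ### A duality principle for simultaneous approximation -/

/-- If every continuous functional that is dominated by the seminorm `p` along `A` kills `x`, then
`x` is a limit of values `A v` with `p v` arbitrarily small. -/
theorem exists_approx_of_dual {X V : Type*} [NormedAddCommGroup X] [NormedSpace ℂ X]
    [AddCommGroup V] [Module ℂ V] (A : V →ₗ[ℂ] X) (p : Seminorm ℂ V) (x : X)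
    (h : ∀ ℓ : X →L[ℂ] ℂ, (∃ C, ∀ v, ‖ℓ (A v)‖ ≤ C * p v) → ℓ x = 0) {δ : ℝ} (hδ : 0 < δ) :
    ∃ v, ‖x - A v‖ < δ ∧ p v < δ := by
  by_contra hcon
  push Not at hcon
  -- This is the image of the `p`-ball thickened by `δ`: open, convex, containing `0`. If it misses
  -- `x`, a functional separates them, and its bound on the `p`-ball is exactly the domination in
  -- the hypothesis, which forces it to vanish at `x`.
  let U : Set X := {y | ∃ v, ‖y - A v‖ < δ ∧ p v < δ}
  have hUo : IsOpen U := by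
    have : U = ⋃ v ∈ {v | p v < δ}, Metric.ball (A v) δ := by
      ext y
      simp only [U, Set.mem_ofPred_eq, Set.mem_iUnion, Metric.mem_ball, dist_eq_norm]
      exact ⟨fun ⟨v, h1, h2⟩ => ⟨v, h2, h1⟩, fun ⟨v, h2, h1⟩ => ⟨v, h1, h2⟩⟩
    rw [this]
    exact isOpen_biUnion fun _ _ => Metric.isOpen_ball
  have hUc : Convex ℝ U := by
    rintro y ⟨v, h1, h2⟩ y' ⟨v', h1', h2'⟩ a b ha hb hab
    refine ⟨(a : ℂ) • v + (b : ℂ) • v', ?_, ?_⟩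
    · have e : a • y + b • y' - A ((a : ℂ) • v + (b : ℂ) • v') =
          (a : ℂ) • (y - A v) + (b : ℂ) • (y' - A v') := by
        rw [map_add, map_smul, map_smul, smul_sub, smul_sub, Complex.coe_smul, Complex.coe_smul,
          Complex.coe_smul, Complex.coe_smul]
        abel
      rw [e]
      refine (norm_add_le _ _).trans_lt ?_
      rw [norm_smul, norm_smul, Complex.norm_real, Complex.norm_real, Real.norm_of_nonneg ha,
        Real.norm_of_nonneg hb]
      rcases ha.eq_or_lt with rfl | ha'
      · simp only [zero_add] at hab
        subst hab
        simpa using h1'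
      · nlinarith
    · refine (map_add_le_add p _ _).trans_lt ?_
      rw [map_smul_eq_mul, map_smul_eq_mul, Complex.norm_real, Complex.norm_real,
        Real.norm_of_nonneg ha, Real.norm_of_nonneg hb]
      rcases ha.eq_or_lt with rfl | ha'
      · simp only [zero_add] at hab
        subst hab
        simpa using h2'
      · nlinarith
  have hx : x ∉ U := fun ⟨v, h1, h2⟩ => absurd h2 (not_lt.2 (hcon v h1))
  obtain ⟨f, hf⟩ := RCLike.geometric_hahn_banach_open_point (𝕜 := ℂ) hUc hUo hx
  have h0 : (0 : X) ∈ U := ⟨0, by simpa using hδ, by simpa using hδ⟩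
  have hpos : 0 < RCLike.re (f x) := by simpa using hf 0 h0
  have key : ∀ v, p v < δ → ‖f (A v)‖ ≤ RCLike.re (f x) := by
    intro v hv
    obtain ⟨c, hc, hcz⟩ : ∃ c : ℂ, ‖c‖ = 1 ∧ ((‖f (A v)‖ : ℝ) : ℂ) = c * f (A v) := by
      obtain ⟨c, hc, hcz⟩ := RCLike.exists_norm_eq_mul_self (f (A v))
      exact ⟨c, hc, hcz⟩
    have hmem : A (c • v) ∈ U := ⟨c • v, by simpa using hδ, by
      rw [map_smul_eq_mul, hc, one_mul]; exact hv⟩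
    have h1 := (hf _ hmem).le
    rw [map_smul, map_smul, smul_eq_mul, ← hcz] at h1
    simpa using h1
  -- The constant comes from rescaling `v` to `p v = δ / 2`. If `p v = 0`, every multiple of `v` is
  -- admissible, so `f (A v)` must be `0`.
  have hz := h f ⟨2 * RCLike.re (f x) / δ, fun v => ?_⟩
  · rw [hz] at hpos
    simp at hpos
  · rcases (apply_nonneg p v).eq_or_lt with hv | hv
    · rw [← hv, mul_zero]
      by_contra hne
      push Not at hne
      have h2 := key ((((2 * RCLike.re (f x) / ‖f (A v)‖ : ℝ)) : ℂ) • v) (by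
        rw [map_smul_eq_mul, ← hv, mul_zero]; exact hδ)
      rw [map_smul, map_smul, norm_smul, Complex.norm_real,
        Real.norm_of_nonneg (by positivity), div_mul_cancel₀ _ hne.ne'] at h2
      linarith
    · have h2 := key (((δ / (2 * p v) : ℝ) : ℂ) • v) (by
        rw [map_smul_eq_mul, Complex.norm_real, Real.norm_of_nonneg (by positivity)]
        field_simp
        linarith)
      rw [map_smul, map_smul, norm_smul, Complex.norm_real,
        Real.norm_of_nonneg (by positivity), div_mul_eq_mul_div, div_le_iff₀ (by positivity)] at h2
      rw [div_mul_eq_mul_div, le_div_iff₀ hδ]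
      linarith

/-! ### Bounded holomorphic functions with Gaussian decay on the boundary -/

theorem exp_linear_sub_sq_le {β : ℝ} (hβ : 0 < β) (a x : ℝ) :
    Real.exp (-β * x ^ 2) * Real.exp (a * x) ≤ Real.exp (a ^ 2 / (4 * β)) := by
  rw [← Real.exp_add]
  refine Real.exp_le_exp.2 ?_
  rw [le_div_iff₀ (by positivity)]
  nlinarith [sq_nonneg (2 * β * x - a)]

/-- The Gaussian is the envelope of the exponential bounds, attained at `a = 2βx`. Phragmén–Lindelöf
can thus be applied to `h` times an exponential and gives a Gaussian bound at the end. -/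
theorem le_gaussian_of_forall_exp_bound {β C r x : ℝ} (hβ : 0 < β)
    (h : ∀ a, 0 ≤ a → r * Real.exp (a * x) ≤ C * Real.exp (a ^ 2 / (4 * β))) (hx : 0 ≤ x) :
    r ≤ C * Real.exp (-β * x ^ 2) := by
  have h1 := h (2 * β * x) (by positivity)
  have e : C * Real.exp ((2 * β * x) ^ 2 / (4 * β)) =
      C * Real.exp (-β * x ^ 2) * Real.exp (2 * β * x * x) := by
    rw [mul_assoc C, ← Real.exp_add]
    congr 2
    field_simp
    ring
  rw [e] at h1
  exact le_of_mul_le_mul_right h1 (Real.exp_pos _)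

/-- A bounded holomorphic function on the upper half-plane with Gaussian decay along the real axis
vanishes. -/
theorem eq_zero_of_gaussian_decay {h : ℂ → ℂ} (hd : DifferentiableOn ℂ h {z | 0 < z.im})
    (hc : ContinuousOn h {z | 0 ≤ z.im}) {C β : ℝ} (hβ : 0 < β)
    (hb : ∀ z : ℂ, 0 ≤ z.im → ‖h z‖ ≤ C)
    (hdec : ∀ t : ℝ, ‖h t‖ ≤ C * Real.exp (-β * t ^ 2)) (t : ℝ) : h t = 0 := by
  have hC : 0 ≤ C := (norm_nonneg _).trans (hb 0 (by simp))
  have hexp : ∀ (b : ℂ) (z : ℂ), ‖Complex.exp (b * z)‖ ≤ Real.exp (‖b‖ * ‖z‖) := fun b z => by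
    rw [Complex.norm_exp]
    exact Real.exp_le_exp.2 ((Complex.re_le_norm _).trans (norm_mul_le _ _))
  have hone : ∀ a : ℝ, C ≤ C * Real.exp (a ^ 2 / (4 * β)) := fun a =>
    le_mul_of_one_le_right hC (Real.one_le_exp (by positivity))
  -- Gaussian decay on horizontal lines
  have s1 : ∀ z : ℂ, 0 ≤ z.re → 0 ≤ z.im → ‖h z‖ ≤ C * Real.exp (-β * z.re ^ 2) := by
    intro z hz1 hz2
    refine le_gaussian_of_forall_exp_bound hβ (fun a ha => ?_) hz1
    -- The factor `e^{az}` is unimodular on the imaginary axis, and on the real axis its growth is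
    -- compensated by the Gaussian up to `e^{a²/(4β)}`.
    have := PhragmenLindelof.quadrant_I (f := fun z => h z * Complex.exp (a * z))
      (C := C * Real.exp (a ^ 2 / (4 * β))) (z := z) ⟨?_, ?_⟩ ⟨1, by norm_num, a, ?_⟩ ?_ ?_ hz1 hz2
    · rwa [norm_mul, Complex.norm_exp, Complex.re_ofReal_mul] at this
    · refine (hd.mono fun z hz => ?_).mul (by fun_prop)
      exact hz.2
    · refine (hc.mono fun z hz => ?_).mul (by fun_prop)
      rw [Complex.closure_reProdIm, closure_Ioi] at hz
      exact hz.2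
    · refine Asymptotics.IsBigO.of_bound C ?_
      rw [eventually_inf_principal]
      refine Eventually.of_forall fun z hz => ?_
      rw [norm_mul, Real.rpow_one, Real.norm_of_nonneg (Real.exp_pos _).le]
      refine mul_le_mul (hb z (le_of_lt hz.2)) ((hexp _ _).trans ?_) (norm_nonneg _) hC
      rw [Complex.norm_real, Real.norm_of_nonneg ha]
    · intro x hx
      rw [norm_mul, Complex.norm_exp]
      calc _ ≤ C * Real.exp (-β * x ^ 2) * Real.exp (a * x) := by
            gcongr
            · exact hdec x
            · simp
        _ ≤ _ := by
            rw [mul_assoc]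
            gcongr
            exact exp_linear_sub_sq_le hβ a x
    · intro x hx
      rw [norm_mul, Complex.norm_exp]
      simp only [Complex.mul_re, Complex.mul_im, Complex.ofReal_re, Complex.ofReal_im, Complex.I_re,
        Complex.I_im]
      simp only [mul_zero, mul_one, zero_mul, sub_self, add_zero, Real.exp_zero]
      exact (hb _ (by simpa using hx)).trans (hone a)
  have s2 : ∀ z : ℂ, z.re ≤ 0 → 0 ≤ z.im → ‖h z‖ ≤ C * Real.exp (-β * z.re ^ 2) := by
    intro z hz1 hz2
    rw [← neg_sq z.re]
    refine le_gaussian_of_forall_exp_bound hβ (fun a ha => ?_) (by linarith)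
    have := PhragmenLindelof.quadrant_II (f := fun z => h z * Complex.exp (((-a : ℝ) : ℂ) * z))
      (C := C * Real.exp (a ^ 2 / (4 * β))) (z := z) ⟨?_, ?_⟩ ⟨1, by norm_num, a, ?_⟩ ?_ ?_ hz1 hz2
    · rwa [norm_mul, Complex.norm_exp, Complex.re_ofReal_mul, neg_mul, ← mul_neg] at this
    · refine (hd.mono fun z hz => ?_).mul (by fun_prop)
      exact hz.2
    · refine (hc.mono fun z hz => ?_).mul (by fun_prop)
      rw [Complex.closure_reProdIm, closure_Ioi] at hz
      exact hz.2
    · refine Asymptotics.IsBigO.of_bound C ?_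
      rw [eventually_inf_principal]
      refine Eventually.of_forall fun z hz => ?_
      rw [norm_mul, Real.rpow_one, Real.norm_of_nonneg (Real.exp_pos _).le]
      refine mul_le_mul (hb z (le_of_lt hz.2)) ((hexp _ _).trans ?_) (norm_nonneg _) hC
      rw [Complex.norm_real, norm_neg, Real.norm_of_nonneg ha]
    · intro x hx
      rw [norm_mul, Complex.norm_exp]
      calc _ ≤ C * Real.exp (-β * x ^ 2) * Real.exp (-a * x) := by
            gcongr
            · exact hdec x
            · simp
        _ ≤ _ := by
            rw [mul_assoc]
            gcongr
            rw [← neg_sq a]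
            exact exp_linear_sub_sq_le hβ (-a) x
    · intro x hx
      rw [norm_mul, Complex.norm_exp]
      simp only [Complex.mul_re, Complex.mul_im, Complex.ofReal_re, Complex.ofReal_im, Complex.I_re,
        Complex.I_im]
      simp only [mul_zero, mul_one, zero_mul, sub_self, add_zero, Real.exp_zero]
      exact (hb _ (by simpa using hx)).trans (hone a)
  -- Gaussian decay on the imaginary axis
  have him : ∀ w : ℂ, ((1 + Complex.I) * w).im = w.re + w.im := fun w => by
    simp [Complex.mul_im]; ring
  have hre : ∀ w : ℂ, ((1 + Complex.I) * w).re = w.re - w.im := fun w => by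
    simp [Complex.mul_re]
  have s3 : ∀ y : ℝ, 0 ≤ y → ‖h (Complex.I * y)‖ ≤ C * Real.exp (-β * y ^ 2) := by
    intro y hy
    refine le_gaussian_of_forall_exp_bound hβ (fun a ha => ?_) hy
    have hnorm : ∀ w : ℂ, ‖Complex.exp (-(a * Complex.I) * ((1 + Complex.I) * w))‖ =
        Real.exp (a * (w.re + w.im)) := fun w => by
      rw [Complex.norm_exp, ← him, neg_mul, Complex.neg_re, mul_assoc, Complex.re_ofReal_mul,
        Complex.I_mul_re]
      ring_nf
    -- The sector between the rays through `1 + i` and `-1 + i` is parametrized by `(1 + i) w` with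
    -- `w` in the first quadrant. On these rays the real part equals the imaginary part up to sign,
    -- so the decay already found beats `e^{a Im z}`; the point `iy` is reached at `w = (1 + i) y /
    -- 2`.
    have := PhragmenLindelof.quadrant_I
      (f := fun w => h ((1 + Complex.I) * w) *
        Complex.exp (-(a * Complex.I) * ((1 + Complex.I) * w)))
      (C := C * Real.exp (a ^ 2 / (4 * β))) (z := (y / 2 : ℝ) + (y / 2 : ℝ) * Complex.I)
      ⟨?_, ?_⟩ ⟨1, by norm_num, 2 * a, ?_⟩ ?_ ?_ (by simp; linarith) (by simp; linarith)
    · rw [norm_mul, hnorm] at this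
      have e : (1 + Complex.I) * ((y / 2 : ℝ) + (y / 2 : ℝ) * Complex.I) = Complex.I * y := by
        push_cast
        linear_combination (y / 2 : ℂ) * Complex.I_mul_I
      rw [e] at this
      simpa using this
    · refine (hd.comp (by fun_prop) fun w hw => ?_).mul (by fun_prop)
      rw [Set.mem_ofPred_eq, him]
      exact add_pos hw.1 hw.2
    · refine (hc.comp (by fun_prop) fun w hw => ?_).mul (by fun_prop)
      rw [Complex.closure_reProdIm, closure_Ioi] at hw
      rw [Set.mem_ofPred_eq, him]
      exact add_nonneg hw.1 hw.2
    · refine Asymptotics.IsBigO.of_bound C ?_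
      rw [eventually_inf_principal]
      refine Eventually.of_forall fun w hw => ?_
      rw [norm_mul, Real.rpow_one, Real.norm_of_nonneg (Real.exp_pos _).le, hnorm]
      have h1 := Complex.re_le_norm w
      have h2 := Complex.im_le_norm w
      refine mul_le_mul (hb _ (by rw [him]; exact (add_pos hw.1 hw.2).le))
        (Real.exp_le_exp.2 ?_) (Real.exp_pos _).le hC
      nlinarith
    · intro x hx
      rw [norm_mul, hnorm]
      have h1 := s1 ((1 + Complex.I) * x) (by rw [hre]; simpa using hx) (by rw [him]; simpa using hx)
      rw [hre] at h1
      simp only [Complex.ofReal_re, Complex.ofReal_im, sub_zero, add_zero] at h1 ⊢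
      calc _ ≤ C * Real.exp (-β * x ^ 2) * Real.exp (a * x) := by gcongr
        _ ≤ _ := by
            rw [mul_assoc]
            gcongr
            exact exp_linear_sub_sq_le hβ a x
    · intro x hx
      rw [norm_mul, hnorm]
      have h1 := s2 ((1 + Complex.I) * (x * Complex.I)) (by rw [hre]; simpa using hx)
        (by rw [him]; simpa using hx)
      rw [hre] at h1
      simp only [Complex.re_ofReal_mul, Complex.im_ofReal_mul, Complex.I_re, Complex.I_im, mul_zero,
        mul_one, zero_sub, zero_add, neg_sq] at h1 ⊢
      calc _ ≤ C * Real.exp (-β * x ^ 2) * Real.exp (a * x) := by gcongr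
        _ ≤ _ := by
            rw [mul_assoc]
            gcongr
            exact exp_linear_sub_sq_le hβ a x
  have him' : ∀ w : ℂ, (Complex.I * w).im = w.re := fun w => by simp
  -- In the coordinate `z = iw` the positive imaginary axis becomes the positive real axis, where
  -- the Gaussian bound is faster than any exponential.
  have := PhragmenLindelof.eq_zero_on_right_half_plane_of_superexponential_decay
    (f := fun w => h (Complex.I * w)) ⟨?_, ?_⟩ ⟨1, by norm_num, 0, ?_⟩ ?_ ⟨C, ?_⟩
  · have h1 := this (x := -Complex.I * t) (by simp)
    simpa [← mul_assoc] using h1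
  · refine hd.comp (by fun_prop) fun w hw => ?_
    rw [Set.mem_ofPred_eq, him']
    exact hw
  · refine hc.comp (by fun_prop) fun w hw => ?_
    rw [Complex.closure_setOfPred_lt_re] at hw
    rw [Set.mem_ofPred_eq, him']
    exact hw
  · refine Asymptotics.IsBigO.of_bound C ?_
    rw [eventually_inf_principal]
    refine Eventually.of_forall fun w hw => ?_
    simpa using hb _ (by rw [him']; exact le_of_lt hw)
  · intro n
    have h1 : Tendsto (fun x : ℝ => C * Real.exp (n * x - β * x ^ 2)) atTop (𝓝 0) := by
      rw [← mul_zero C]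
      refine Tendsto.const_mul C (Real.tendsto_exp_atBot.comp ?_)
      have : (fun x : ℝ => n * x - β * x ^ 2) = fun x => -(x * (β * x - n)) := by
        funext x; ring
      rw [this]
      refine tendsto_neg_atTop_atBot.comp (tendsto_id.atTop_mul_atTop₀ ?_)
      exact tendsto_atTop_add_const_right _ _ (tendsto_id.const_mul_atTop hβ)
    refine squeeze_zero' (Eventually.of_forall fun x => by positivity) ?_ h1
    filter_upwards [eventually_ge_atTop 0] with x hx
    rw [← Real.exp_nat_mul]
    calc _ ≤ Real.exp (n * x) * (C * Real.exp (-β * x ^ 2)) := by gcongr; exact s3 x hx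
      _ = C * (Real.exp (n * x) * Real.exp (-β * x ^ 2)) := by ring
      _ = _ := by rw [← Real.exp_add]; ring_nf
  · intro x
    refine hb _ ?_
    rw [him']
    simp

/-! ### The Fourier transform `∫ f(x) e^{-i⟨x,ξ⟩} dx` -/

/-- The Fourier transform in the normalization `∫ f(x) e^{-i⟨x,ξ⟩} dx`. -/
noncomputable def eft {d : ℕ} (f : Rd d → ℂ) (ξ : Rd d) : ℂ := ∫ x, f x * character ξ x

theorem eft_eq_fourier {d : ℕ} (f : Rd d → ℂ) (ξ : Rd d) :
    eft f ξ = FourierTransform.fourier f ((2 * Real.pi)⁻¹ • ξ) := by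
  rw [Real.fourier_eq']
  unfold eft character
  refine integral_congr_ae (Eventually.of_forall fun x => ?_)
  simp only [smul_eq_mul, inner_smul_right]
  rw [mul_comm]
  congr 2
  have : (2 * Real.pi) ≠ 0 := by positivity
  rw [real_inner_comm, neg_mul, neg_mul, neg_mul, mul_inv_cancel_left₀ this]
  push_cast
  ring

theorem continuous_character {d : ℕ} : Continuous fun p : Rd d × Rd d => character p.1 p.2 := by
  unfold character
  fun_prop

theorem continuous_eft {d : ℕ} {f : Rd d → ℂ} (hf : Integrable f) : Continuous (eft f) := by
  refine continuous_of_dominated (bound := fun x => ‖f x‖) (fun ξ => ?_) (fun ξ => ?_) hf.norm ?_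
  · exact hf.aestronglyMeasurable.mul
      (contDiff_character ξ).continuous.aestronglyMeasurable
  · exact Eventually.of_forall fun x => by simp [norm_character]
  · refine Eventually.of_forall fun x => ?_
    have : Continuous fun ξ : Rd d => character ξ x :=
      continuous_character.comp (by fun_prop : Continuous fun ξ : Rd d => (ξ, x))
    fun_prop

theorem integrable_mul_character {d : ℕ} {f : Rd d → ℂ} (hf : Integrable f) (ξ : Rd d) :
    Integrable fun x => f x * character ξ x :=
  hf.mono (hf.aestronglyMeasurable.mul (contDiff_character ξ).continuous.aestronglyMeasurable)
    (Eventually.of_forall fun x => by simp [norm_character])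

theorem eft_add {d : ℕ} {f g : Rd d → ℂ} (hf : Integrable f) (hg : Integrable g) (ξ : Rd d) :
    eft (fun x => f x + g x) ξ = eft f ξ + eft g ξ := by
  unfold eft
  rw [← integral_add (integrable_mul_character hf ξ) (integrable_mul_character hg ξ)]
  simp only [add_mul]

theorem eft_const_mul {d : ℕ} (f : Rd d → ℂ) (c : ℂ) (ξ : Rd d) :
    eft (fun x => c * f x) ξ = c * eft f ξ := by
  unfold eft
  rw [← integral_const_mul]
  simp only [mul_assoc]

theorem norm_eft_le {d : ℕ} (f : Rd d → ℂ) (ξ : Rd d) : ‖eft f ξ‖ ≤ ∫ x, ‖f x‖ := by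
  refine (norm_integral_le_integral_norm _).trans (le_of_eq ?_)
  simp [norm_character]

theorem eft_translate {d : ℕ} (f : Rd d → ℂ) (v ξ : Rd d) :
    eft (fun x => f (x - v)) ξ = character ξ v * eft f ξ := by
  unfold eft
  rw [← integral_add_right_eq_self _ v, ← integral_const_mul]
  refine integral_congr_ae (Eventually.of_forall fun x => ?_)
  have : character ξ (x + v) = character ξ v * character ξ x := by
    unfold character
    rw [← Complex.exp_add, inner_add_right]
    push_cast
    ring_nf
  simp only [add_sub_cancel_right, this]
  ring

theorem exists_bracket_pow_mul_eft_le (d N : ℕ) : ∃ C : ℝ, 0 < C ∧ ∀ G : Rd d → ℂ,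
    ContDiff ℝ ∞ G → (∀ n ≤ N, Integrable (iteratedFDeriv ℝ n G)) → ∀ ξ,
      ‖eft G ξ‖ * bracket ξ ^ N ≤ C * ∑ n ∈ Finset.range (N + 1), ∫ x, ‖iteratedFDeriv ℝ n G x‖ := by
  refine ⟨2 ^ N * ((2 * Real.pi) ^ N * 2 ^ N + 1), by positivity, fun G hG hi ξ => ?_⟩
  set S := ∑ n ∈ Finset.range (N + 1), ∫ x, ‖iteratedFDeriv ℝ n G x‖ with hS
  have h0 : ‖eft G ξ‖ ≤ S := by
    refine (norm_eft_le G ξ).trans ?_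
    have e : ∫ x, ‖G x‖ = ∫ x, ‖iteratedFDeriv ℝ 0 G x‖ := by simp
    rw [e]
    exact Finset.single_le_sum (f := fun n => ∫ x, ‖iteratedFDeriv ℝ n G x‖)
      (fun n _ => by positivity) (Finset.mem_range.2 (Nat.succ_pos N))
  have h1 : ‖ξ‖ ^ N * ‖eft G ξ‖ ≤ (2 * Real.pi) ^ N * 2 ^ N * S := by
    have := Real.pow_mul_norm_iteratedFDeriv_fourier_le (f := G) (K := 0) (N := N)
      (hG.of_le (mod_cast le_top)) (fun k n hk hn => ?_) (k := 0) (n := N) le_rfl le_rfl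
      ((2 * Real.pi)⁻¹ • ξ)
    · rw [norm_iteratedFDeriv_zero, ← eft_eq_fourier, norm_smul, mul_pow] at this
      simp only [zero_add, Finset.range_one, Finset.singleton_product, Finset.sum_map] at this
      simp only [Function.Embedding.coeFn_mk, pow_zero, one_mul, CharP.cast_eq_zero, mul_zero,
        zero_add, ← hS] at this
      rw [norm_inv, Real.norm_of_nonneg (by positivity), inv_pow, mul_assoc,
        inv_mul_le_iff₀ (by positivity)] at this
      linarith
    · have hk0 : k = 0 := by simpa using hk
      subst hk0
      simpa using (hi n (by exact_mod_cast hn)).norm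
  have hb : bracket ξ ^ N ≤ 2 ^ N * (1 + ‖ξ‖ ^ N) := by
    calc bracket ξ ^ N ≤ (1 + ‖ξ‖) ^ N := by
          gcongr
          · exact (bracket_pos ξ).le
          · exact bracket_le_one_add_norm ξ
      _ ≤ 2 ^ (N - 1) * (1 ^ N + ‖ξ‖ ^ N) := add_pow_le zero_le_one (norm_nonneg _) N
      _ ≤ _ := by
          rw [one_pow]
          gcongr
          · norm_num
          · omega
  calc ‖eft G ξ‖ * bracket ξ ^ N ≤ ‖eft G ξ‖ * (2 ^ N * (1 + ‖ξ‖ ^ N)) := by gcongr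
    _ = 2 ^ N * (‖eft G ξ‖ + ‖ξ‖ ^ N * ‖eft G ξ‖) := by ring
    _ ≤ 2 ^ N * (S + (2 * Real.pi) ^ N * 2 ^ N * S) := by gcongr
    _ = _ := by ring

/-! ### Derivative bounds -/

theorem norm_iteratedFDeriv_mul_le_of_le {d : ℕ} {f g : Rd d → ℂ} (hf : ContDiff ℝ ∞ f)
    (hg : ContDiff ℝ ∞ g) {N : ℕ} {x : Rd d} {a b : ℝ}
    (ha : ∀ i ≤ N, ‖iteratedFDeriv ℝ i f x‖ ≤ a) (hb : ∀ i ≤ N, ‖iteratedFDeriv ℝ i g x‖ ≤ b)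
    {n : ℕ} (hn : n ≤ N) :
    ‖iteratedFDeriv ℝ n (fun x => f x * g x) x‖ ≤ 2 ^ N * (a * b) := by
  have ha0 : 0 ≤ a := (norm_nonneg _).trans (ha 0 (Nat.zero_le _))
  have hb0 : 0 ≤ b := (norm_nonneg _).trans (hb 0 (Nat.zero_le _))
  refine (norm_iteratedFDeriv_mul_le hf hg x (n := n) (mod_cast le_top)).trans ?_
  calc ∑ i ∈ Finset.range (n + 1), (n.choose i : ℝ) * ‖iteratedFDeriv ℝ i f x‖ *
        ‖iteratedFDeriv ℝ (n - i) g x‖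
      ≤ ∑ i ∈ Finset.range (n + 1), (n.choose i : ℝ) * (a * b) := by
        refine Finset.sum_le_sum fun i hi => ?_
        have hi' := Finset.mem_range_succ_iff.1 hi
        rw [mul_assoc]
        gcongr
        · exact ha i (hi'.trans hn)
        · exact hb _ ((Nat.sub_le _ _).trans hn)
    _ = 2 ^ n * (a * b) := by
        rw [← Finset.sum_mul]
        congr 1
        exact_mod_cast Nat.sum_range_choose n
    _ ≤ _ := by gcongr; norm_num

theorem exists_norm_iteratedFDeriv_le {d : ℕ} {F : Type*} [NormedAddCommGroup F] [NormedSpace ℝ F]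
    {f : Rd d → F} (hf : ContDiff ℝ ∞ f)
    (hc : HasCompactSupport f) (N : ℕ) :
    ∃ K : ℝ, 0 < K ∧ ∀ n ≤ N, ∀ x, ‖iteratedFDeriv ℝ n f x‖ ≤ K := by
  have h1 : ∀ n, ∃ K, ∀ x, ‖iteratedFDeriv ℝ n f x‖ ≤ K := fun n =>
    (hc.iteratedFDeriv n).exists_bound_of_continuous (hf.continuous_iteratedFDeriv (mod_cast le_top))
  choose K hK using h1
  refine ⟨∑ n ∈ Finset.range (N + 1), |K n| + 1, by positivity, fun n hn x => ?_⟩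
  have : |K n| ≤ ∑ n ∈ Finset.range (N + 1), |K n| :=
    Finset.single_le_sum (f := fun n => |K n|) (fun _ _ => abs_nonneg _)
      (Finset.mem_range_succ_iff.2 hn)
  linarith [hK n x, le_abs_self (K n)]

theorem norm_iteratedFDeriv_comp_smul_le {d : ℕ} {F : Type*} [NormedAddCommGroup F]
    [NormedSpace ℝ F] {f : Rd d → F} (hf : ContDiff ℝ ∞ f) {a : ℝ} (ha : |a| ≤ 1) (n : ℕ)
    (x : Rd d) :
    ‖iteratedFDeriv ℝ n (fun x => f (a • x)) x‖ ≤ ‖iteratedFDeriv ℝ n f (a • x)‖ := by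
  have e : (fun x => f (a • x)) = f ∘ (a • ContinuousLinearMap.id ℝ (Rd d)) := by
    funext x; simp
  rw [e, ContinuousLinearMap.iteratedFDeriv_comp_right _ hf x (i := n) (mod_cast le_top)]
  refine (ContinuousMultilinearMap.norm_compContinuousLinearMap_le _ _).trans ?_
  have h1 : ‖a • ContinuousLinearMap.id ℝ (Rd d)‖ ≤ 1 := by
    rw [norm_smul]
    exact mul_le_one₀ ha (norm_nonneg _) ContinuousLinearMap.norm_id_le
  refine (mul_le_of_le_one_right (norm_nonneg _) ?_).trans (le_of_eq (by simp))
  exact Finset.prod_le_one (fun _ _ => norm_nonneg _) fun _ _ => h1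

theorem integrable_iteratedFDeriv_of_hasCompactSupport {d : ℕ} {F : Type*} [NormedAddCommGroup F]
    [NormedSpace ℝ F] {f : Rd d → F}
    (hf : ContDiff ℝ ∞ f) (hc : HasCompactSupport f) (n : ℕ) : Integrable (iteratedFDeriv ℝ n f) :=
  (hf.continuous_iteratedFDeriv (mod_cast le_top)).integrable_of_hasCompactSupport
    (hc.iteratedFDeriv n)

theorem exists_bracket_pow_mul_eft_le_of_hasCompactSupport {d : ℕ} {G : Rd d → ℂ}
    (hG : ContDiff ℝ ∞ G) (hc : HasCompactSupport G) (N : ℕ) :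
    ∃ C, 0 < C ∧ ∀ ξ, ‖eft G ξ‖ * bracket ξ ^ N ≤ C := by
  obtain ⟨C, hC, h⟩ := exists_bracket_pow_mul_eft_le d N
  refine ⟨C * (∑ n ∈ Finset.range (N + 1), ∫ x, ‖iteratedFDeriv ℝ n G x‖) + 1, by positivity,
    fun ξ => (h G hG (fun n _ => integrable_iteratedFDeriv_of_hasCompactSupport hG hc n) ξ).trans
      (by linarith)⟩

theorem integrable_inv_one_add_norm_pow (d : ℕ) :
    Integrable fun x : Rd d => ((1 + ‖x‖) ^ (d + 1))⁻¹ := by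
  have := integrable_one_add_norm (E := Rd d) (μ := volume) (r := d + 1) (by simp)
  refine this.congr (Eventually.of_forall fun x => ?_)
  simp only
  rw [Real.rpow_neg (by positivity)]
  norm_cast

theorem integrable_iteratedFDeriv_of_le {d : ℕ} {G : Rd d → ℂ} (hG : ContDiff ℝ ∞ G) {n : ℕ}
    {B : ℝ} (hB : ∀ x, ‖iteratedFDeriv ℝ n G x‖ ≤ B * ((1 + ‖x‖) ^ (d + 1))⁻¹) :
    Integrable (iteratedFDeriv ℝ n G) :=
  ((integrable_inv_one_add_norm_pow d).const_mul B).mono'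
    (hG.continuous_iteratedFDeriv (mod_cast le_top)).aestronglyMeasurable
    (Eventually.of_forall hB)

theorem exists_bracket_pow_mul_eft_le_of_decay (d N : ℕ) : ∃ C : ℝ, 0 < C ∧ ∀ (G : Rd d → ℂ) (B : ℝ),
    ContDiff ℝ ∞ G → (∀ n ≤ N, ∀ x, ‖iteratedFDeriv ℝ n G x‖ ≤ B * ((1 + ‖x‖) ^ (d + 1))⁻¹) → ∀ ξ,
      ‖eft G ξ‖ * bracket ξ ^ N ≤ C * B := by
  obtain ⟨C, hC, hft⟩ := exists_bracket_pow_mul_eft_le d N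
  set J : ℝ := ∫ x : Rd d, ((1 + ‖x‖) ^ (d + 1))⁻¹ with hJ
  have hJ0 : 0 ≤ J := integral_nonneg fun x => by positivity
  refine ⟨C * ((N + 1) * (J + 1)), by positivity, fun G B hG hB ξ => ?_⟩
  have hB0 : 0 ≤ B := by
    have := (norm_nonneg _).trans (hB 0 (Nat.zero_le _) 0)
    simpa using this
  have hGi := fun n hn => integrable_iteratedFDeriv_of_le hG (hB n hn)
  refine (hft G hG hGi ξ).trans ?_
  rw [mul_assoc]
  gcongr
  calc ∑ n ∈ Finset.range (N + 1), ∫ x, ‖iteratedFDeriv ℝ n G x‖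
      ≤ ∑ n ∈ Finset.range (N + 1), B * J := by
        refine Finset.sum_le_sum fun n hn => ?_
        have hn' := Finset.mem_range_succ_iff.1 hn
        rw [hJ, ← integral_const_mul]
        exact integral_mono (hGi n hn').norm ((integrable_inv_one_add_norm_pow d).const_mul _)
          fun x => hB n hn' x
    _ = (N + 1) * J * B := by
        rw [Finset.sum_const, Finset.card_range, nsmul_eq_mul]
        push_cast
        ring
    _ ≤ (N + 1) * (J + 1) * B := by
        gcongr
        linarith

/-! ### Fourier transforms of test functions are dense in weighted spaces -/

/-- A smooth cut-off at scale `R`. -/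
theorem exists_smooth_cutoff (d : ℕ) : ∃ χ : Rd d → ℂ, ContDiff ℝ ∞ χ ∧ HasCompactSupport χ ∧
    ∀ x, ‖x‖ ≤ 1 → χ x = 1 := by
  let bump : ContDiffBump (0 : Rd d) := ⟨1, 2, one_pos, one_lt_two⟩
  refine ⟨fun x => (bump x : ℂ), Complex.ofRealCLM.contDiff.comp bump.contDiff,
    bump.hasCompactSupport.comp_left (g := fun r : ℝ => (r : ℂ)) (by simp), fun x hx => ?_⟩
  have : bump x = 1 := bump.one_of_mem_closedBall (by simpa using hx)
  simp [this]

/-- The discarded part lives where `‖x‖ ≥ R`. One power of `1 + ‖x‖` beyond integrability turns into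
a factor `1/R` for all derivatives up to order `N`, and these control the weighted sup norm of the
transform. -/
theorem exists_truncation_eft_le {d : ℕ} (g : SchwartzMap (Rd d) ℂ) (N : ℕ) {ε : ℝ} (hε : 0 < ε) :
    ∃ ψ : Rd d → ℂ, ContDiff ℝ ∞ ψ ∧ HasCompactSupport ψ ∧
      ∀ ξ, ‖eft g ξ - eft ψ ξ‖ * bracket ξ ^ N ≤ ε := by
  obtain ⟨χ, hχ, hχc, hχ1⟩ := exists_smooth_cutoff d
  obtain ⟨K, hK, hχK⟩ := exists_norm_iteratedFDeriv_le hχ hχc N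
  obtain ⟨C, hC, hft⟩ := exists_bracket_pow_mul_eft_le_of_decay d N
  have hdecay : ∃ B : ℝ, 0 < B ∧ ∀ n ≤ N, ∀ x,
      ‖iteratedFDeriv ℝ n g x‖ ≤ B * ((1 + ‖x‖) ^ (d + 2))⁻¹ := by
    refine ⟨2 ^ (d + 2) * (((Finset.Iic (d + 2, N)).sup fun m =>
      SchwartzMap.seminorm ℝ m.1 m.2) g) + 1, by positivity, fun n hn x => ?_⟩
    rw [← div_eq_mul_inv, le_div_iff₀ (by positivity), mul_comm]
    exact (SchwartzMap.one_add_le_sup_seminorm_apply (𝕜 := ℝ) (m := (d + 2, N)) le_rfl hn g x).trans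
      (by linarith)
  obtain ⟨B, hB, hgB⟩ := hdecay
  set D : ℝ := 2 ^ N * ((K + 1) * B) with hD
  obtain ⟨R, hR, hRε⟩ : ∃ R : ℝ, 1 ≤ R ∧ C * D / R ≤ ε := by
    refine ⟨max 1 (C * D / ε), le_max_left _ _, ?_⟩
    rw [div_le_iff₀ (by positivity), mul_comm ε, ← div_le_iff₀ hε]
    exact le_max_right _ _
  have hR0 : 0 < R := by linarith
  have hRa : |R⁻¹| ≤ 1 := by
    rw [abs_of_pos (by positivity)]
    exact inv_le_one_of_one_le₀ hR
  set ψ : Rd d → ℂ := fun x => χ (R⁻¹ • x) * g x with hψ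
  have hχR : ContDiff ℝ ∞ fun x : Rd d => χ (R⁻¹ • x) := hχ.comp (contDiff_const_smul _)
  have hψs : ContDiff ℝ ∞ ψ := hχR.mul (g.smooth ⊤)
  have hψc : HasCompactSupport ψ := (hχc.comp_smul (by positivity)).mul_right
  refine ⟨ψ, hψs, hψc, fun ξ => ?_⟩
  have hgi : Integrable (g : Rd d → ℂ) := g.integrable
  have hψi : Integrable ψ := hψs.continuous.integrable_of_hasCompactSupport hψc
  set G : Rd d → ℂ := fun x => (1 - χ (R⁻¹ • x)) * g x with hG
  have hχR1 : ContDiff ℝ ∞ fun x : Rd d => 1 - χ (R⁻¹ • x) := contDiff_const.sub hχR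
  have hGs : ContDiff ℝ ∞ G := hχR1.mul (g.smooth ⊤)
  have hbound : ∀ n ≤ N, ∀ x, ‖iteratedFDeriv ℝ n G x‖ ≤ D / R * ((1 + ‖x‖) ^ (d + 1))⁻¹ := by
    intro n hn x
    by_cases hx : ‖x‖ < R
    · have hz : G =ᶠ[𝓝 x] fun _ => (0 : ℂ) := by
        have : ∀ᶠ y : Rd d in 𝓝 x, ‖y‖ < R :=
          (isOpen_lt continuous_norm continuous_const).mem_nhds hx
        filter_upwards [this] with y hy
        have h1 : χ (R⁻¹ • y) = 1 := hχ1 _ (by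
          rw [norm_smul, norm_inv, Real.norm_of_nonneg hR0.le, inv_mul_le_iff₀ hR0]
          linarith)
        simp [hG, h1]
      rw [(hz.iteratedFDeriv ℝ n).eq_of_nhds]
      simp only [iteratedFDeriv_fun_zero, Pi.zero_apply, norm_zero]
      positivity
    · push Not at hx
      have h1 : ∀ i ≤ N, ‖iteratedFDeriv ℝ i (fun x : Rd d => 1 - χ (R⁻¹ • x)) x‖ ≤ K + 1 := by
        intro i hi
        have e : iteratedFDeriv ℝ i (fun x : Rd d => 1 - χ (R⁻¹ • x)) x =
            iteratedFDeriv ℝ i (fun _ : Rd d => (1 : ℂ)) x -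
              iteratedFDeriv ℝ i (fun x : Rd d => χ (R⁻¹ • x)) x :=
          iteratedFDeriv_sub_apply (contDiff_const.contDiffAt)
            ((hχR.of_le (mod_cast le_top)).contDiffAt)
        rw [e]
        refine (norm_sub_le _ _).trans ?_
        have h2 : ‖iteratedFDeriv ℝ i (fun _ : Rd d => (1 : ℂ)) x‖ ≤ 1 := by
          rcases i with _ | i
          · simp
          · rw [iteratedFDeriv_const_of_ne (by omega)]
            simp
        have h3 := (norm_iteratedFDeriv_comp_smul_le hχ hRa i x).trans (hχK i hi _)
        linarith
      refine (norm_iteratedFDeriv_mul_le_of_le hχR1 (g.smooth ⊤) h1 (fun i hi => hgB i hi x)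
        hn).trans ?_
      have h2 : ((1 + ‖x‖) ^ (d + 2))⁻¹ ≤ R⁻¹ * ((1 + ‖x‖) ^ (d + 1))⁻¹ := by
        rw [pow_succ, mul_inv, mul_comm]
        gcongr
        linarith
      calc 2 ^ N * ((K + 1) * (B * ((1 + ‖x‖) ^ (d + 2))⁻¹))
          ≤ 2 ^ N * ((K + 1) * (B * (R⁻¹ * ((1 + ‖x‖) ^ (d + 1))⁻¹))) := by gcongr
        _ = _ := by rw [hD]; ring
  have e : eft g ξ - eft ψ ξ = eft G ξ := by
    have hGi0 : Integrable G := by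
      have : G = fun x => g x - ψ x := by funext x; simp [hG, hψ]; ring
      rw [this]
      exact hgi.sub hψi
    rw [sub_eq_iff_eq_add, ← eft_add hGi0 hψi]
    congr 1
    funext x
    simp [hG, hψ]
    ring
  rw [e]
  refine (hft G _ hGs hbound ξ).trans (le_trans (le_of_eq ?_) hRε)
  ring

theorem exists_schwartz_eft_eq {d : ℕ} {G : Rd d → ℂ} (hG : ContDiff ℝ ∞ G)
    (hc : HasCompactSupport G) : ∃ g : SchwartzMap (Rd d) ℂ, ∀ ξ, eft g ξ = G ξ := by
  have h2 : (2 * Real.pi) ≠ 0 := by positivity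
  have h1 : HasCompactSupport fun x : Rd d => G ((2 * Real.pi) • x) := hc.comp_smul h2
  let S : SchwartzMap (Rd d) ℂ := h1.toSchwartzMap (hG.comp (contDiff_const_smul _))
  refine ⟨FourierTransformInv.fourierInv S, fun ξ => ?_⟩
  have e : FourierTransform.fourier (FourierTransformInv.fourierInv S) = S :=
    FourierTransform.fourier_fourierInv_eq S
  rw [eft_eq_fourier, ← SchwartzMap.fourier_coe, e]
  change G _ = G ξ
  rw [smul_inv_smul₀ h2]

/-- Fourier transforms of test functions are dense in the space of continuous functions on `Γ` that
are `o(⟨ξ⟩^{-N})`. -/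
theorem exists_eft_approx {d : ℕ} {F : Rd d → ℂ} (hF : Continuous F) {Γ : Set (Rd d)} {N : ℕ}
    {C : ℝ} (hdec : ∀ ξ ∈ Γ, ‖F ξ‖ * bracket ξ ^ (N + 1) ≤ C) {ε : ℝ} (hε : 0 < ε) :
    ∃ ψ : Rd d → ℂ, ContDiff ℝ ∞ ψ ∧ HasCompactSupport ψ ∧
      ∀ ξ ∈ Γ, ‖F ξ - eft ψ ξ‖ * bracket ξ ^ N ≤ ε := by
  -- Beyond radius `r` the spare power of `⟨ξ⟩` makes `F` itself negligible on `Γ`. The three thirds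
  -- of `ε` are spent on the cut-off, on smoothing, and on truncating the inverse transform.
  obtain ⟨r, hr0, hr⟩ : ∃ r : ℝ, 0 < r ∧ C ≤ ε / 3 * r := by
    refine ⟨max 1 (C / (ε / 3)), by positivity, ?_⟩
    rw [mul_comm, ← div_le_iff₀ (by positivity)]
    exact le_max_right _ _
  set κ : Rd d → ℝ := fun ξ => max 0 (min 1 (r + 1 - ‖ξ‖)) with hκ
  have hκc : Continuous κ := by fun_prop
  have hκ0 : ∀ ξ, 0 ≤ κ ξ := fun ξ => le_max_left _ _
  have hκ1 : ∀ ξ, κ ξ ≤ 1 := fun ξ => max_le zero_le_one (min_le_left _ _)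
  have hκr : ∀ ξ, ‖ξ‖ ≤ r → κ ξ = 1 := fun ξ h => by
    simp only [hκ]
    rw [min_eq_left (by linarith), max_eq_right zero_le_one]
  have hκz : ∀ ξ, r + 1 ≤ ‖ξ‖ → κ ξ = 0 := fun ξ h => by
    simp only [hκ]
    exact max_eq_left (min_le_of_right_le (by linarith))
  set Fr : Rd d → ℂ := fun ξ => (κ ξ : ℂ) * F ξ with hFr
  have hFrc : Continuous Fr := by fun_prop
  have hFrs : HasCompactSupport Fr := by
    refine HasCompactSupport.intro (isCompact_closedBall (0 : Rd d) (r + 1)) fun ξ hξ => ?_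
    have : r + 1 ≤ ‖ξ‖ := by
      rw [Metric.mem_closedBall, dist_zero_right] at hξ
      linarith
    simp [hFr, hκz ξ this]
  have h1 : ∀ ξ ∈ Γ, ‖F ξ - Fr ξ‖ * bracket ξ ^ N ≤ ε / 3 := by
    intro ξ hξ
    by_cases h : ‖ξ‖ ≤ r
    · simp [hFr, hκr ξ h]
      positivity
    · push Not at h
      have hb := norm_le_bracket ξ
      have e : F ξ - Fr ξ = ((1 - κ ξ : ℝ) : ℂ) * F ξ := by
        simp only [hFr]; push_cast; ring
      have h2 : ‖F ξ - Fr ξ‖ ≤ ‖F ξ‖ := by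
        rw [e, norm_mul, Complex.norm_real, Real.norm_of_nonneg (by linarith [hκ1 ξ])]
        exact mul_le_of_le_one_left (norm_nonneg _) (by linarith [hκ0 ξ])
      have hbp := bracket_pos ξ
      refine le_of_mul_le_mul_right ?_ hbp
      calc ‖F ξ - Fr ξ‖ * bracket ξ ^ N * bracket ξ
          ≤ ‖F ξ‖ * bracket ξ ^ N * bracket ξ := by gcongr
        _ = ‖F ξ‖ * bracket ξ ^ (N + 1) := by ring
        _ ≤ C := hdec ξ hξ
        _ ≤ ε / 3 * r := hr
        _ ≤ _ := by gcongr; linarith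
  set B : ℝ := (1 + (r + 2)) ^ N with hB
  have hB0 : 0 < B := by positivity
  have hu : UniformContinuous Fr := hFrs.uniformContinuous_of_continuous hFrc
  obtain ⟨δ, hδ, huδ⟩ := Metric.uniformContinuous_iff.1 hu (ε / 3 / B) (by positivity)
  -- The scale is also kept at most `1`: then the smoothing vanishes outside radius `r + 2`, and the
  -- weight is bounded by `B` where it matters.
  obtain ⟨G, hG, hGd⟩ := hFrc.exists_contDiff_dist_le_of_forall_mem_ball_dist_le
    (ε := min δ 1) (by positivity)
  have hGz : ∀ ξ, r + 2 ≤ ‖ξ‖ → G ξ = 0 := by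
    intro ξ hξ
    have hz : ∀ y, r + 1 ≤ ‖y‖ → Fr y = 0 := fun y hy => by simp [hFr, hκz y hy]
    have := hGd ξ 0 fun y hy => by
      have h3 : ‖y - ξ‖ < 1 := by
        have := (Metric.mem_ball.1 hy).trans_le (min_le_right _ _)
        rwa [dist_eq_norm] at this
      have h4 : ‖ξ‖ ≤ ‖y‖ + ‖y - ξ‖ := by
        have := norm_sub_le y (y - ξ)
        rwa [sub_sub_cancel] at this
      rw [hz y (by linarith), hz ξ (by linarith), dist_self]
    rw [hz ξ (by linarith)] at this
    simpa using this
  have hGc : HasCompactSupport G := by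
    refine HasCompactSupport.intro (isCompact_closedBall (0 : Rd d) (r + 2)) fun ξ hξ => ?_
    rw [Metric.mem_closedBall, dist_zero_right] at hξ
    exact hGz ξ (by linarith)
  have h2 : ∀ ξ, ‖Fr ξ - G ξ‖ * bracket ξ ^ N ≤ ε / 3 := by
    intro ξ
    by_cases h : ‖ξ‖ ≤ r + 2
    · have h3 : ‖Fr ξ - G ξ‖ ≤ ε / 3 / B := by
        rw [← dist_eq_norm, dist_comm]
        exact hGd ξ _ fun y hy => (huδ ((Metric.mem_ball.1 hy).trans_le (min_le_left _ _))).le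
      have h4 : bracket ξ ^ N ≤ B := by
        rw [hB]
        have := bracket_pos ξ
        gcongr
        exact (bracket_le_one_add_norm ξ).trans (by linarith)
      calc _ ≤ ε / 3 / B * B := mul_le_mul h3 h4 (pow_pos (bracket_pos ξ) N).le (by positivity)
        _ = _ := by field_simp
    · push Not at h
      have h3 : Fr ξ = 0 := by simp [hFr, hκz ξ (by linarith)]
      rw [h3, hGz ξ h.le]
      simp
      positivity
  obtain ⟨g, hg⟩ := exists_schwartz_eft_eq hG hGc
  obtain ⟨ψ, hψ, hψc, hψe⟩ := exists_truncation_eft_le g N (ε := ε / 3) (by positivity)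
  refine ⟨ψ, hψ, hψc, fun ξ hξ => ?_⟩
  have h3 := hψe ξ
  rw [hg] at h3
  have hbp : 0 ≤ bracket ξ ^ N := (pow_pos (bracket_pos ξ) N).le
  calc ‖F ξ - eft ψ ξ‖ * bracket ξ ^ N
      = ‖(F ξ - Fr ξ) + (Fr ξ - G ξ) + (G ξ - eft ψ ξ)‖ * bracket ξ ^ N := by
        congr 2; ring
    _ ≤ (‖F ξ - Fr ξ‖ + ‖Fr ξ - G ξ‖ + ‖G ξ - eft ψ ξ‖) * bracket ξ ^ N := by
        gcongr
        exact norm_add₃_le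
    _ ≤ ε := by
        have h4 := h1 ξ hξ
        have h5 := h2 ξ
        linarith

/-! ### Holomorphic families of waves -/

theorem norm_exp_sub_exp_le {u v : ℂ} (hu : u.re ≤ 0) (hv : v.re ≤ 0) :
    ‖Complex.exp u - Complex.exp v‖ ≤ ‖u - v‖ := by
  have hc : Convex ℝ {z : ℂ | z.re ≤ 0} := convex_halfSpace_re_le 0
  have := hc.norm_image_sub_le_of_norm_hasDerivWithin_le (f := Complex.exp) (f' := Complex.exp)
    (C := 1) (fun z _ => (Complex.hasDerivAt_exp z).hasDerivWithinAt)
    (fun z hz => by rw [Complex.norm_exp]; exact Real.exp_le_one_iff.2 hz) hv hu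
  simpa using this

theorem norm_exp_sub_exp_sub_le {u v : ℂ} (hu : u.re ≤ 0) (hv : v.re ≤ 0) :
    ‖Complex.exp u - Complex.exp v - (u - v) * Complex.exp v‖ ≤ ‖u - v‖ ^ 2 := by
  have hc : Convex ℝ ({z : ℂ | z.re ≤ 0} ∩ Metric.closedBall v ‖u - v‖) :=
    (convex_halfSpace_re_le 0).inter (convex_closedBall _ _)
  have := hc.norm_image_sub_le_of_norm_hasDerivWithin_le
    (f := fun z => Complex.exp z - z * Complex.exp v)
    (f' := fun z => Complex.exp z - 1 * Complex.exp v) (C := ‖u - v‖) (x := v) (y := u)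
    (fun z _ => ((Complex.hasDerivAt_exp z).sub
      ((hasDerivAt_id z).mul_const _)).hasDerivWithinAt)
    (fun z hz => by
      rw [one_mul]
      refine (norm_exp_sub_exp_le hz.1 hv).trans ?_
      have := hz.2
      rwa [Metric.mem_closedBall, dist_eq_norm] at this)
    ⟨hv, by simp⟩ ⟨hu, by simp [dist_eq_norm]⟩
  rw [sq]
  refine le_trans (le_of_eq ?_) this
  congr 1
  ring

/-- Bounded families `z ↦ a e^{-izs}` with `s ≤ 0` on a closed half-plane, tested by a continuous
functional, cannot have Gaussian decay along the real axis unless they vanish there. -/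
theorem wave_apply_eq_zero {α : Type*} [TopologicalSpace α] {a : α → ℂ} {s : α → ℝ}
    (ha : Continuous a) (hs : Continuous s) (hs0 : ∀ x, s x ≤ 0) {B : ℝ}
    (hBnn : 0 ≤ B) (hB0 : ∀ x, ‖a x‖ ≤ B) (hB2 : ∀ x, ‖a x‖ * s x ^ 2 ≤ B) (ℓ : (α →ᵇ ℂ) →L[ℂ] ℂ)
    {b : ℝ → (α →ᵇ ℂ)} (hb : ∀ t x, b t x = a x * Complex.exp (-Complex.I * (t * s x)))
    {C β : ℝ} (hβ : 0 < β) (hdec : ∀ t, ‖ℓ (b t)‖ ≤ C * Real.exp (-β * t ^ 2)) (t : ℝ) :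
    ℓ (b t) = 0 := by
  -- Below the real axis the functions need not be bounded. Clipping the imaginary part defines the
  -- family on all of `ℂ` as bounded functions without changing it on the closed upper half-plane.
  let clip : ℂ → ℂ := fun z => ⟨z.re, max z.im 0⟩
  have hclip : ∀ z : ℂ, 0 ≤ z.im → clip z = z := fun z hz => by
    apply Complex.ext <;> simp [clip, hz]
  have hclip0 : ∀ z, 0 ≤ (clip z).im := fun z => le_max_right _ _
  have hre : ∀ (z : ℂ) (x : α), 0 ≤ z.im → (-Complex.I * (z * s x)).re ≤ 0 := fun z x hz => by
    have : (-Complex.I * (z * s x)).re = z.im * s x := by simp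
    rw [this]
    exact mul_nonpos_of_nonneg_of_nonpos hz (hs0 x)
  have hone : ∀ (z : ℂ) (x : α), 0 ≤ z.im → ‖Complex.exp (-Complex.I * (z * s x))‖ ≤ 1 :=
    fun z x hz => by
      rw [Complex.norm_exp]
      exact Real.exp_le_one_iff.2 (hre z x hz)
  have hB1 : ∀ x, ‖a x‖ * |s x| ≤ B := fun x => by
    rcases le_total |s x| 1 with h | h
    · exact (mul_le_of_le_one_right (norm_nonneg _) h).trans (hB0 x)
    · refine le_trans ?_ (hB2 x)
      rw [← sq_abs]
      gcongr
      nlinarith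
  let w : ℂ → (α →ᵇ ℂ) := fun z => BoundedContinuousFunction.ofNormedAddCommGroup
    (fun x => a x * Complex.exp (-Complex.I * (clip z * s x))) (by fun_prop) B (fun x => by
      rw [norm_mul]
      exact (mul_le_of_le_one_right (norm_nonneg _) (hone _ x (hclip0 z))).trans (hB0 x))
  have hw : ∀ z x, 0 ≤ z.im → w z x = a x * Complex.exp (-Complex.I * (z * s x)) :=
    fun z x hz => by
      change a x * Complex.exp (-Complex.I * (clip z * s x)) = _
      rw [hclip z hz]
  let w' : ℂ → (α →ᵇ ℂ) := fun z => BoundedContinuousFunction.ofNormedAddCommGroup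
    (fun x => a x * ((-Complex.I * s x) * Complex.exp (-Complex.I * (clip z * s x))))
    (by fun_prop) B (fun x => by
      rw [norm_mul, norm_mul, norm_mul, norm_neg, Complex.norm_I, one_mul, Complex.norm_real,
        ← mul_assoc]
      exact (mul_le_of_le_one_right (by positivity) (hone _ x (hclip0 z))).trans (hB1 x))
  have hlip : ∀ z z' : ℂ, 0 ≤ z.im → 0 ≤ z'.im → ‖w z - w z'‖ ≤ B * ‖z - z'‖ := by
    intro z z' hz hz'
    rw [BoundedContinuousFunction.norm_le (by positivity)]
    intro x
    rw [BoundedContinuousFunction.sub_apply, hw z x hz, hw z' x hz', ← mul_sub, norm_mul]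
    calc _ ≤ ‖a x‖ * ‖-Complex.I * (z * s x) - -Complex.I * (z' * s x)‖ := by
          gcongr
          exact norm_exp_sub_exp_le (hre z x hz) (hre z' x hz')
      _ = ‖a x‖ * |s x| * ‖z - z'‖ := by
          rw [← mul_sub, ← sub_mul, norm_mul, norm_mul, norm_neg, Complex.norm_I, one_mul,
            Complex.norm_real, Real.norm_eq_abs]
          ring
      _ ≤ _ := by gcongr; exact hB1 x
  -- The second-order remainder carries `s²`, which is the purpose of the bound on `‖a‖ s²`; it
  -- gives differentiability in sup norm and hence holomorphy after applying `ℓ`.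
  have hder : ∀ z z' : ℂ, 0 ≤ z.im → 0 ≤ z'.im →
      ‖w z' - w z - (z' - z) • w' z‖ ≤ B * ‖z' - z‖ ^ 2 := by
    intro z z' hz hz'
    rw [BoundedContinuousFunction.norm_le (by positivity)]
    intro x
    have e : (w z' - w z - (z' - z) • w' z) x = a x * (Complex.exp (-Complex.I * (z' * s x)) -
        Complex.exp (-Complex.I * (z * s x)) - (-Complex.I * (z' * s x) - -Complex.I * (z * s x)) *
          Complex.exp (-Complex.I * (z * s x))) := by
      rw [BoundedContinuousFunction.sub_apply, BoundedContinuousFunction.sub_apply, hw z x hz,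
        hw z' x hz', BoundedContinuousFunction.smul_apply]
      change _ - (z' - z) • (a x * ((-Complex.I * s x) *
        Complex.exp (-Complex.I * (clip z * s x)))) = _
      rw [hclip z hz, smul_eq_mul]
      ring
    rw [e, norm_mul]
    calc _ ≤ ‖a x‖ * ‖-Complex.I * (z' * s x) - -Complex.I * (z * s x)‖ ^ 2 := by
          gcongr
          exact norm_exp_sub_exp_sub_le (hre z' x hz') (hre z x hz)
      _ = ‖a x‖ * s x ^ 2 * ‖z' - z‖ ^ 2 := by
          rw [← mul_sub, ← sub_mul, norm_mul, norm_mul, norm_neg, Complex.norm_I, one_mul,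
            Complex.norm_real, Real.norm_eq_abs, mul_pow, sq_abs]
          ring
      _ ≤ _ := by gcongr; exact hB2 x
  have hbw : ∀ t : ℝ, b t = w t := fun t => by
    ext x
    rw [hb, hw t x (by simp)]
  have hwn : ∀ z, ‖w z‖ ≤ B := fun z => BoundedContinuousFunction.norm_ofNormedAddCommGroup_le _ hBnn _
  have hC0 : 0 ≤ C := by
    have := (norm_nonneg _).trans (hdec 0)
    simpa using this
  rw [hbw]
  refine eq_zero_of_gaussian_decay (h := fun z => ℓ (w z)) (C := max C (‖ℓ‖ * B)) ?_ ?_ hβ ?_ ?_ t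
  · intro z hz
    have hz' : 0 < z.im := hz
    have h1 : HasDerivAt w (w' z) z := by
      rw [hasDerivAt_iff_isLittleO]
      have h2 : (fun z' => w z' - w z - (z' - z) • w' z) =O[𝓝 z] fun z' => ‖z' - z‖ ^ 2 := by
        refine Asymptotics.IsBigO.of_bound B ?_
        have : ∀ᶠ z' : ℂ in 𝓝 z, 0 < z'.im :=
          (isOpen_lt continuous_const Complex.continuous_im).mem_nhds hz'
        filter_upwards [this] with z' hz''
        rw [Real.norm_of_nonneg (by positivity)]
        exact hder z z' hz'.le hz''.le
      refine h2.trans_isLittleO ?_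
      have h3 : (fun z' : ℂ => ‖z' - z‖ ^ 2) =o[𝓝 z] fun z' => ‖z' - z‖ ^ 1 := by
        have h4 : Tendsto (fun z' : ℂ => ‖z' - z‖) (𝓝 z) (𝓝 0) := by
          have : Continuous fun z' : ℂ => ‖z' - z‖ := by fun_prop
          exact this.tendsto' z 0 (by simp)
        exact (Asymptotics.isLittleO_pow_pow (𝕜 := ℝ) one_lt_two).comp_tendsto h4
      simpa using h3
    exact (ℓ.hasFDerivAt.comp_hasDerivAt z h1).differentiableAt.differentiableWithinAt
  · refine ℓ.continuous.comp_continuousOn ?_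
    have : LipschitzOnWith ⟨B, hBnn⟩ w {z | 0 ≤ z.im} :=
      LipschitzOnWith.of_dist_le_mul fun z hz z' hz' => by
        rw [dist_eq_norm, dist_eq_norm]
        exact hlip z z' hz hz'
    exact this.continuousOn
  · intro z _
    exact ((ℓ.le_opNorm _).trans (by gcongr; exact hwn z)).trans (le_max_right _ _)
  · intro t
    have := hdec t
    rw [hbw] at this
    exact this.trans (by gcongr; exact le_max_left _ _)

/-! ### Corrections supported far away -/

/-- The complex-valued Gaussian `e^{-β|x-x₀|²}`. -/
noncomputable def gaussC {d : ℕ} (β : ℝ) (x₀ x : Rd d) : ℂ :=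
  Complex.exp ((-(β * ‖x - x₀‖ ^ 2) : ℝ) : ℂ)

theorem norm_gaussC {d : ℕ} (β : ℝ) (x₀ x : Rd d) :
    ‖gaussC β x₀ x‖ = Real.exp (-β * ‖x - x₀‖ ^ 2) := by
  rw [gaussC, Complex.norm_exp, Complex.ofReal_re, neg_mul]

theorem gaussC_mul {d : ℕ} (β β' : ℝ) (x₀ x : Rd d) :
    gaussC β x₀ x * gaussC β' x₀ x = gaussC (β + β') x₀ x := by
  rw [gaussC, gaussC, gaussC, ← Complex.exp_add]
  push_cast
  ring_nf

theorem gaussianWave_zero {d : ℕ} (x₀ : Rd d) (M : ℕ+) (x : Rd d) :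
    gaussianWave x₀ M 0 x = gaussC (4 * (M : ℝ))⁻¹ x₀ x := by
  rw [gaussianWave, gaussC]
  congr 1
  simp
  ring

theorem contDiff_gaussC {d : ℕ} (β : ℝ) (x₀ : Rd d) : ContDiff ℝ ∞ (gaussC β x₀) := by
  have h1 : ContDiff ℝ ∞ (fun x : Rd d => -(β * ‖x - x₀‖ ^ 2)) :=
    (contDiff_const.mul ((contDiff_id.sub contDiff_const).norm_sq ℝ)).neg
  exact (Complex.ofRealCLM.contDiff.comp h1).cexp

theorem fderiv_gaussC {d : ℕ} (β : ℝ) (x₀ x : Rd d) :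
    fderiv ℝ (gaussC β x₀) x = gaussC β x₀ x •
      (((-(2 * β)) • innerCBilin d) x + (2 * β) • innerC x₀) := by
  have h1 : HasFDerivAt (fun x : Rd d => ‖x - x₀‖ ^ 2) (2 • (innerSL ℝ (x - x₀))) x := by
    simpa using ((hasFDerivAt_id x).sub_const x₀).norm_sq
  have h2 := (Complex.ofRealCLM.hasFDerivAt.comp x (h1.const_mul β).neg).cexp
  have e : gaussC β x₀ =
      fun x => Complex.exp ((Complex.ofRealCLM ∘ (-fun y => β * ‖y - x₀‖ ^ 2)) x) := rfl
  rw [e, h2.fderiv]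
  ext y
  simp
  ring

theorem exists_norm_iteratedFDeriv_gaussC_le {d : ℕ} {β : ℝ} (hβ : 0 < β) (x₀ : Rd d) (N : ℕ) :
    ∃ C : ℝ, 0 < C ∧ ∀ n ≤ N, ∀ x,
      ‖iteratedFDeriv ℝ n (gaussC β x₀) x‖ ≤ C * Real.exp (-(β / 2) * ‖x - x₀‖ ^ 2) := by
  obtain ⟨C, hC, hb⟩ := exists_bracket_pow_le_exp (d := d) N (κ := β / 2) (by positivity)
  set Λ := (-(2 * β)) • innerCBilin d with hΛ
  set c := 1 + 2 * β + √(‖Λ‖ * N) with hc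
  have hc1 : 1 ≤ c := by rw [hc]; linarith [Real.sqrt_nonneg (‖Λ‖ * N)]
  refine ⟨c ^ N * C, by positivity, fun n hn x => ?_⟩
  refine (norm_iteratedFDeriv_le_of_fderiv_eq (contDiff_gaussC β x₀) Λ ((2 * β) • innerC x₀)
    (fderiv_gaussC β x₀) x n).trans ?_
  have h1 : ‖Λ x + (2 * β) • innerC x₀‖ ≤ 2 * β * ‖x - x₀‖ := by
    have e : Λ x + (2 * β) • innerC x₀ = (-(2 * β)) • innerC (x - x₀) := by
      ext y
      simp [hΛ, inner_sub_left]
      ring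
    rw [e, norm_smul, norm_neg, Real.norm_of_nonneg (by positivity)]
    gcongr
    exact norm_innerC_le _
  have hbr := one_le_bracket (x - x₀)
  have h2 : ‖Λ x + (2 * β) • innerC x₀‖ + √(‖Λ‖ * n) ≤ c * bracket (x - x₀) := by
    have h3 : √(‖Λ‖ * n) ≤ √(‖Λ‖ * N) := by
      apply Real.sqrt_le_sqrt
      gcongr
    have h4 := norm_le_bracket (x - x₀)
    have h5 := Real.sqrt_nonneg (‖Λ‖ * N)
    calc _ ≤ 2 * β * bracket (x - x₀) + √(‖Λ‖ * N) * 1 := by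
          rw [mul_one]; exact add_le_add (h1.trans (by gcongr)) h3
      _ ≤ 2 * β * bracket (x - x₀) + √(‖Λ‖ * N) * bracket (x - x₀) := by gcongr
      _ ≤ _ := by rw [hc]; nlinarith
  rw [norm_gaussC]
  calc Real.exp (-β * ‖x - x₀‖ ^ 2) * (‖Λ x + (2 * β) • innerC x₀‖ + √(‖Λ‖ * n)) ^ n
      ≤ Real.exp (-β * ‖x - x₀‖ ^ 2) * (c * bracket (x - x₀)) ^ n := by gcongr
    _ ≤ Real.exp (-β * ‖x - x₀‖ ^ 2) * (c * bracket (x - x₀)) ^ N := by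
        gcongr
        nlinarith
    _ ≤ Real.exp (-β * ‖x - x₀‖ ^ 2) * (c ^ N * (C * Real.exp (β / 2 * ‖x - x₀‖ ^ 2))) := by
        rw [mul_pow]
        gcongr
        exact hb _
    _ = c ^ N * C * (Real.exp (-β * ‖x - x₀‖ ^ 2) * Real.exp (β / 2 * ‖x - x₀‖ ^ 2)) := by ring
    _ = _ := by rw [← Real.exp_add]; ring_nf

/-- Sliding a test function along `θ` under a Gaussian gives Gaussian decay of all derivatives. -/
theorem exists_integral_sliding_le {d : ℕ} {ψ : Rd d → ℂ} (hψ : ContDiff ℝ ∞ ψ)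
    (hψc : HasCompactSupport ψ) {β κ : ℝ} (hβ : 0 < β) (x₀ θ : Rd d) (hκ : κ ≤ β / 4 * ‖θ‖ ^ 2)
    (N : ℕ) : ∃ C : ℝ, 0 ≤ C ∧ ∀ n ≤ N, ∀ t : ℝ,
      ∫ x, ‖iteratedFDeriv ℝ n (fun x => ψ (x - t • θ) * gaussC β x₀ x) x‖ ≤
        C * Real.exp (-κ * t ^ 2) := by
  obtain ⟨C₁, hC₁, hg⟩ := exists_norm_iteratedFDeriv_gaussC_le hβ x₀ N
  obtain ⟨K, hK, hψK⟩ := exists_norm_iteratedFDeriv_le hψ hψc N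
  obtain ⟨R, hR⟩ := hψc.isCompact.isBounded.subset_closedBall (0 : Rd d)
  have hR0 : 0 ≤ |R| := abs_nonneg R
  set h : Rd d → ℝ := (Metric.closedBall (0 : Rd d) R).indicator fun _ => 1 with hh
  have hhi : Integrable h := (integrable_indicator_iff measurableSet_closedBall).2
    (integrableOn_const (by exact measure_closedBall_lt_top.ne) (by simp))
  set D := 2 ^ N * (K * (C₁ * Real.exp (β / 2 * (|R| + ‖x₀‖) ^ 2))) with hD
  refine ⟨D * ∫ x, h x, by
    have : 0 ≤ ∫ x, h x := integral_nonneg fun x => Set.indicator_nonneg (fun _ _ => zero_le_one) x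
    positivity, fun n hn t => ?_⟩
  have hpt : ∀ x, ‖iteratedFDeriv ℝ n (fun x => ψ (x - t • θ) * gaussC β x₀ x) x‖ ≤
      D * Real.exp (-κ * t ^ 2) * h (x - t • θ) := by
    intro x
    by_cases hx : x - t • θ ∈ tsupport ψ
    · have hx' := hR hx
      have h1 : h (x - t • θ) = 1 := Set.indicator_of_mem hx' _
      rw [h1, mul_one]
      have htr : ContDiff ℝ ∞ fun x => ψ (x - t • θ) := hψ.comp (contDiff_id.sub contDiff_const)
      refine (norm_iteratedFDeriv_mul_le_of_le htr (contDiff_gaussC β x₀) (a := K)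
        (fun i hi => ?_) (fun i hi => hg i hi x) hn).trans ?_
      · rw [iteratedFDeriv_comp_sub]
        exact hψK i hi _
      · rw [Metric.mem_closedBall, dist_zero_right] at hx'
        -- On the support of the shifted function `x` stays within a bounded distance of `tθ`, so
        -- the remaining factor `e^{-(β/2)‖x-x₀‖²}` is at most a constant times `e^{-(β/4)‖θ‖²t²}`.
        have h2 : ‖t • θ‖ ≤ ‖x - x₀‖ + (|R| + ‖x₀‖) := by
          have e : t • θ = (x - x₀) + x₀ - (x - t • θ) := by abel
          rw [e]
          refine (norm_sub_le _ _).trans ?_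
          have := norm_add_le (x - x₀) x₀
          linarith [le_abs_self R]
        have h3 : κ * t ^ 2 ≤ β / 2 * ‖x - x₀‖ ^ 2 + β / 2 * (|R| + ‖x₀‖) ^ 2 := by
          have h4 : ‖t • θ‖ ^ 2 = ‖θ‖ ^ 2 * t ^ 2 := by
            rw [norm_smul, mul_pow, Real.norm_eq_abs, sq_abs]; ring
          have h5 : ‖t • θ‖ ^ 2 ≤ 2 * ‖x - x₀‖ ^ 2 + 2 * (|R| + ‖x₀‖) ^ 2 := by
            have : ‖t • θ‖ ^ 2 ≤ (‖x - x₀‖ + (|R| + ‖x₀‖)) ^ 2 := by gcongr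
            nlinarith [sq_nonneg (‖x - x₀‖ - (|R| + ‖x₀‖))]
          have h6 : κ * t ^ 2 ≤ β / 4 * ‖θ‖ ^ 2 * t ^ 2 := by gcongr
          nlinarith
        rw [hD]
        calc 2 ^ N * (K * (C₁ * Real.exp (-(β / 2) * ‖x - x₀‖ ^ 2)))
            ≤ 2 ^ N * (K * (C₁ * Real.exp (β / 2 * (|R| + ‖x₀‖) ^ 2 + -κ * t ^ 2))) := by
              gcongr
              linarith
          _ = _ := by rw [Real.exp_add]; ring
    · have hz : (fun x => ψ (x - t • θ) * gaussC β x₀ x) =ᶠ[𝓝 x] fun _ => (0 : ℂ) := by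
        have h1 : Tendsto (fun y : Rd d => y - t • θ) (𝓝 x) (𝓝 (x - t • θ)) := by
          have : Continuous fun y : Rd d => y - t • θ := by fun_prop
          exact this.tendsto x
        have h2 := h1.eventually (notMem_tsupport_iff_eventuallyEq.1 hx)
        filter_upwards [h2] with y hy
        simp [hy]
      rw [(hz.iteratedFDeriv ℝ n).eq_of_nhds]
      simp only [iteratedFDeriv_fun_zero, Pi.zero_apply, norm_zero]
      have : 0 ≤ h (x - t • θ) := Set.indicator_nonneg (fun _ _ => zero_le_one) _
      positivity
  calc _ ≤ ∫ x, D * Real.exp (-κ * t ^ 2) * h (x - t • θ) := by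
        refine integral_mono_of_nonneg (Eventually.of_forall fun x => norm_nonneg _) ?_
          (Eventually.of_forall hpt)
        exact (hhi.comp_sub_right (t • θ)).const_mul _
    _ = _ := by
        rw [integral_const_mul, integral_sub_right_eq_self h]
        ring

/-- The Gaussian transform `∫ f(x) E_{x₀,M}(x) e^{-i⟨x,ξ⟩} dx` of a function. -/
noncomputable def fnSTFT {d : ℕ} (f : Rd d → ℂ) (x₀ : Rd d) (M : ℕ+) (ξ : Rd d) : ℂ :=
  ∫ x, f x * gaussianWave x₀ M ξ x

theorem gaussianWave_eq_mul {d : ℕ} (x₀ : Rd d) (M : ℕ+) (ξ x : Rd d) :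
    gaussianWave x₀ M ξ x = gaussC (4 * (M : ℝ))⁻¹ x₀ x * character ξ x := by
  have := congrFun (gaussianWave_add x₀ M 0 ξ) x
  rw [zero_add] at this
  rw [this, gaussianWave_zero]

theorem fnSTFT_eq_eft {d : ℕ} (f : Rd d → ℂ) (x₀ : Rd d) (M : ℕ+) (ξ : Rd d) :
    fnSTFT f x₀ M ξ = eft (fun x => f x * gaussC (4 * (M : ℝ))⁻¹ x₀ x) ξ := by
  unfold fnSTFT eft
  simp only [gaussianWave_eq_mul, mul_assoc]

/-- Test functions that vanish on the closed ball of radius `R` around `x₀`. -/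
def farTest {d : ℕ} (x₀ : Rd d) (R : ℝ) : Submodule ℂ (Rd d → ℂ) where
  carrier := {f | ContDiff ℝ ∞ f ∧ HasCompactSupport f ∧ ∀ x, ‖x - x₀‖ ≤ R → f x = 0}
  zero_mem' := ⟨contDiff_const, HasCompactSupport.zero, fun _ _ => rfl⟩
  add_mem' := by
    rintro f g ⟨h1, h2, h3⟩ ⟨h1', h2', h3'⟩
    exact ⟨h1.add h1', h2.add h2', fun x hx => by simp [h3 x hx, h3' x hx]⟩
  smul_mem' := by
    rintro c f ⟨h1, h2, h3⟩
    exact ⟨contDiff_const.smul h1, h2.smul_left, fun x hx => by simp [h3 x hx]⟩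

/-! ### Weighted transforms of far-supported test functions -/

section farTest

variable {d : ℕ} {x₀ : Rd d} {R : ℝ}

theorem farTest.contDiff_mul (f : farTest x₀ R) (β : ℝ) :
    ContDiff ℝ ∞ fun x => f.1 x * gaussC β x₀ x := f.2.1.mul (contDiff_gaussC β x₀)

theorem farTest.hasCompactSupport_mul (f : farTest x₀ R) (β : ℝ) :
    HasCompactSupport fun x => f.1 x * gaussC β x₀ x := f.2.2.1.mul_right

theorem farTest.integrable_mul (f : farTest x₀ R) (β : ℝ) :
    Integrable fun x => f.1 x * gaussC β x₀ x :=
  (farTest.contDiff_mul f β).continuous.integrable_of_hasCompactSupport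
    (farTest.hasCompactSupport_mul f β)

/-- The seminorm `∑ ∫ ‖D^n (f E_{x₀,M})‖` over `n ≤ N` and finitely many widths. -/
noncomputable def farSeminorm (x₀ : Rd d) (R : ℝ) (S : Finset ℕ+) (N : ℕ) :
    Seminorm ℂ (farTest x₀ R) :=
  Seminorm.of (fun f => ∑ M ∈ S, ∑ n ∈ Finset.range (N + 1),
      ∫ x, ‖iteratedFDeriv ℝ n (fun x => f.1 x * gaussC (4 * (M : ℝ))⁻¹ x₀ x) x‖)
    (fun f g => by
      rw [← Finset.sum_add_distrib]
      refine Finset.sum_le_sum fun M _ => ?_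
      rw [← Finset.sum_add_distrib]
      refine Finset.sum_le_sum fun n _ => ?_
      have hf := integrable_iteratedFDeriv_of_hasCompactSupport
        (farTest.contDiff_mul f (4 * (M : ℝ))⁻¹) (farTest.hasCompactSupport_mul f _) n
      have hg := integrable_iteratedFDeriv_of_hasCompactSupport
        (farTest.contDiff_mul g (4 * (M : ℝ))⁻¹) (farTest.hasCompactSupport_mul g _) n
      rw [← integral_add hf.norm hg.norm]
      have e : (fun x => (f + g).1 x * gaussC (4 * (M : ℝ))⁻¹ x₀ x) =
          (fun x => f.1 x * gaussC (4 * (M : ℝ))⁻¹ x₀ x) +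
            fun x => g.1 x * gaussC (4 * (M : ℝ))⁻¹ x₀ x := by
        funext x
        exact add_mul _ _ _
      refine integral_mono_of_nonneg (Eventually.of_forall fun x => norm_nonneg _)
        (hf.norm.add hg.norm) (Eventually.of_forall fun x => ?_)
      simp only [e]
      rw [iteratedFDeriv_add_apply
        ((farTest.contDiff_mul f _).of_le (mod_cast le_top)).contDiffAt
        ((farTest.contDiff_mul g _).of_le (mod_cast le_top)).contDiffAt]
      exact norm_add_le _ _)
    (fun c f => by
      rw [Finset.mul_sum]
      refine Finset.sum_congr rfl fun M _ => ?_
      rw [Finset.mul_sum]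
      refine Finset.sum_congr rfl fun n _ => ?_
      rw [← integral_const_mul]
      refine integral_congr_ae (Eventually.of_forall fun x => ?_)
      have e : (fun x => (c • f).1 x * gaussC (4 * (M : ℝ))⁻¹ x₀ x) =
          c • fun x => f.1 x * gaussC (4 * (M : ℝ))⁻¹ x₀ x := by
        funext x
        exact mul_assoc _ _ _
      simp only [e]
      rw [iteratedFDeriv_const_smul_apply
        ((farTest.contDiff_mul f _).of_le (mod_cast le_top)).contDiffAt, norm_smul])

theorem farSeminorm_apply (S : Finset ℕ+) (N : ℕ) (f : farTest x₀ R) :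
    farSeminorm x₀ R S N f = ∑ M ∈ S, ∑ n ∈ Finset.range (N + 1),
      ∫ x, ‖iteratedFDeriv ℝ n (fun x => f.1 x * gaussC (4 * (M : ℝ))⁻¹ x₀ x) x‖ := rfl

theorem sum_integral_le_farSeminorm {S : Finset ℕ+} {M : ℕ+} (hM : M ∈ S) (N : ℕ)
    (f : farTest x₀ R) : ∑ n ∈ Finset.range (N + 1),
      ∫ x, ‖iteratedFDeriv ℝ n (fun x => f.1 x * gaussC (4 * (M : ℝ))⁻¹ x₀ x) x‖ ≤
        farSeminorm x₀ R S N f := by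
  rw [farSeminorm_apply]
  exact Finset.single_le_sum (f := fun M : ℕ+ => ∑ n ∈ Finset.range (N + 1),
      ∫ x, ‖iteratedFDeriv ℝ n (fun x => f.1 x * gaussC (4 * (M : ℝ))⁻¹ x₀ x) x‖)
    (fun M _ => Finset.sum_nonneg fun n _ => integral_nonneg fun x => norm_nonneg _) hM

/-- The weighted Gaussian transform on `Γ` as a bounded function. -/
noncomputable def farTransform (x₀ : Rd d) (R : ℝ) (M : ℕ+) (N : ℕ) (Γ : Set (Rd d)) :
    farTest x₀ R →ₗ[ℂ] (Γ →ᵇ ℂ) where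
  toFun f := BoundedContinuousFunction.ofNormedAddCommGroup
    (fun ξ : Γ => ((bracket ξ.1 ^ N : ℝ) : ℂ) * fnSTFT f.1 x₀ M ξ.1) (by
      have h1 := continuous_eft (farTest.integrable_mul f (4 * (M : ℝ))⁻¹)
      have h2 := continuous_bracket (d := d)
      simp only [fnSTFT_eq_eft]
      fun_prop)
    (exists_bracket_pow_mul_eft_le_of_hasCompactSupport
      (farTest.contDiff_mul f (4 * (M : ℝ))⁻¹) (farTest.hasCompactSupport_mul f _) N).choose
    (fun ξ => by
      rw [fnSTFT_eq_eft, norm_mul, Complex.norm_real,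
        Real.norm_of_nonneg (pow_pos (bracket_pos _) N).le, mul_comm]
      exact (exists_bracket_pow_mul_eft_le_of_hasCompactSupport
        (farTest.contDiff_mul f (4 * (M : ℝ))⁻¹)
          (farTest.hasCompactSupport_mul f _) N).choose_spec.2 ξ.1)
  map_add' f g := by
    ext ξ
    change _ * fnSTFT _ _ _ _ = _ * fnSTFT _ _ _ _ + _ * fnSTFT _ _ _ _
    rw [fnSTFT_eq_eft, fnSTFT_eq_eft, fnSTFT_eq_eft, ← mul_add,
      ← eft_add (farTest.integrable_mul f _) (farTest.integrable_mul g _)]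
    simp only [← add_mul]
    rfl
  map_smul' c f := by
    ext ξ
    change _ * fnSTFT _ _ _ _ = c * (_ * fnSTFT _ _ _ _)
    rw [fnSTFT_eq_eft, fnSTFT_eq_eft, mul_left_comm c, ← eft_const_mul _ c]
    simp only [← mul_assoc]
    rfl

theorem farTransform_apply (M : ℕ+) (N : ℕ) (Γ : Set (Rd d)) (f : farTest x₀ R) (ξ : Γ) :
    farTransform x₀ R M N Γ f ξ = ((bracket ξ.1 ^ N : ℝ) : ℂ) * fnSTFT f.1 x₀ M ξ.1 := rfl

end farTest

/-! ### The duality argument for one correction -/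

theorem character_smul {d : ℕ} (ξ θ : Rd d) (t : ℝ) :
    character ξ (t • θ) = Complex.exp (-Complex.I * (t * (inner ℝ θ ξ : ℝ))) := by
  unfold character
  rw [inner_smul_right, real_inner_comm]
  push_cast
  rfl

/-- A functional on the weighted space over a half-space `Γ` that is dominated by the narrower
Gaussian windows annihilates the Fourier transforms of all test functions. -/
theorem dual_eft_eq_zero {d : ℕ} {x₀ θ : Rd d} (hθ : θ ≠ 0) {R : ℝ} {M : ℕ+} {S : Finset ℕ+}
    (hS : ∀ M' ∈ S, M' < M) {N : ℕ} {Γ : Set (Rd d)} (hΓ : ∀ ξ ∈ Γ, inner ℝ θ ξ ≤ 0)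
    (ℓ : (Γ →ᵇ ℂ) →L[ℂ] ℂ) {C : ℝ}
    (hℓ : ∀ f, ‖ℓ (farTransform x₀ R M N Γ f)‖ ≤ C * farSeminorm x₀ R S N f)
    {ψ : Rd d → ℂ} (hψ : ContDiff ℝ ∞ ψ) (hψc : HasCompactSupport ψ) (b : Γ →ᵇ ℂ)
    (hb : ∀ ξ : Γ, b ξ = ((bracket ξ.1 ^ N : ℝ) : ℂ) * eft ψ ξ.1) : ℓ b = 0 := by
  have hM0 : (0 : ℝ) < M := by exact_mod_cast M.pos
  have hθ0 : 0 < ‖θ‖ := norm_pos_iff.2 hθ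
  set a : Γ → ℂ := fun ξ => ((bracket ξ.1 ^ N : ℝ) : ℂ) * eft ψ ξ.1 with ha
  set s : Γ → ℝ := fun ξ => inner ℝ θ ξ.1 with hs
  have hψi : Integrable ψ := hψ.continuous.integrable_of_hasCompactSupport hψc
  have hac : Continuous a := by
    have h1 := continuous_eft hψi
    have h2 := continuous_bracket (d := d)
    fun_prop
  have hsc : Continuous s := by fun_prop
  -- Two extra powers make `a ξ · ⟨θ,ξ⟩²` bounded, as required for holomorphy of the family of
  -- waves.
  obtain ⟨B, hB, hψB⟩ := exists_bracket_pow_mul_eft_le_of_hasCompactSupport hψ hψc (N + 2)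
  have hna : ∀ ξ, ‖a ξ‖ = ‖eft ψ ξ.1‖ * bracket ξ.1 ^ N := fun ξ => by
    rw [ha, norm_mul, Complex.norm_real, Real.norm_of_nonneg (pow_pos (bracket_pos _) N).le,
      mul_comm]
  have hB2' : ∀ ξ : Γ, ‖a ξ‖ * bracket ξ.1 ^ 2 ≤ B := fun ξ => by
    rw [hna, mul_assoc, ← pow_add]
    exact hψB ξ.1
  have hBa : ∀ ξ, ‖a ξ‖ ≤ B := fun ξ =>
    (le_mul_of_one_le_right (norm_nonneg _) (one_le_pow₀ (one_le_bracket _))).trans (hB2' ξ)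
  have hB2 : ∀ ξ, ‖a ξ‖ * s ξ ^ 2 ≤ (1 + ‖θ‖ ^ 2) * B := fun ξ => by
    have h1 : s ξ ^ 2 ≤ ‖θ‖ ^ 2 * bracket ξ.1 ^ 2 := by
      rw [← mul_pow, ← sq_abs]
      gcongr
      exact (abs_real_inner_le_norm _ _).trans (by gcongr; exact norm_le_bracket _)
    calc ‖a ξ‖ * s ξ ^ 2 ≤ ‖a ξ‖ * (‖θ‖ ^ 2 * bracket ξ.1 ^ 2) := by gcongr
      _ = ‖θ‖ ^ 2 * (‖a ξ‖ * bracket ξ.1 ^ 2) := by ring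
      _ ≤ ‖θ‖ ^ 2 * B := by gcongr; exact hB2' ξ
      _ ≤ _ := by nlinarith
  let w : ℝ → (Γ →ᵇ ℂ) := fun t => BoundedContinuousFunction.ofNormedAddCommGroup
    (fun ξ => a ξ * Complex.exp (-Complex.I * (t * s ξ))) (by fun_prop) B (fun ξ => by
      have : ‖Complex.exp (-Complex.I * (t * s ξ))‖ = 1 := by
        rw [Complex.norm_exp]; simp
      rw [norm_mul, this, mul_one]
      exact hBa ξ)
  have hwn : ∀ t, ‖w t‖ ≤ B := fun t =>
    BoundedContinuousFunction.norm_ofNormedAddCommGroup_le _ hB.le _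
  have hwb : w 0 = b := by
    ext ξ
    change a ξ * Complex.exp (-Complex.I * ((0 : ℝ) * s ξ)) = _
    rw [hb]
    simp [ha]
  rw [← hwb]
  -- decay along the real axis
  set κ : ℝ := (4 * (M : ℝ) ^ 2)⁻¹ / 4 * ‖θ‖ ^ 2 with hκ
  have hκ0 : 0 < κ := by positivity
  have hslide : ∀ M' ∈ S, ∃ C : ℝ, 0 ≤ C ∧ ∀ n ≤ N, ∀ t : ℝ,
      ∫ x, ‖iteratedFDeriv ℝ n (fun x => ψ (x - t • θ) *
        gaussC ((4 * (M' : ℝ))⁻¹ - (4 * (M : ℝ))⁻¹) x₀ x) x‖ ≤ C * Real.exp (-κ * t ^ 2) := by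
    intro M' hM'
    have h0 : (0 : ℝ) < M' := by exact_mod_cast M'.pos
    have h1 : (M' : ℝ) + 1 ≤ M := by exact_mod_cast (PNat.add_one_le_iff.2 (hS M' hM'))
    -- Integer widths `M' < M` differ by at least one, so the gap `(M - M')/(4MM')` is at least
    -- `1/(4M²)`; this gives a rate `κ` common to all `M'` in `S`.
    have h2 : (4 * (M : ℝ) ^ 2)⁻¹ ≤ (4 * (M' : ℝ))⁻¹ - (4 * (M : ℝ))⁻¹ := by
      have e : (4 * (M' : ℝ))⁻¹ - (4 * (M : ℝ))⁻¹ = ((M : ℝ) - M') * (4 * ((M : ℝ) * M'))⁻¹ := by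
        field_simp
      rw [e]
      calc (4 * (M : ℝ) ^ 2)⁻¹ ≤ (4 * ((M : ℝ) * M'))⁻¹ := by
            gcongr
            nlinarith
        _ ≤ _ := le_mul_of_one_le_left (by positivity) (by linarith)
    exact exists_integral_sliding_le hψ hψc (lt_of_lt_of_le (by positivity) h2) x₀ θ
      (by rw [hκ]; gcongr) N
  choose! C' hC'0 hC' using hslide
  obtain ⟨r, hr⟩ := hψc.isCompact.isBounded.subset_closedBall (0 : Rd d)
  -- For `|t| ≥ T` the support of `ψ(· - tθ)` misses the ball of radius `R` around `x₀`. For smaller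
  -- `|t|` boundedness of `ℓ` suffices, since `e^{-κt²}` is bounded below there.
  set T := (|R| + |r| + ‖x₀‖) / ‖θ‖ + 1 with hT
  have hT0 : 0 < T := by positivity
  set D := |C| * ∑ M' ∈ S, ((N + 1 : ℕ) : ℝ) * C' M' with hD
  have hD0 : 0 ≤ D := mul_nonneg (abs_nonneg _) (Finset.sum_nonneg fun M' hM' =>
    mul_nonneg (Nat.cast_nonneg _) (hC'0 M' hM'))
  have hdec : ∀ t, ‖ℓ (w t)‖ ≤ (D + ‖ℓ‖ * B * Real.exp (κ * T ^ 2)) * Real.exp (-κ * t ^ 2) := by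
    intro t
    rw [add_mul]
    by_cases ht : |t| < T
    · have h1 : ‖ℓ (w t)‖ ≤ ‖ℓ‖ * B := (ℓ.le_opNorm _).trans (by gcongr; exact hwn t)
      have h2 : 1 ≤ Real.exp (κ * T ^ 2) * Real.exp (-κ * t ^ 2) := by
        rw [← Real.exp_add]
        refine Real.one_le_exp ?_
        have : t ^ 2 ≤ T ^ 2 := by
          rw [← sq_abs t]
          gcongr
        nlinarith
      have h3 : ‖ℓ‖ * B ≤ ‖ℓ‖ * B * Real.exp (κ * T ^ 2) * Real.exp (-κ * t ^ 2) := by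
        rw [mul_assoc (‖ℓ‖ * B)]
        exact le_mul_of_one_le_right (by positivity) h2
      have h4 : 0 ≤ D * Real.exp (-κ * t ^ 2) := by positivity
      linarith
    · push Not at ht
      -- The growing Gaussian is the inverse of the window of width `M`: there the product is `ψ(· -
      -- tθ)` exactly, while every narrower window leaves a decaying Gaussian.
      let f : farTest x₀ R := ⟨fun x => ψ (x - t • θ) * gaussC (-(4 * (M : ℝ))⁻¹) x₀ x,
        (hψ.comp (contDiff_id.sub contDiff_const)).mul (contDiff_gaussC _ _),
        (by
          have := hψc.comp_homeomorph (Homeomorph.subRight (t • θ))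
          exact this.mul_right), fun x hx => by
          have h1 : ψ (x - t • θ) = 0 := by
            refine image_eq_zero_of_notMem_tsupport fun hmem => ?_
            have h2 := hr hmem
            rw [Metric.mem_closedBall, dist_zero_right] at h2
            have h3 : ‖t • θ‖ ≤ |R| + |r| + ‖x₀‖ := by
              have e : t • θ = (x - x₀) + x₀ - (x - t • θ) := by abel
              rw [e]
              refine (norm_sub_le _ _).trans ?_
              have := norm_add_le (x - x₀) x₀
              linarith [le_abs_self R, le_abs_self r]
            rw [norm_smul, Real.norm_eq_abs, ← le_div_iff₀ hθ0] at h3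
            linarith
          simp [h1]⟩
      have hf : ∀ β x, f.1 x * gaussC β x₀ x =
          ψ (x - t • θ) * gaussC (β - (4 * (M : ℝ))⁻¹) x₀ x := fun β x => by
        change ψ (x - t • θ) * gaussC (-(4 * (M : ℝ))⁻¹) x₀ x * gaussC β x₀ x = _
        rw [mul_assoc, gaussC_mul]
        ring_nf
      have hfw : farTransform x₀ R M N Γ f = w t := by
        ext ξ
        rw [farTransform_apply, fnSTFT_eq_eft]
        simp only [hf, sub_self]
        have e : (fun x => ψ (x - t • θ) * gaussC 0 x₀ x) = fun x => ψ (x - t • θ) := by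
          funext x
          simp [gaussC]
        rw [e, eft_translate, character_smul]
        change _ = a ξ * Complex.exp (-Complex.I * (t * s ξ))
        simp only [ha, hs]
        ring
      have h1 := hℓ f
      rw [hfw] at h1
      have h2 : farSeminorm x₀ R S N f ≤
          (∑ M' ∈ S, ((N + 1 : ℕ) : ℝ) * C' M') * Real.exp (-κ * t ^ 2) := by
        rw [farSeminorm_apply, Finset.sum_mul]
        refine Finset.sum_le_sum fun M' hM' => ?_
        calc _ ≤ ∑ n ∈ Finset.range (N + 1), C' M' * Real.exp (-κ * t ^ 2) := by
              refine Finset.sum_le_sum fun n hn => ?_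
              simp only [hf]
              exact hC' M' hM' n (Finset.mem_range_succ_iff.1 hn) t
          _ = _ := by
              rw [Finset.sum_const, Finset.card_range, nsmul_eq_mul]
              ring
      calc ‖ℓ (w t)‖ ≤ C * farSeminorm x₀ R S N f := h1
        _ ≤ |C| * farSeminorm x₀ R S N f := by
            gcongr
            exact le_abs_self C
        _ ≤ |C| * ((∑ M' ∈ S, ((N + 1 : ℕ) : ℝ) * C' M') * Real.exp (-κ * t ^ 2)) := by gcongr
        _ = D * Real.exp (-κ * t ^ 2) := by rw [hD]; ring
        _ ≤ _ := by
            have : 0 ≤ ‖ℓ‖ * B * Real.exp (κ * T ^ 2) * Real.exp (-κ * t ^ 2) := by positivity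
            linarith
  exact wave_apply_eq_zero hac hsc (fun ξ => hΓ ξ.1 ξ.2) (B := (1 + ‖θ‖ ^ 2) * B) (by positivity)
    (fun ξ => (hBa ξ).trans (by nlinarith [sq_nonneg ‖θ‖])) hB2 ℓ (b := w) (fun t ξ => rfl) hκ0 hdec 0

/-- The Gaussian transform of a function can be cancelled on a half-space, at a given width, by a
test function supported far away whose transforms at all narrower widths are small. -/
theorem exists_correction {d : ℕ} {x₀ θ : Rd d} (hθ : θ ≠ 0) {F : Rd d → ℂ} (hF : Continuous F)
    {Γ : Set (Rd d)} (hΓ : ∀ ξ ∈ Γ, inner ℝ θ ξ ≤ 0) {N : ℕ} {C : ℝ}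
    (hdec : ∀ ξ ∈ Γ, ‖F ξ‖ * bracket ξ ^ (N + 1) ≤ C) (M : ℕ+) (S : Finset ℕ+)
    (hS : ∀ M' ∈ S, M' < M) (R : ℝ) {δ : ℝ} (hδ : 0 < δ) :
    ∃ f ∈ farTest x₀ R, (∀ ξ ∈ Γ, ‖F ξ + fnSTFT f x₀ M ξ‖ * bracket ξ ^ N ≤ δ) ∧
      ∀ M' ∈ S, (∀ ξ, ‖fnSTFT f x₀ M' ξ‖ * bracket ξ ^ N ≤ δ) ∧
        ∫ x, ‖f x‖ * ‖gaussianWave x₀ M' 0 x‖ ≤ δ := by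
  have hbr := continuous_bracket (d := d)
  have hb0 : ∀ ξ : Rd d, 0 ≤ bracket ξ ^ N := fun ξ => (pow_pos (bracket_pos ξ) N).le
  have hdec' : ∀ ξ ∈ Γ, ‖F ξ‖ * bracket ξ ^ N ≤ C := fun ξ hξ => by
    refine le_trans ?_ (hdec ξ hξ)
    gcongr
    · exact one_le_bracket ξ
    · omega
  let x : Γ →ᵇ ℂ := BoundedContinuousFunction.ofNormedAddCommGroup
    (fun ξ : Γ => ((bracket ξ.1 ^ N : ℝ) : ℂ) * -F ξ.1) (by fun_prop) C (fun ξ => by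
      rw [norm_mul, norm_neg, Complex.norm_real, Real.norm_of_nonneg (hb0 _), mul_comm]
      exact hdec' ξ.1 ξ.2)
  have hx : ∀ ξ : Γ, x ξ = ((bracket ξ.1 ^ N : ℝ) : ℂ) * -F ξ.1 := fun ξ => rfl
  obtain ⟨K, hK, hft⟩ := exists_bracket_pow_mul_eft_le d N
  -- `K` is the cost of passing from the `L¹` norms of derivatives in `farSeminorm` to the weighted
  -- sup norm of the transform.
  have hδ' : 0 < δ / (K + 1) := by positivity
  obtain ⟨f, hf1, hf2⟩ := exists_approx_of_dual (farTransform x₀ R M N Γ) (farSeminorm x₀ R S N) x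
    (fun ℓ hℓ => by
      obtain ⟨C', hℓ⟩ := hℓ
      refine norm_le_zero_iff.1 (le_of_forall_pos_le_add fun ε hε => ?_)
      rw [zero_add]
      -- The functional kills the weighted transforms of test functions, which come arbitrarily
      -- close to `x`; the decay of `F` of order `N + 1` is used for this density.
      obtain ⟨ψ, hψ, hψc, hψe⟩ := exists_eft_approx hF.neg (Γ := Γ) (N := N) (C := C)
        (by simpa using hdec) (ε := ε / (‖ℓ‖ + 1)) (by positivity)
      obtain ⟨B, hB, hψB⟩ := exists_bracket_pow_mul_eft_le_of_hasCompactSupport hψ hψc N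
      have hψi := continuous_eft (hψ.continuous.integrable_of_hasCompactSupport hψc)
      let b : Γ →ᵇ ℂ := BoundedContinuousFunction.ofNormedAddCommGroup
        (fun ξ : Γ => ((bracket ξ.1 ^ N : ℝ) : ℂ) * eft ψ ξ.1) (by fun_prop) B (fun ξ => by
          rw [norm_mul, Complex.norm_real, Real.norm_of_nonneg (hb0 _), mul_comm]
          exact hψB ξ.1)
      have h1 := dual_eft_eq_zero hθ hS hΓ ℓ hℓ hψ hψc b (fun ξ => rfl)
      have h2 : ‖x - b‖ ≤ ε / (‖ℓ‖ + 1) := by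
        rw [BoundedContinuousFunction.norm_le (by positivity)]
        intro ξ
        change ‖((bracket ξ.1 ^ N : ℝ) : ℂ) * -F ξ.1 - ((bracket ξ.1 ^ N : ℝ) : ℂ) * eft ψ ξ.1‖ ≤ _
        rw [← mul_sub, norm_mul, Complex.norm_real, Real.norm_of_nonneg (hb0 _), mul_comm]
        exact hψe ξ.1 ξ.2
      calc ‖ℓ x‖ = ‖ℓ (x - b)‖ := by rw [map_sub, h1, sub_zero]
        _ ≤ ‖ℓ‖ * (ε / (‖ℓ‖ + 1)) := (ℓ.le_opNorm _).trans (by gcongr)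
        _ ≤ ε := by
          rw [mul_div_assoc', div_le_iff₀ (by positivity)]
          nlinarith [norm_nonneg ℓ]) hδ'
  have hδK : δ / (K + 1) ≤ δ := div_le_self hδ.le (by linarith)
  refine ⟨f.1, f.2, fun ξ hξ => ?_, fun M' hM' => ?_⟩
  · have h1 := ((x - farTransform x₀ R M N Γ f).norm_coe_le_norm ⟨ξ, hξ⟩).trans hf1.le
    rw [BoundedContinuousFunction.sub_apply, hx, farTransform_apply, ← mul_sub, norm_mul,
      Complex.norm_real, Real.norm_of_nonneg (hb0 _), mul_comm, ← neg_add', norm_neg] at h1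
    exact h1.trans hδK
  · have h1 := (sum_integral_le_farSeminorm hM' N f).trans hf2.le
    refine ⟨fun ξ => ?_, ?_⟩
    · rw [fnSTFT_eq_eft]
      refine (hft _ (farTest.contDiff_mul f _) (fun n _ =>
        integrable_iteratedFDeriv_of_hasCompactSupport (farTest.contDiff_mul f _)
          (farTest.hasCompactSupport_mul f _) n) ξ).trans ?_
      calc _ ≤ K * (δ / (K + 1)) := by gcongr
        _ ≤ δ := by
          rw [mul_div_assoc', div_le_iff₀ (by positivity)]
          nlinarith
    · refine le_trans ?_ (h1.trans hδK)
      refine le_trans (le_of_eq ?_) (Finset.single_le_sum (f := fun n =>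
        ∫ x, ‖iteratedFDeriv ℝ n (fun x => f.1 x * gaussC (4 * (M' : ℝ))⁻¹ x₀ x) x‖)
        (fun n _ => integral_nonneg fun x => norm_nonneg _)
        (Finset.mem_range.2 (Nat.succ_pos N)))
      simp [gaussianWave_zero]

/-! ### Functions as elements of the dual of the Gelfand–Shilov space -/

theorem factorial_two_mul_le (m : ℕ) : (2 * m)! ≤ 4 ^ m * (m ! * m !) := by
  have h1 := Nat.choose_mul_factorial_mul_factorial (n := 2 * m) (k := m) (by omega)
  have h2 : (2 * m).choose m ≤ 2 ^ (2 * m) := Nat.choose_le_two_pow _ _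
  rw [show 2 * m - m = m by omega, mul_assoc] at h1
  rw [← h1]
  have : (4 : ℕ) ^ m = 2 ^ (2 * m) := by
    rw [pow_mul]
    norm_num
  rw [this]
  gcongr

/-- Summing the bounds on the even moments against the exponential series gives the Gaussian:
`√(2m)! ≤ 2^m m!`, and `c = 1/(4A²)` makes the series geometric with ratio `1/2`. -/
theorem GSBound.norm_le_exp {d : ℕ} {A K : ℝ} (hA : 0 < A) (hK : 0 ≤ K) {g : Rd d → ℂ}
    (hg : GSBound A K g) (x : Rd d) :
    ‖g x‖ ≤ 2 * K * Real.exp (-(4 * A ^ 2)⁻¹ * ‖x‖ ^ 2) := by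
  set c := (4 * A ^ 2)⁻¹ with hc
  have hc0 : 0 < c := by positivity
  have h1 : HasSum (fun m : ℕ => (c * ‖x‖ ^ 2) ^ m / (m ! : ℝ) * ‖g x‖)
      (Real.exp (c * ‖x‖ ^ 2) * ‖g x‖) := by
    have := NormedSpace.expSeries_div_hasSum_exp (𝔸 := ℝ) (c * ‖x‖ ^ 2)
    rw [← Real.exp_eq_exp_ℝ] at this
    exact this.mul_right _
  have h2 : HasSum (fun m : ℕ => K * (1 / 2 : ℝ) ^ m) (K * 2) := hasSum_geometric_two.mul_left K
  have h3 : ∀ m : ℕ, (c * ‖x‖ ^ 2) ^ m / (m ! : ℝ) * ‖g x‖ ≤ K * (1 / 2 : ℝ) ^ m := by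
    intro m
    have hb := hg (2 * m) 0 x
    rw [norm_iteratedFDeriv_zero] at hb
    simp only [add_zero, Nat.factorial_zero, Nat.cast_one, Real.sqrt_one, mul_one] at hb
    have hf : √((2 * m)! : ℝ) ≤ 2 ^ m * (m ! : ℝ) := by
      rw [Real.sqrt_le_left (by positivity)]
      have := factorial_two_mul_le m
      calc (((2 * m)! : ℕ) : ℝ) ≤ ((4 ^ m * (m ! * m !) : ℕ) : ℝ) := by exact_mod_cast this
        _ = _ := by
          push_cast
          rw [show (4 : ℝ) = 2 ^ 2 by norm_num, ← pow_mul]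
          ring
    have hm : (0 : ℝ) < m ! := by positivity
    calc (c * ‖x‖ ^ 2) ^ m / (m ! : ℝ) * ‖g x‖ = c ^ m / (m ! : ℝ) * (‖x‖ ^ (2 * m) * ‖g x‖) := by
          rw [mul_pow, ← pow_mul]; ring
      _ ≤ c ^ m / (m ! : ℝ) * (K * A ^ (2 * m) * (2 ^ m * (m ! : ℝ))) := by
          refine mul_le_mul_of_nonneg_left (hb.trans ?_) (by positivity)
          gcongr
      _ = K * (c * (A ^ 2) * 2) ^ m := by
          rw [mul_pow, mul_pow, pow_mul]
          field_simp
      _ = _ := by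
          congr 2
          rw [hc]
          field_simp
          norm_num
  have h4 := hasSum_le h3 h1 h2
  rw [neg_mul, Real.exp_neg, ← div_eq_mul_inv, le_div_iff₀ (Real.exp_pos _)]
  linarith

theorem GS.exists_norm_le_exp {d : ℕ} (g : GS d) :
    ∃ c C : ℝ, 0 < c ∧ 0 ≤ C ∧ ∀ x, ‖g.1 x‖ ≤ C * Real.exp (-c * ‖x‖ ^ 2) := by
  obtain ⟨_, A, K, hA, hK, hb⟩ := g.2
  exact ⟨(4 * A ^ 2)⁻¹, 2 * K, by positivity, by positivity, hb.norm_le_exp hA hK⟩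

/-- A continuous function as a distribution. -/
noncomputable def fnDistr {d : ℕ} (f : Rd d → ℂ) : Distr d :=
  (TestFunction.integralAgainstBilinCLM (ContinuousLinearMap.lsmul ℝ ℝ) volume f :
    RealTest d →L[ℝ] ℂ)

theorem fnDistr_apply {d : ℕ} {f : Rd d → ℂ} (hf : Continuous f) (ψ : RealTest d) :
    fnDistr f ψ = ∫ x, (ψ x : ℂ) * f x := by
  have h := TestFunction.integralAgainstBilinCLM_eq_integral
    (B := ContinuousLinearMap.lsmul ℝ ℝ) (μ := volume)
    (hf.locallyIntegrable.locallyIntegrableOn _) (f := ψ)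
  refine h.trans (integral_congr_ae (Eventually.of_forall fun x => ?_))
  simp

theorem fnDistr_pair {d : ℕ} {f : Rd d → ℂ} (hf : Continuous f) (ψ : CplxTest d) :
    (fnDistr f).pair ψ = ∫ x, ψ x * f x := by
  have hi : ∀ ℓ : ℂ →L[ℝ] ℝ, Integrable fun x => ((ℓ (ψ x) : ℝ) : ℂ) * f x := fun ℓ => by
    have hψ := ψ.continuous
    refine Continuous.integrable_of_hasCompactSupport (by fun_prop) ?_
    exact (ψ.hasCompactSupport.comp_left (g := fun z => ((ℓ z : ℝ) : ℂ)) (by simp)).mul_right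
  unfold Distr.pair
  rw [fnDistr_apply hf, fnDistr_apply hf, ← integral_const_mul]
  have e : ∀ (ℓ : ℂ →L[ℝ] ℝ) (x : Rd d),
      (TestFunction.postcompCLM (𝕜 := ℝ) ℓ ψ : RealTest d) x = ℓ (ψ x) := fun ℓ x => rfl
  simp only [e]
  rw [← integral_add (hi _) ((hi _).const_mul _)]
  refine integral_congr_ae (Eventually.of_forall fun x => ?_)
  simp only [Complex.reCLM_apply, Complex.imCLM_apply]
  conv_rhs => rw [← Complex.re_add_im (ψ x)]
  ring

section fnGS

variable {d : ℕ} {f : Rd d → ℂ}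

theorem integrable_mul_gs (hf : Continuous f)
    (hi : ∀ c : ℝ, 0 < c → Integrable fun x => ‖f x‖ * Real.exp (-c * ‖x‖ ^ 2)) (g : GS d) :
    Integrable fun x => f x * g.1 x := by
  obtain ⟨c, C, hc, hC, hb⟩ := GS.exists_norm_le_exp g
  refine ((hi c hc).const_mul C).mono' (hf.mul g.2.1.continuous).aestronglyMeasurable
    (Eventually.of_forall fun x => ?_)
  rw [norm_mul]
  calc ‖f x‖ * ‖g.1 x‖ ≤ ‖f x‖ * (C * Real.exp (-c * ‖x‖ ^ 2)) := by gcongr; exact hb x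
    _ = _ := by ring

/-- Integration against a function that is integrable against all Gaussians. -/
noncomputable def fnGS (f : Rd d → ℂ) (hf : Continuous f)
    (hi : ∀ c : ℝ, 0 < c → Integrable fun x => ‖f x‖ * Real.exp (-c * ‖x‖ ^ 2)) :
    GS d →ₗ[ℂ] ℂ where
  toFun g := ∫ x, f x * g.1 x
  map_add' g g' := by
    rw [← integral_add (integrable_mul_gs hf hi g) (integrable_mul_gs hf hi g')]
    simp [mul_add]
  map_smul' c g := by
    rw [RingHom.id_apply, smul_eq_mul, ← integral_const_mul]
    refine integral_congr_ae (Eventually.of_forall fun x => ?_)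
    simp
    ring

/-- Elements of a step are dominated by a fixed Gaussian times their norm, which yields continuity;
the truncations converge by dominated convergence. -/
theorem belongsToGSDual_fnDistr (hf : Continuous f)
    (hi : ∀ c : ℝ, 0 < c → Integrable fun x => ‖f x‖ * Real.exp (-c * ‖x‖ ^ 2)) :
    BelongsToGSDual (fnDistr f) (fnGS f hf hi) := by
  refine ⟨fun A hA => ?_, fun χ hχ g => ?_⟩
  · set c := (4 * A ^ 2)⁻¹ with hc
    have hc0 : 0 < c := by positivity
    refine ⟨2 * ∫ x, ‖f x‖ * Real.exp (-c * ‖x‖ ^ 2), fun g K hK hg => ?_⟩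
    have h1 : ‖∫ x, f x * g.1 x‖ ≤ ∫ x, 2 * K * (‖f x‖ * Real.exp (-c * ‖x‖ ^ 2)) := by
      refine norm_integral_le_of_norm_le ((hi c hc0).const_mul _) (Eventually.of_forall fun x => ?_)
      rw [norm_mul]
      calc ‖f x‖ * ‖g.1 x‖ ≤ ‖f x‖ * (2 * K * Real.exp (-c * ‖x‖ ^ 2)) := by
            gcongr
            exact hg.norm_le_exp hA hK x
        _ = _ := by ring
    rw [integral_const_mul] at h1
    refine h1.trans (le_of_eq ?_)
    ring
  · simp only [fnDistr_pair hf]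
    obtain ⟨B, hB⟩ := χ.hasCompactSupport.exists_bound_of_continuous χ.continuous
    have hgi := integrable_mul_gs hf hi g
    refine tendsto_integral_of_dominated_convergence (fun x => B * ‖f x * g.1 x‖)
      (fun k => ?_) (hgi.norm.const_mul B) (fun k => Eventually.of_forall fun x => ?_)
      (Eventually.of_forall fun x => ?_)
    · exact ((truncate χ g k).continuous.mul hf).aestronglyMeasurable
    · rw [truncate_apply, mul_assoc, norm_mul, Complex.norm_real, mul_comm (g.1 x)]
      gcongr
      exact hB _
    · refine Tendsto.congr' (f₁ := fun _ => f x * g.1 x) ?_ tendsto_const_nhds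
      have h1 : Tendsto (fun k : ℕ => ((k : ℝ) + 1)⁻¹ • x) atTop (𝓝 (0 : Rd d)) := by
        have h2 := (tendsto_one_div_add_atTop_nhds_zero_nat (𝕜 := ℝ)).smul_const x
        simpa using h2
      filter_upwards [h1.eventually hχ] with k hk
      rw [truncate_apply, hk]
      simp [mul_comm]

/-- Since `|x - x₀|² ≤ 2|x|² + 2|x₀|²`, the window of width `M` dominates a multiple of `e^{-c|x|²}`
as soon as `1/(2M) ≤ c`. -/
theorem integrable_mul_exp_of_forall_gaussianWave (hf : Continuous f) {x₀ : Rd d}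
    (hi : ∀ M : ℕ+, Integrable fun x => f x * gaussianWave x₀ M 0 x) (c : ℝ) (hc : 0 < c) :
    Integrable fun x => ‖f x‖ * Real.exp (-c * ‖x‖ ^ 2) := by
  obtain ⟨n, hn⟩ := exists_nat_gt (2 * c)⁻¹
  let M : ℕ+ := ⟨n + 1, Nat.succ_pos n⟩
  have hM : (2 * (M : ℝ))⁻¹ ≤ c := by
    have h1 : (2 * c)⁻¹ ≤ (M : ℝ) := by
      have : ((M : ℕ) : ℝ) = n + 1 := by simp [M]
      rw [this]; linarith
    have hM0 : (0 : ℝ) < M := by exact_mod_cast M.pos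
    rw [inv_le_comm₀ (by positivity) (by positivity)]
    rw [inv_le_iff_one_le_mul₀ (by positivity)] at h1 ⊢
    linarith
  have hM0 : (0 : ℝ) < M := by exact_mod_cast M.pos
  refine ((hi M).norm.const_mul (Real.exp ((2 * (M : ℝ))⁻¹ * ‖x₀‖ ^ 2))).mono'
    (by fun_prop) (Eventually.of_forall fun x => ?_)
  rw [Real.norm_of_nonneg (by positivity), norm_mul, norm_gaussianWave, mul_left_comm,
    ← Real.exp_add]
  gcongr
  have h1 : ‖x - x₀‖ ^ 2 ≤ 2 * ‖x‖ ^ 2 + 2 * ‖x₀‖ ^ 2 := by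
    have : ‖x - x₀‖ ^ 2 ≤ (‖x‖ + ‖x₀‖) ^ 2 := by gcongr; exact norm_sub_le _ _
    nlinarith [sq_nonneg (‖x‖ - ‖x₀‖)]
  have h2 : ‖x - x₀‖ ^ 2 / (4 * (M : ℝ)) ≤ (2 * (M : ℝ))⁻¹ * ‖x‖ ^ 2 + (2 * (M : ℝ))⁻¹ * ‖x₀‖ ^ 2 := by
    rw [div_le_iff₀ (by positivity)]
    field_simp
    linarith
  have h3 : (2 * (M : ℝ))⁻¹ * ‖x‖ ^ 2 ≤ c * ‖x‖ ^ 2 := by gcongr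
  linarith

end fnGS

/-! ### From rapid decay to the Gevrey estimate by changing the extension -/

theorem integrable_of_enorm_le_tsum {α : Type*} [MeasurableSpace α] {μ : Measure α}
    {F : ℕ → α → ℂ} (hF : ∀ i, Integrable (F i) μ) (hs : Summable fun i => ∫ x, ‖F i x‖ ∂μ)
    {f : α → ℂ} (hf : AEStronglyMeasurable f μ) (hle : ∀ x, ‖f x‖ₑ ≤ ∑' i, ‖F i x‖ₑ) :
    Integrable f μ := by
  refine ⟨hf, ?_⟩
  refine lt_of_le_of_lt (lintegral_mono hle) ?_
  rw [lintegral_tsum fun i => (hF i).aestronglyMeasurable.enorm]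
  have e : ∀ i, ∫⁻ x, ‖F i x‖ₑ ∂μ = ENNReal.ofReal (∫ x, ‖F i x‖ ∂μ) := fun i =>
    (ofReal_integral_norm_eq_lintegral_enorm (hF i)).symm
  simp only [e]
  exact hs.tsum_ofReal_ne_top.lt_top

theorem one_le_natCast_rpow {s : ℝ} (hs : 0 ≤ s) (n : ℕ) : 1 ≤ (n : ℝ) ^ (s * n) := by
  rcases Nat.eq_zero_or_pos n with rfl | hn
  · simp
  · exact Real.one_le_rpow (by exact_mod_cast hn) (by positivity)

theorem farTest.integrable_mul_gaussianWave {d : ℕ} {x₀ : Rd d} {R : ℝ} {f : Rd d → ℂ}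
    (hf : f ∈ farTest x₀ R) (M : ℕ+) (ξ : Rd d) :
    Integrable fun x => f x * gaussianWave x₀ M ξ x :=
  (hf.1.continuous.mul (contDiff_gaussianWave x₀ M ξ).continuous).integrable_of_hasCompactSupport
    hf.2.1.mul_right

/-- A sequence of corrections supported farther and farther away which makes the transforms of
width `j + 1` small of order `j + 1`. -/
theorem exists_correction_sequence {d : ℕ} {L : GS d →ₗ[ℂ] ℂ} (hL : GSContinuous L)
    {x₀ ξ₀ : Rd d} (hξ₀ : ξ₀ ≠ 0) (hr : RapidAt L x₀ ξ₀) :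
    ∃ Γ : Set (Rd d), IsConeNhd Γ ξ₀ ∧ ∃ f : ℕ → Rd d → ℂ,
      (∀ j : ℕ, f j ∈ farTest x₀ (j + 1)) ∧
      (∀ j : ℕ, ∀ ξ ∈ Γ, ‖gaussianSTFT L x₀ j.succPNat ξ +
        ∑ i ∈ Finset.range (j + 1), fnSTFT (f i) x₀ j.succPNat ξ‖ * bracket ξ ^ (j + 1) ≤
          (1 / 2) ^ (j + 1)) ∧
      ∀ j : ℕ, ∀ M : ℕ+, M < j.succPNat →
        (∀ ξ, ‖fnSTFT (f j) x₀ M ξ‖ * bracket ξ ^ (j + 1) ≤ (1 / 2) ^ (j + 1)) ∧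
        ∫ x, ‖f j x‖ * ‖gaussianWave x₀ M 0 x‖ ≤ (1 / 2) ^ (j + 1) := by
  obtain ⟨Γ, hΓ, hest⟩ := hr
  -- The cone is cut down to a half-space so that the corrections can be slid in the direction `θ =
  -- -ξ₀`, for which `⟨θ,ξ⟩ ≤ 0` on the cone.
  have hhalf : IsConeNhd {ξ : Rd d | 0 < inner ℝ ξ₀ ξ} ξ₀ := by
    refine ⟨isOpen_lt continuous_const (by fun_prop), fun ξ hξ t ht => ?_, ?_⟩
    · change 0 < inner ℝ ξ₀ (t • ξ)
      rw [inner_smul_right]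
      exact mul_pos ht hξ
    · exact real_inner_self_pos.2 hξ₀
  refine ⟨Γ ∩ {ξ | 0 < inner ℝ ξ₀ ξ}, hΓ.inter hhalf, ?_⟩
  -- `Φ` stands for the sum of the earlier corrections. The radius `-1` imposes no support
  -- condition, so `farTest x₀ (-1)` is the space of all test functions.
  have hstep : ∀ (j : ℕ) (Φ : farTest x₀ (-1)), ∃ f ∈ farTest x₀ ((j : ℝ) + 1),
      (∀ ξ ∈ Γ ∩ {ξ | 0 < inner ℝ ξ₀ ξ}, ‖(gaussianSTFT L x₀ j.succPNat ξ +
        fnSTFT Φ.1 x₀ j.succPNat ξ) + fnSTFT f x₀ j.succPNat ξ‖ * bracket ξ ^ (j + 1) ≤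
          (1 / 2) ^ (j + 1)) ∧ ∀ M ∈ Finset.Ico 1 j.succPNat,
        (∀ ξ, ‖fnSTFT f x₀ M ξ‖ * bracket ξ ^ (j + 1) ≤ (1 / 2) ^ (j + 1)) ∧
        ∫ x, ‖f x‖ * ‖gaussianWave x₀ M 0 x‖ ≤ (1 / 2) ^ (j + 1) := by
    intro j Φ
    -- The order is `j + 2` because `exists_correction` loses one power. The constants may depend on
    -- `j` without restriction, since the correction absorbs them.
    obtain ⟨C, hC⟩ := hest j.succPNat (j + 1 + 1)
    obtain ⟨C', hC'0, hC'⟩ := exists_bracket_pow_mul_eft_le_of_hasCompactSupport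
      (farTest.contDiff_mul Φ (4 * (j.succPNat : ℝ))⁻¹) (farTest.hasCompactSupport_mul Φ _)
      (j + 1 + 1)
    refine exists_correction (θ := -ξ₀) (neg_ne_zero.2 hξ₀)
      (F := fun ξ => gaussianSTFT L x₀ j.succPNat ξ + fnSTFT Φ.1 x₀ j.succPNat ξ) ?_
      (fun ξ hξ => ?_) (C := C + C') (fun ξ hξ => ?_) j.succPNat _
      (fun M hM => (Finset.mem_Ico.1 hM).2) _ (by positivity)
    · refine (continuous_gaussianSTFT hL x₀ _).add ?_
      refine (continuous_eft (farTest.integrable_mul Φ (4 * (j.succPNat : ℝ))⁻¹)).congr fun ξ => ?_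
      exact (fnSTFT_eq_eft _ _ _ _).symm
    · rw [inner_neg_left]
      have : 0 < inner ℝ ξ₀ ξ := hξ.2
      linarith
    · have h1 := hC ξ hξ.1
      have h2 := hC' ξ
      rw [← fnSTFT_eq_eft] at h2
      have hb : 0 < bracket ξ ^ (j + 1 + 1) := pow_pos (bracket_pos ξ) _
      calc _ ≤ (‖gaussianSTFT L x₀ j.succPNat ξ‖ + ‖fnSTFT Φ.1 x₀ j.succPNat ξ‖) *
            bracket ξ ^ (j + 1 + 1) := by gcongr; exact norm_add_le _ _
        _ ≤ _ := by rw [add_mul]; exact add_le_add h1 h2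
  choose step hmem hstep1 hstep2 using hstep
  have hmono : ∀ (j : ℕ) (f : Rd d → ℂ), f ∈ farTest x₀ ((j : ℝ) + 1) → f ∈ farTest x₀ (-1) :=
    fun j f hf => ⟨hf.1, hf.2.1, fun x hx => hf.2.2 x (hx.trans (by
      have : (0 : ℝ) ≤ j := Nat.cast_nonneg j
      linarith))⟩
  let Φ : ℕ → farTest x₀ (-1) := fun n => Nat.rec 0
    (fun j Φj => Φj + ⟨step j Φj, hmono j _ (hmem j Φj)⟩) n
  have hΦ : ∀ j, Φ (j + 1) = Φ j + ⟨step j (Φ j), hmono j _ (hmem j (Φ j))⟩ := fun j => rfl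
  have hsum : ∀ (M : ℕ+) (ξ : Rd d) (j : ℕ), fnSTFT (Φ j).1 x₀ M ξ =
      ∑ i ∈ Finset.range j, fnSTFT (step i (Φ i)) x₀ M ξ := by
    intro M ξ j
    induction j with
    | zero =>
      have : (Φ 0).1 = 0 := rfl
      rw [this]
      simp [fnSTFT]
    | succ j ih =>
      rw [Finset.sum_range_succ, ← ih]
      unfold fnSTFT
      rw [← integral_add (farTest.integrable_mul_gaussianWave (Φ j).2 M ξ)
        (farTest.integrable_mul_gaussianWave (hmem j (Φ j)) M ξ), hΦ]
      refine integral_congr_ae (Eventually.of_forall fun x => ?_)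
      exact add_mul _ _ _
  refine ⟨fun j => step j (Φ j), fun j => hmem j (Φ j), fun j ξ hξ => ?_, fun j M hM => ?_⟩
  · have := hstep1 j (Φ j) ξ hξ
    rwa [hsum, add_assoc, ← Finset.sum_range_succ] at this
  · exact hstep2 j (Φ j) M (Finset.mem_Ico.2 ⟨one_le, hM⟩)

/-- If some suitable extension has rapidly decaying Gaussian transforms in a cone, then some other
one satisfies the Gevrey estimate. -/
theorem IsSuitableExtension.exists_gevreyEstimate {d : ℕ} {u T : Distr d} {L : GS d →ₗ[ℂ] ℂ}
    {x₀ ξ₀ : Rd d} (hξ₀ : ξ₀ ≠ 0) (h : IsSuitableExtension u x₀ T L) (hr : RapidAt L x₀ ξ₀)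
    {s : ℝ} (hs : 0 ≤ s) :
    ∃ (T' : Distr d) (L' : GS d →ₗ[ℂ] ℂ), IsSuitableExtension u x₀ T' L' ∧
      GevreyEstimate s L' x₀ ξ₀ := by
  obtain ⟨hTL, r, hr0, hloc⟩ := h
  obtain ⟨Γ, hΓ, f, hfmem, hf1, hf2⟩ := exists_correction_sequence hTL.1 hξ₀ hr
  -- The sum is locally finite: on the ball of radius `n + 1` around `x₀` only the first `n`
  -- functions are nonzero.
  set w : Rd d → ℂ := fun x => ∑' j, f j x with hw
  have hfz : ∀ (n : ℕ) (x : Rd d), ‖x - x₀‖ ≤ n + 1 → ∀ j, n ≤ j → f j x = 0 := by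
    intro n x hx j hj
    have : (n : ℝ) ≤ j := by exact_mod_cast hj
    exact (hfmem j).2.2 x (by linarith)
  have hwn : ∀ (n : ℕ) (x : Rd d), ‖x - x₀‖ ≤ n + 1 → w x = ∑ j ∈ Finset.range n, f j x := by
    intro n x hx
    refine tsum_eq_sum fun j hj => hfz n x hx j ?_
    simpa using hj
  have hwc : Continuous w := by
    rw [continuous_iff_continuousAt]
    intro x
    obtain ⟨n, hn⟩ := exists_nat_gt ‖x - x₀‖
    have h1 : w =ᶠ[𝓝 x] fun y => ∑ j ∈ Finset.range n, f j y := by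
      have : ∀ᶠ y : Rd d in 𝓝 x, ‖y - x₀‖ < n :=
        (isOpen_lt (by fun_prop) continuous_const).mem_nhds hn
      filter_upwards [this] with y hy
      exact hwn n y (by linarith)
    refine ContinuousAt.congr ?_ h1.symm
    have : Continuous fun y => ∑ j ∈ Finset.range n, f j y :=
      continuous_finsetSum _ fun j _ => (hfmem j).1.continuous
    exact this.continuousAt
  have hFi : ∀ (M : ℕ+) (ξ : Rd d) (j : ℕ), Integrable fun x => f j x * gaussianWave x₀ M ξ x :=
    fun M ξ j => farTest.integrable_mul_gaussianWave (hfmem j) M ξ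
  have hnorm : ∀ (M : ℕ+) (ξ : Rd d) (j : ℕ), ∫ x, ‖f j x * gaussianWave x₀ M ξ x‖ =
      ∫ x, ‖f j x‖ * ‖gaussianWave x₀ M 0 x‖ := fun M ξ j => by
    simp only [norm_mul, norm_gaussianWave]
  have hgeo : Summable fun j : ℕ => ((1 : ℝ) / 2) ^ (j + 1) :=
    (summable_nat_add_iff 1).2 summable_geometric_two
  -- Smallness at width `M` is known from the index `M` on; the finitely many earlier functions have
  -- compact support.
  have hsm : ∀ (M : ℕ+) (ξ : Rd d), Summable fun j => ∫ x, ‖f j x * gaussianWave x₀ M ξ x‖ := by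
    intro M ξ
    rw [← summable_nat_add_iff (M : ℕ)]
    refine Summable.of_nonneg_of_le (fun j => integral_nonneg fun x => norm_nonneg _)
      (fun j => ?_) ((summable_nat_add_iff (M : ℕ)).2 hgeo)
    rw [hnorm]
    refine (hf2 (j + M) M ?_).2
    rw [← PNat.coe_lt_coe, Nat.succPNat_coe]
    omega
  have hwsum : ∀ (M : ℕ+) (ξ x : Rd d),
      w x * gaussianWave x₀ M ξ x = ∑' j, f j x * gaussianWave x₀ M ξ x :=
    fun M ξ x => (tsum_mul_right).symm
  have hwi : ∀ M : ℕ+, Integrable fun x => w x * gaussianWave x₀ M 0 x := by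
    intro M
    refine integrable_of_enorm_le_tsum (hFi M 0) (hsm M 0)
      (hwc.mul (contDiff_gaussianWave x₀ M 0).continuous).aestronglyMeasurable fun x => ?_
    rw [hwsum]
    exact enorm_tsum_le_tsum_enorm
  have hwi' := integrable_mul_exp_of_forall_gaussianWave hwc hwi
  -- All corrections vanish on the unit ball around `x₀`, so `T + w` coincides with `u` on the ball
  -- of radius `min r 1`.
  refine ⟨T + fnDistr w, L + fnGS w hwc hwi',
    ⟨hTL.add (belongsToGSDual_fnDistr hwc hwi'), min r 1, by positivity, fun ψ hψ => ?_⟩, ?_⟩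
  · have h1 : fnDistr w ψ = 0 := by
      rw [fnDistr_apply hwc]
      refine integral_eq_zero_of_ae (Eventually.of_forall fun x => ?_)
      by_cases hx : x ∈ tsupport ψ
      · have h2 := Metric.mem_ball.1 (hψ hx)
        rw [dist_eq_norm] at h2
        have h3 := hwn 0 x (by
          have := h2.trans_le (min_le_right r 1)
          simp only [Nat.cast_zero]
          linarith)
        simp [h3]
      · simp [image_eq_zero_of_notMem_tsupport hx]
    rw [add_apply, h1, add_zero]
    exact hloc ψ (hψ.trans (Metric.ball_subset_ball (min_le_left _ _)))
  -- With `v = 1` and `N = k + 1`, the transform is at most `2 / ⟨ξ⟩^(k+1)`: one unit comes from `L`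
  -- with the corrections up to index `k`, one from the later ones. As `n ≤ k + 1` and `n^{sn} ≥ 1`,
  -- the constant `C = 2` works.
  · refine ⟨Γ, hΓ.1, hΓ.2.1, hΓ.2.2, 1, 1, 2, two_pos, fun ξ hξ N _ n hn => ?_⟩
    rw [one_mul]
    obtain ⟨k, rfl⟩ : ∃ k : ℕ, N = k.succPNat := ⟨N.natPred, (PNat.succPNat_natPred N).symm⟩
    rw [Nat.succPNat_coe] at hn
    have e1 : gaussianSTFT (L + fnGS w hwc hwi') x₀ k.succPNat ξ =
        gaussianSTFT L x₀ k.succPNat ξ + fnSTFT w x₀ k.succPNat ξ := rfl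
    have hS := hasSum_integral_of_summable_integral_norm (hFi k.succPNat ξ) (hsm k.succPNat ξ)
    have e2 : fnSTFT w x₀ k.succPNat ξ = ∑' j, fnSTFT (f j) x₀ k.succPNat ξ := by
      unfold fnSTFT
      rw [hS.tsum_eq]
      simp only [hwsum]
    have hSs : Summable fun j => fnSTFT (f j) x₀ k.succPNat ξ := hS.summable
    have hb := bracket_pos ξ
    have hb1 := one_le_bracket ξ
    have hB : 0 < bracket ξ ^ (k + 1) := by positivity
    -- For these corrections `k + 1` is a narrower width, at which they are small to an order above
    -- `k + 1`; the geometric factors sum to `1`.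
    have htail : ‖∑' j, fnSTFT (f (j + (k + 1))) x₀ k.succPNat ξ‖ ≤ 1 / bracket ξ ^ (k + 1) := by
      have hg2 : HasSum (fun j : ℕ => ((1 : ℝ) / 2) ^ (j + 1) / bracket ξ ^ (k + 1))
          (1 / bracket ξ ^ (k + 1)) := by
        have h1 : HasSum (fun j : ℕ => ((1 : ℝ) / 2) ^ (j + 1)) 1 := by
          have h2 := hasSum_geometric_two.mul_left (1 / 2 : ℝ)
          simp only [← pow_succ'] at h2
          norm_num at h2 ⊢
          exact h2
        exact h1.div_const _
      refine tsum_of_norm_bounded hg2 fun j => ?_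
      have h1 := (hf2 (j + (k + 1)) k.succPNat (by
        rw [← PNat.coe_lt_coe, Nat.succPNat_coe, Nat.succPNat_coe]
        omega)).1 ξ
      rw [le_div_iff₀ hB]
      calc _ ≤ ‖fnSTFT (f (j + (k + 1))) x₀ k.succPNat ξ‖ * bracket ξ ^ (j + (k + 1) + 1) := by
            gcongr
            omega
        _ ≤ _ := h1
        _ ≤ _ := pow_le_pow_of_le_one (by norm_num) (by norm_num) (by omega)
    have hhead : ‖gaussianSTFT L x₀ k.succPNat ξ +
        ∑ i ∈ Finset.range (k + 1), fnSTFT (f i) x₀ k.succPNat ξ‖ ≤ 1 / bracket ξ ^ (k + 1) := by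
      rw [le_div_iff₀ hB]
      exact (hf1 k ξ hξ).trans (pow_le_one₀ (by norm_num) (by norm_num))
    rw [e1, e2, ← hSs.sum_add_tsum_nat_add (k + 1), ← add_assoc]
    calc _ ≤ 1 / bracket ξ ^ (k + 1) + 1 / bracket ξ ^ (k + 1) :=
          (norm_add_le _ _).trans (add_le_add hhead htail)
      _ = 2 / bracket ξ ^ (k + 1) := by ring
      _ ≤ 2 / bracket ξ ^ n := by gcongr
      _ ≤ _ := by
          gcongr
          calc (2 : ℝ) = 2 * 1 := by ring
            _ ≤ 2 ^ (n + 1) * (n : ℝ) ^ (s * n) := by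
              gcongr
              · exact le_self_pow₀ (by norm_num) (by omega)
              · exact one_le_natCast_rpow hs n

/-! ### The first inclusion -/

theorem WFs_PDu_subset {d : ℕ} (P : MvPolynomial (Fin d) ℂ) (u : Distr d) {s : ℝ} (hs : 0 ≤ s) :
    WFs s (PDu P u) ⊆ WFs s u := by
  rintro ⟨x₀, ξ₀⟩ ⟨hξ, hno⟩
  refine ⟨hξ, fun ⟨T, L, hTL, hest⟩ => hno ?_⟩
  -- The extension `P(D)T` of `P(D)u` is only known to have rapidly decaying transforms; the
  -- extension that finally satisfies the estimate is `P(D)T` plus a function vanishing near `x₀`.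
  obtain ⟨h1, h2⟩ := hTL.PDu P (hest.rapidAt hTL.1.1)
  exact h1.exists_gevreyEstimate hξ h2 hs

/-! ### Functionals given by a polynomially bounded Fourier transform -/

theorem one_add_norm_le_bracket {d : ℕ} (ξ : Rd d) : 1 + ‖ξ‖ ≤ 2 * bracket ξ := by
  linarith [one_le_bracket ξ, norm_le_bracket ξ]

theorem GS.exists_norm_iteratedFDeriv_le {d : ℕ} (g : GS d) (N : ℕ) : ∃ B : ℝ, 0 ≤ B ∧
    ∀ n ≤ N, ∀ x, ‖iteratedFDeriv ℝ n g.1 x‖ ≤ B * ((1 + ‖x‖) ^ (d + 1))⁻¹ := by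
  obtain ⟨-, A, K, hA, hK, hb⟩ := g.2
  let b : ℕ → ℝ := fun n => 2 ^ d * (K * A ^ (0 + n) * (√(0 ! : ℝ) * √(n ! : ℝ)) +
    K * A ^ (d + 1 + n) * (√((d + 1)! : ℝ) * √(n ! : ℝ)))
  have hb0 : ∀ n, 0 ≤ b n := fun n => by positivity
  refine ⟨∑ n ∈ Finset.range (N + 1), b n, Finset.sum_nonneg fun n _ => hb0 n,
    fun n hn x => ?_⟩
  rw [← div_eq_mul_inv, le_div_iff₀ (by positivity)]
  have h1 : (1 + ‖x‖) ^ (d + 1) ≤ 2 ^ d * (1 ^ (d + 1) + ‖x‖ ^ (d + 1)) :=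
    add_pow_le zero_le_one (norm_nonneg x) (d + 1)
  have h2 := hb 0 n x
  have h3 := hb (d + 1) n x
  calc ‖iteratedFDeriv ℝ n g.1 x‖ * (1 + ‖x‖) ^ (d + 1)
      ≤ ‖iteratedFDeriv ℝ n g.1 x‖ * (2 ^ d * (1 ^ (d + 1) + ‖x‖ ^ (d + 1))) := by gcongr
    _ = 2 ^ d * (‖x‖ ^ 0 * ‖iteratedFDeriv ℝ n g.1 x‖ +
        ‖x‖ ^ (d + 1) * ‖iteratedFDeriv ℝ n g.1 x‖) := by ring
    _ ≤ b n := by simp only [b]; gcongr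
    _ ≤ _ := Finset.single_le_sum (f := b) (fun n _ => hb0 n) (Finset.mem_range_succ_iff.2 hn)

theorem GS.integrable {d : ℕ} (g : GS d) : Integrable g.1 := by
  obtain ⟨B, -, h⟩ := GS.exists_norm_iteratedFDeriv_le g 0
  refine ((integrable_inv_one_add_norm_pow d).const_mul B).mono'
    g.2.1.continuous.aestronglyMeasurable (Eventually.of_forall fun x => ?_)
  simpa using h 0 le_rfl x

theorem GS.exists_bracket_pow_mul_eft_le {d : ℕ} (g : GS d) (N : ℕ) :
    ∃ C, ∀ ξ, ‖eft g.1 ξ‖ * bracket ξ ^ N ≤ C := by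
  obtain ⟨C, -, h⟩ := exists_bracket_pow_mul_eft_le_of_decay d N
  obtain ⟨B, -, hB⟩ := GS.exists_norm_iteratedFDeriv_le g N
  exact ⟨C * B, h g.1 B g.2.1 hB⟩

theorem norm_mul_eft_le {d : ℕ} {U : Rd d → ℂ} {C : ℝ} {l : ℕ} (hC : 0 ≤ C)
    (hU : ∀ η, ‖U η‖ ≤ C * bracket η ^ l) {f : Rd d → ℂ} {C' : ℝ}
    (hf : ∀ ξ, ‖eft f ξ‖ * bracket ξ ^ (l + (d + 1)) ≤ C') (η : Rd d) :
    ‖U η * eft f (-η)‖ ≤ C * C' * 2 ^ (d + 1) * ((1 + ‖η‖) ^ (d + 1))⁻¹ := by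
  have h1 := hf (-η)
  rw [bracket_neg] at h1
  have hb := bracket_pos η
  rw [← div_eq_mul_inv, le_div_iff₀ (by positivity), norm_mul]
  calc ‖U η‖ * ‖eft f (-η)‖ * (1 + ‖η‖) ^ (d + 1)
      ≤ C * bracket η ^ l * ‖eft f (-η)‖ * (2 * bracket η) ^ (d + 1) := by
        gcongr
        · exact hU η
        · exact one_add_norm_le_bracket η
    _ = C * 2 ^ (d + 1) * (‖eft f (-η)‖ * bracket η ^ (l + (d + 1))) := by
        rw [mul_pow, pow_add]; ring
    _ ≤ C * 2 ^ (d + 1) * C' := by gcongr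
    _ = _ := by ring

theorem aestronglyMeasurable_mul_eft {d : ℕ} {U : Rd d → ℂ} (hm : Measurable U) {f : Rd d → ℂ}
    (hf : Integrable f) : AEStronglyMeasurable (fun η => U η * eft f (-η)) volume :=
  hm.aestronglyMeasurable.mul
    ((continuous_eft hf).comp continuous_neg).aestronglyMeasurable

theorem integrable_mul_eft {d : ℕ} {U : Rd d → ℂ} (hm : Measurable U) {C : ℝ} {l : ℕ} (hC : 0 ≤ C)
    (hU : ∀ η, ‖U η‖ ≤ C * bracket η ^ l) {f : Rd d → ℂ} (hf : Integrable f) {C' : ℝ}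
    (hf' : ∀ ξ, ‖eft f ξ‖ * bracket ξ ^ (l + (d + 1)) ≤ C') :
    Integrable fun η => U η * eft f (-η) :=
  ((integrable_inv_one_add_norm_pow d).const_mul _).mono' (aestronglyMeasurable_mul_eft hm hf)
    (Eventually.of_forall (norm_mul_eft_le hC hU hf'))

/-- `L` acts by integration of the Fourier transform against a polynomially bounded function. -/
def FourierRep {d : ℕ} (L : GS d →ₗ[ℂ] ℂ) (U : Rd d → ℂ) : Prop :=
  Measurable U ∧ (∃ (C : ℝ) (l : ℕ), 0 ≤ C ∧ ∀ η, ‖U η‖ ≤ C * bracket η ^ l) ∧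
    ∀ g : GS d, L g = ∫ η, U η * eft g.1 (-η)

theorem FourierRep.integrable {d : ℕ} {L : GS d →ₗ[ℂ] ℂ} {U : Rd d → ℂ} (h : FourierRep L U)
    (g : GS d) : Integrable fun η => U η * eft g.1 (-η) := by
  obtain ⟨hm, ⟨C, l, hC, hU⟩, -⟩ := h
  obtain ⟨C', hC'⟩ := GS.exists_bracket_pow_mul_eft_le g (l + (d + 1))
  exact integrable_mul_eft hm hC hU (GS.integrable g) hC'

theorem FourierRep.zero {d : ℕ} : FourierRep (0 : GS d →ₗ[ℂ] ℂ) 0 :=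
  ⟨measurable_const, ⟨0, 0, le_rfl, fun η => by simp⟩, fun g => by simp⟩

theorem FourierRep.add {d : ℕ} {L L' : GS d →ₗ[ℂ] ℂ} {U U' : Rd d → ℂ} (h : FourierRep L U)
    (h' : FourierRep L' U') : FourierRep (L + L') (U + U') := by
  obtain ⟨C, l, hC, hU⟩ := h.2.1
  obtain ⟨C', l', hC', hU'⟩ := h'.2.1
  refine ⟨h.1.add h'.1, ⟨C + C', l + l', by positivity, fun η => ?_⟩, fun g => ?_⟩
  · have hb := one_le_bracket η
    calc ‖(U + U') η‖ ≤ ‖U η‖ + ‖U' η‖ := norm_add_le _ _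
      _ ≤ C * bracket η ^ l + C' * bracket η ^ l' := add_le_add (hU η) (hU' η)
      _ ≤ C * bracket η ^ (l + l') + C' * bracket η ^ (l + l') := by gcongr <;> omega
      _ = _ := by ring
  · rw [LinearMap.add_apply, h.2.2, h'.2.2, ← integral_add (h.integrable g) (h'.integrable g)]
    simp [add_mul]

theorem FourierRep.smul {d : ℕ} {L : GS d →ₗ[ℂ] ℂ} {U : Rd d → ℂ} (h : FourierRep L U) (c : ℂ) :
    FourierRep (c • L) (c • U) := by
  obtain ⟨C, l, hC, hU⟩ := h.2.1
  refine ⟨h.1.const_smul c, ⟨‖c‖ * C, l, by positivity, fun η => ?_⟩, fun g => ?_⟩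
  · rw [Pi.smul_apply, norm_smul, mul_assoc]
    gcongr
    exact hU η
  · rw [LinearMap.smul_apply, h.2.2, smul_eq_mul, ← integral_const_mul]
    simp [mul_assoc]

theorem eft_partial {d : ℕ} (g : GS d) (j : Fin d) (ζ : Rd d) :
    eft (GS.partial j g).1 ζ = Complex.I * (ζ j : ℂ) * eft g.1 ζ := by
  have hd : fderiv ℝ (character ζ) = fun x => character ζ x • ((-Complex.I) • innerC ζ) := by
    funext x
    rw [fderiv_character]
    simp
  have h1 : ∀ x, fderiv ℝ (character ζ) x (EuclideanSpace.single j 1) =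
      character ζ x * (-Complex.I * (ζ j : ℂ)) := fun x => by
    rw [hd]
    simp [innerC, EuclideanSpace.inner_single_right]
  have h2 := integral_mul_fderiv_eq_neg_fderiv_mul_of_integrable (𝕜 := ℂ) (μ := volume)
    (f := g.1) (g := character ζ) (v := EuclideanSpace.single j (1 : ℝ))
    (integrable_mul_character (GS.integrable (GS.partial j g)) ζ)
    (by
      simp only [h1]
      have := (integrable_mul_character (GS.integrable g) ζ).mul_const (-Complex.I * (ζ j : ℂ))
      exact this.congr (Eventually.of_forall fun x => by simp only; ring))
    (integrable_mul_character (GS.integrable g) ζ)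
    (fun x _ => g.2.1.differentiable (by simp) x)
    (fun x _ => (contDiff_character ζ).differentiable (by simp) x)
  have h3 : eft (GS.partial j g).1 ζ =
      ∫ x, fderiv ℝ g.1 x (EuclideanSpace.single j 1) * character ζ x := rfl
  rw [h3, ← neg_eq_iff_eq_neg.2 h2, eft, ← integral_const_mul, ← integral_neg]
  refine integral_congr_ae (Eventually.of_forall fun x => ?_)
  simp only [h1]
  ring

/-- Multiplication by the `j`-th coordinate. -/
noncomputable def coordMul {d : ℕ} (j : Fin d) : Module.End ℂ (Rd d → ℂ) where
  toFun U η := (η j : ℂ) * U η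
  map_add' U V := by ext η; simp [mul_add]
  map_smul' c U := by ext η; simp; ring

theorem FourierRep.gsD {d : ℕ} {L : GS d →ₗ[ℂ] ℂ} {U : Rd d → ℂ} (h : FourierRep L U) (j : Fin d) :
    FourierRep (gsD j L) (coordMul j U) := by
  obtain ⟨C, l, hC, hU⟩ := h.2.1
  refine ⟨(continuous_coord j).measurable.mul h.1, ⟨C, l + 1, hC, fun η => ?_⟩, fun g => ?_⟩
  · have e : coordMul j U η = (η j : ℂ) * U η := rfl
    rw [e, norm_mul]
    calc _ ≤ bracket η * (C * bracket η ^ l) :=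
          mul_le_mul ((norm_coord_le η j).trans (norm_le_bracket η)) (hU η) (norm_nonneg _)
            (bracket_pos η).le
      _ = _ := by ring
  · have e : _root_.gsD j L g = Complex.I * L (GS.partial j g) := by simp [_root_.gsD]
    rw [e, h.2.2, ← integral_const_mul]
    refine integral_congr_ae (Eventually.of_forall fun η => ?_)
    simp only [eft_partial, coordMul, LinearMap.coe_mk, AddHom.coe_mk, PiLp.neg_apply]
    push_cast
    linear_combination (-(U η * (η j : ℂ) * eft g.1 (-η))) * Complex.I_sq

theorem polyOp_coordMul {d : ℕ} (P : MvPolynomial (Fin d) ℂ) (U : Rd d → ℂ) (η : Rd d) :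
    polyOp coordMul P U η = MvPolynomial.eval (fun j => ((η j : ℝ) : ℂ)) P * U η := by
  have hpow : ∀ (j : Fin d) (n : ℕ) (V : Rd d → ℂ), (coordMul j ^ n) V η = (η j : ℂ) ^ n * V η := by
    intro j n V
    induction n with
    | zero => simp
    | succ n ih =>
      rw [pow_succ', pow_succ', mul_assoc, ← ih]
      rfl
  have hlist : ∀ (α : Fin d →₀ ℕ) (l : List (Fin d)),
      (l.map fun j => coordMul j ^ α j).prod U η = (l.map fun j => (η j : ℂ) ^ α j).prod * U η := by
    intro α l
    induction l with
    | nil => simp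
    | cons j l ih =>
      rw [List.map_cons, List.prod_cons, List.map_cons, List.prod_cons, mul_assoc, ← ih]
      exact hpow _ _ _
  unfold polyOp
  rw [LinearMap.sum_apply, Finset.sum_apply, MvPolynomial.eval_eq', Finset.sum_mul]
  refine Finset.sum_congr rfl fun α _ => ?_
  rw [LinearMap.smul_apply, Pi.smul_apply, smul_eq_mul, List.ofFn_eq_map, hlist,
    ← List.ofFn_eq_map, List.prod_ofFn, mul_assoc]

theorem FourierRep.polyOp {d : ℕ} {L : GS d →ₗ[ℂ] ℂ} {U : Rd d → ℂ} (h : FourierRep L U)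
    (P : MvPolynomial (Fin d) ℂ) : FourierRep (polyOp _root_.gsD P L)
      fun η => MvPolynomial.eval (fun j => ((η j : ℝ) : ℂ)) P * U η := by
  have h1 := polyOp_rel (D := _root_.gsD) (D' := coordMul) FourierRep FourierRep.zero
    (fun _ _ _ _ h h' => h.add h') (fun c _ _ h => h.smul c) (fun j _ _ h => h.gsD j) P h
  rwa [show _root_.polyOp coordMul P U = _ from funext (polyOp_coordMul P U)] at h1

theorem exists_realTest_eq_one_near_zero (d : ℕ) :
    ∃ χ : RealTest d, ∀ᶠ x in 𝓝 (0 : Rd d), χ x = 1 := by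
  let b : ContDiffBump (0 : Rd d) := ⟨1, 2, one_pos, one_lt_two⟩
  exact ⟨⟨b, b.contDiff, b.hasCompactSupport, by simp⟩, b.eventuallyEq_one⟩

theorem exists_norm_iteratedFDeriv_truncate_le {d : ℕ} (χ : RealTest d) (g : GS d) (N : ℕ) :
    ∃ B : ℝ, ∀ k, ∀ n ≤ N, ∀ x,
      ‖iteratedFDeriv ℝ n (truncate χ g k) x‖ ≤ B * ((1 + ‖x‖) ^ (d + 1))⁻¹ := by
  have hχ : ContDiff ℝ ∞ fun x => ((χ x : ℝ) : ℂ) := Complex.ofRealCLM.contDiff.comp χ.contDiff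
  have hχc : HasCompactSupport fun x => ((χ x : ℝ) : ℂ) :=
    χ.hasCompactSupport.comp_left (g := fun r : ℝ => (r : ℂ)) (by simp)
  obtain ⟨a, ha, hχN⟩ := exists_norm_iteratedFDeriv_le hχ hχc N
  obtain ⟨B, hB, hg⟩ := GS.exists_norm_iteratedFDeriv_le g N
  refine ⟨2 ^ N * (a * B), fun k n hn x => ?_⟩
  have hk : |((k : ℝ) + 1)⁻¹| ≤ 1 := by
    rw [abs_of_nonneg (by positivity)]
    exact inv_le_one_of_one_le₀ (by linarith [Nat.cast_nonneg (α := ℝ) k])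
  have h := norm_iteratedFDeriv_mul_le_of_le (N := N) (x := x)
    (f := fun x => ((χ (((k : ℝ) + 1)⁻¹ • x) : ℝ) : ℂ)) (g := g.1)
    (hχ.comp (contDiff_id.const_smul (((k : ℝ) + 1)⁻¹))) g.2.1
    (fun m hm => (norm_iteratedFDeriv_comp_smul_le hχ hk m x).trans (hχN m hm _))
    (fun m hm => hg m hm x) hn
  refine h.trans (le_of_eq ?_)
  ring

/-- The inversion formula is given on test functions only. It passes to `S^{1/2}_{1/2}` along the
truncations, because their transforms decay to any fixed order uniformly in `k`; the factor
`(2π)^{-d}` is absorbed in `U`. -/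
theorem BelongsToGSDual.exists_fourierRep {d : ℕ} {T : Distr d} {L : GS d →ₗ[ℂ] ℂ}
    (h : BelongsToGSDual T L) (hT : HasPolyBoundedFourier T) : ∃ U, FourierRep L U := by
  obtain ⟨U, C, l, hm, hU, hT⟩ := hT
  set c : ℂ := (((2 * Real.pi) ^ d : ℝ) : ℂ)⁻¹ with hc
  have hC : 0 ≤ C := by simpa [bracket] using (norm_nonneg _).trans (hU 0)
  have hV : ∀ η, ‖c * U η‖ ≤ ‖c‖ * C * bracket η ^ ⌈l⌉₊ := fun η => by
    rw [norm_mul, mul_assoc]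
    gcongr
    refine (hU η).trans ?_
    rw [← Real.rpow_natCast]
    gcongr
    · exact one_le_bracket η
    · exact Nat.le_ceil l
  have hVm : Measurable fun η => c * U η := hm.const_mul c
  have hcC : 0 ≤ ‖c‖ * C := by positivity
  have hpair : ∀ ψ : CplxTest d, T.pair ψ = ∫ η, c * U η * eft ψ (-η) := by
    intro ψ
    have hsm : ∀ ℓ : ℂ →L[ℝ] ℝ, ContDiff ℝ ∞ fun x => ((ℓ (ψ x) : ℝ) : ℂ) := fun ℓ =>
      Complex.ofRealCLM.contDiff.comp (ℓ.contDiff.comp ψ.contDiff)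
    have hcs : ∀ ℓ : ℂ →L[ℝ] ℝ, HasCompactSupport fun x => ((ℓ (ψ x) : ℝ) : ℂ) := fun ℓ =>
      ψ.hasCompactSupport.comp_left (g := fun z => ((ℓ z : ℝ) : ℂ)) (by simp)
    have hint : ∀ ℓ : ℂ →L[ℝ] ℝ, Integrable fun x => ((ℓ (ψ x) : ℝ) : ℂ) := fun ℓ =>
      (hsm ℓ).continuous.integrable_of_hasCompactSupport (hcs ℓ)
    have hi : ∀ ℓ : ℂ →L[ℝ] ℝ,
        Integrable fun η => c * U η * eft (fun x => ((ℓ (ψ x) : ℝ) : ℂ)) (-η) := fun ℓ => by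
      obtain ⟨C', -, hC'⟩ := exists_bracket_pow_mul_eft_le_of_hasCompactSupport (hsm ℓ) (hcs ℓ)
        (⌈l⌉₊ + (d + 1))
      exact integrable_mul_eft hVm hcC hV (hint ℓ) hC'
    have hℓ : ∀ ℓ : ℂ →L[ℝ] ℝ, T (TestFunction.postcompCLM (𝕜 := ℝ) ℓ ψ) =
        ∫ η, c * U η * eft (fun x => ((ℓ (ψ x) : ℝ) : ℂ)) (-η) := fun ℓ => by
      rw [hT, ← integral_const_mul]
      refine integral_congr_ae (Eventually.of_forall fun η => ?_)
      simp only
      rw [← mul_assoc, eft]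
      congr 2
      funext x
      rw [mul_comm, character, inner_neg_left, real_inner_comm]
      push_cast
      rw [neg_mul_neg]
      rfl
    rw [Distr.pair, hℓ, hℓ, ← integral_const_mul, ← integral_add (hi _) ((hi _).const_mul _)]
    refine integral_congr_ae (Eventually.of_forall fun η => ?_)
    have e : (ψ : Rd d → ℂ) = fun x => ((Complex.reCLM (ψ x) : ℝ) : ℂ) +
        Complex.I * ((Complex.imCLM (ψ x) : ℝ) : ℂ) := funext fun x => by
      simp only [Complex.reCLM_apply, Complex.imCLM_apply]
      conv_lhs => rw [← Complex.re_add_im (ψ x)]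
      ring
    have e2 : eft ψ (-η) = eft (fun x => ((Complex.reCLM (ψ x) : ℝ) : ℂ)) (-η) +
        Complex.I * eft (fun x => ((Complex.imCLM (ψ x) : ℝ) : ℂ)) (-η) := by
      conv_lhs => rw [e]
      rw [eft_add (hint _) ((hint _).const_mul _), eft_const_mul]
    simp only [e2]
    ring
  refine ⟨fun η => c * U η, hVm, ⟨_, _, hcC, hV⟩, fun g => ?_⟩
  obtain ⟨χ, hχ⟩ := exists_realTest_eq_one_near_zero d
  refine tendsto_nhds_unique (h.2 χ hχ g) ?_
  simp only [hpair]
  obtain ⟨C', -, hC'⟩ := exists_bracket_pow_mul_eft_le_of_decay d (⌈l⌉₊ + (d + 1))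
  obtain ⟨B, hB⟩ := exists_norm_iteratedFDeriv_truncate_le χ g (⌈l⌉₊ + (d + 1))
  refine tendsto_integral_of_dominated_convergence _ (fun k => ?_)
    ((integrable_inv_one_add_norm_pow d).const_mul _)
    (fun k => Eventually.of_forall (norm_mul_eft_le hcC hV
      (hC' (truncate χ g k) B (truncate χ g k).contDiff (hB k))))
    (Eventually.of_forall fun η => ?_)
  · exact aestronglyMeasurable_mul_eft hVm
      ((truncate χ g k).continuous.integrable_of_hasCompactSupport (truncate χ g k).hasCompactSupport)
  -- Pointwise convergence of the transforms of the truncations is the statement that the bounded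
  -- function `character (-η)` belongs to the dual.
  · have hcont : Continuous (character (-η)) := (contDiff_character (-η)).continuous
    have h1 := (belongsToGSDual_fnDistr hcont fun b hb => by
      simpa only [norm_character, one_mul] using integrable_exp_neg_mul_sq_norm hb).2 χ hχ g
    simp only [fnDistr_pair hcont] at h1
    have h2 : eft g.1 (-η) = ∫ x, character (-η) x * g.1 x := by simp only [eft, mul_comm]
    rw [h2]
    exact h1.const_mul _

/-! ### Gaussian averages of the Fourier transform -/

theorem eft_gaussianWave {d : ℕ} (x₀ : Rd d) (M : ℕ+) (ξ η : Rd d) :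
    eft (gaussianWave x₀ M ξ) (-η) = (Real.pi / (((4 * (M : ℝ))⁻¹ : ℝ) : ℂ)) ^ (d / 2 : ℂ) *
      character ξ x₀ * (character (-η) x₀ * Complex.exp ((-(M : ℝ) * ‖ξ - η‖ ^ 2 : ℝ) : ℂ)) := by
  have hM : (0 : ℝ) < M := by exact_mod_cast M.pos
  have h1 := GaussianFourier.integral_cexp_neg_mul_sq_norm_add (V := Rd d)
    (b := (((4 * (M : ℝ))⁻¹ : ℝ) : ℂ)) (by rw [Complex.ofReal_re]; positivity) (-Complex.I) (ξ - η)
  have h2 : ∀ y : Rd d, gaussianWave x₀ M ξ (y + x₀) * character (-η) (y + x₀) =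
      character ξ x₀ * character (-η) x₀ *
        Complex.exp (-(((4 * (M : ℝ))⁻¹ : ℝ) : ℂ) * (‖y‖ : ℂ) ^ 2 +
          -Complex.I * ((inner ℝ (ξ - η) y : ℝ) : ℂ)) := by
    intro y
    unfold gaussianWave character
    rw [← Complex.exp_add, ← Complex.exp_add, ← Complex.exp_add, add_sub_cancel_right]
    congr 1
    simp only [inner_add_left, inner_add_right, inner_sub_left, inner_neg_left,
      real_inner_comm ξ y, real_inner_comm ξ x₀]
    push_cast
    ring
  rw [eft, ← integral_add_right_eq_self _ x₀]
  simp_rw [h2]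
  rw [integral_const_mul, h1, finrank_euclideanSpace, Fintype.card_fin]
  have h3 : (-Complex.I) ^ 2 * (‖ξ - η‖ : ℂ) ^ 2 / (4 * (((4 * (M : ℝ))⁻¹ : ℝ) : ℂ)) =
      ((-(M : ℝ) * ‖ξ - η‖ ^ 2 : ℝ) : ℂ) := by
    have : (M : ℂ) ≠ 0 := by exact_mod_cast hM.ne'
    push_cast
    rw [neg_sq, Complex.I_sq]
    field_simp
  rw [h3]
  ring

/-- A wave has a Gaussian Fourier transform concentrated at `ξ`, with exponent `-M‖ξ - η‖²`. Up to
phases the transform of `L` is therefore a Gaussian average of `U`, more concentrated for wider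
windows. -/
theorem FourierRep.gaussianSTFT_eq {d : ℕ} {L : GS d →ₗ[ℂ] ℂ} {U : Rd d → ℂ} (h : FourierRep L U)
    (x₀ : Rd d) (M : ℕ+) (ξ : Rd d) :
    gaussianSTFT L x₀ M ξ = (Real.pi / (((4 * (M : ℝ))⁻¹ : ℝ) : ℂ)) ^ (d / 2 : ℂ) *
      character ξ x₀ * ∫ η, U (ξ - η) * character (-(ξ - η)) x₀ *
        Complex.exp ((-(M : ℝ) * ‖η‖ ^ 2 : ℝ) : ℂ) := by
  have e := integral_sub_left_eq_self (fun η => U η * character (-η) x₀ *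
    Complex.exp ((-(M : ℝ) * ‖ξ - η‖ ^ 2 : ℝ) : ℂ)) volume ξ
  simp only [sub_sub_cancel] at e
  rw [gaussianSTFT, h.2.2, e, ← integral_const_mul]
  refine integral_congr_ae (Eventually.of_forall fun η => ?_)
  simp only [eft_gaussianWave]
  ring

/-- Rescaling `η` by `M^{-1/2}` cancels the factor `M^{d/2}` of the window, so the averages have a
constant independent of `M` and the limit `M → ∞` can be taken. -/
theorem FourierRep.norm_gaussianSTFT {d : ℕ} {L : GS d →ₗ[ℂ] ℂ} {U : Rd d → ℂ}
    (h : FourierRep L U) (x₀ : Rd d) (M : ℕ+) (ξ : Rd d) :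
    ‖gaussianSTFT L x₀ M ξ‖ = (4 * Real.pi) ^ (d / 2 : ℝ) * ‖∫ η, U (ξ - (√(M : ℝ))⁻¹ • η) *
      character (-(ξ - (√(M : ℝ))⁻¹ • η)) x₀ * Complex.exp ((-‖η‖ ^ 2 : ℝ) : ℂ)‖ := by
  have hM : (0 : ℝ) < M := by exact_mod_cast M.pos
  have e := Measure.integral_comp_smul (volume : Measure (Rd d)) (fun η => U (ξ - η) *
    character (-(ξ - η)) x₀ * Complex.exp ((-(M : ℝ) * ‖η‖ ^ 2 : ℝ) : ℂ)) (√(M : ℝ))⁻¹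
  have e1 : ∀ η : Rd d, -(M : ℝ) * ‖(√(M : ℝ))⁻¹ • η‖ ^ 2 = -‖η‖ ^ 2 := by
    intro η
    rw [norm_smul, mul_pow, Real.norm_eq_abs, sq_abs, inv_pow, Real.sq_sqrt hM.le]
    field_simp
  simp only [e1] at e
  rw [e, h.gaussianSTFT_eq, norm_mul, norm_mul, norm_character, mul_one, norm_smul, ← mul_assoc]
  congr 1
  have e2 : (Real.pi / (((4 * (M : ℝ))⁻¹ : ℝ) : ℂ)) = ((4 * Real.pi * M : ℝ) : ℂ) := by
    push_cast
    rw [div_inv_eq_mul]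
    ring
  rw [e2, Complex.norm_cpow_eq_rpow_re_of_pos (by positivity), finrank_euclideanSpace,
    Fintype.card_fin, inv_pow, inv_inv, Real.norm_of_nonneg (abs_nonneg _),
    abs_of_nonneg (by positivity), Real.sqrt_eq_rpow, ← Real.rpow_natCast, ← Real.rpow_mul hM.le]
  have e3 : (d / 2 : ℂ).re = d / 2 := by simp
  rw [e3, Real.mul_rpow (by positivity) hM.le]
  congr 2
  ring

/-! ### Recovering a function from its Gaussian averages -/

theorem integrable_bracket_pow_mul_exp {d : ℕ} (l : ℕ) :
    Integrable fun w : Rd d => bracket w ^ l * Real.exp (-‖w‖ ^ 2) := by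
  obtain ⟨C, hC, hb⟩ := exists_bracket_pow_le_exp (d := d) l (κ := 1 / 2) (by norm_num)
  refine ((integrable_exp_neg_mul_sq_norm (d := d) (b := 1 / 2) (by norm_num)).const_mul C).mono'
    (Continuous.aestronglyMeasurable (by have := continuous_bracket (d := d); fun_prop))
    (Eventually.of_forall fun w => ?_)
  have := bracket_pos w
  rw [Real.norm_of_nonneg (by positivity)]
  calc _ ≤ C * Real.exp (1 / 2 * ‖w‖ ^ 2) * Real.exp (-‖w‖ ^ 2) := by gcongr; exact hb w
    _ = _ := by
      rw [mul_assoc, ← Real.exp_add]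
      ring_nf

theorem bracket_sub_le {d : ℕ} (ξ : Rd d) {t : Rd d} (ht : ‖t‖ ≤ 1) :
    bracket (ξ - t) ≤ 4 * bracket ξ := by
  have h1 := bracket_add_le ξ (-t)
  rw [bracket_neg, ← sub_eq_add_neg] at h1
  have h2 := bracket_le_one_add_norm t
  have h3 := bracket_pos ξ
  nlinarith

theorem bracket_sub_smul_le {d : ℕ} (ξ w : Rd d) {s : ℝ} (hs : |s| ≤ 1) :
    bracket (ξ - s • w) ≤ 2 * (bracket ξ * bracket w) := by
  have h1 := bracket_add_le ξ (-(s • w))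
  rw [bracket_neg, ← sub_eq_add_neg] at h1
  have h2 : bracket (s • w) ≤ bracket w := by
    have := bracket_le_of_norm_le (k := 1) le_rfl (ξ := s • w) (η := w) (by
      rw [norm_smul, one_mul]
      exact mul_le_of_le_one_left (norm_nonneg _) hs)
    linarith
  have h3 := bracket_pos ξ
  exact h1.trans (by gcongr)

theorem ContDiffBump.norm_integral_normed_mul_le {d : ℕ} (b : ContDiffBump (0 : Rd d)) {F : Rd d → ℂ}
    {K : ℝ} (hF : ∀ t, ‖t‖ < b.rOut → ‖F t‖ ≤ K) :
    ‖∫ t, (b.normed volume t : ℂ) * F t‖ ≤ K := by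
  have h1 : ‖∫ t, (b.normed volume t : ℂ) * F t‖ ≤ ∫ t, b.normed volume t * K := by
    refine norm_integral_le_of_norm_le (b.integrable_normed.mul_const K)
      (Eventually.of_forall fun t => ?_)
    rw [norm_mul, Complex.norm_real, Real.norm_of_nonneg (b.nonneg_normed t)]
    by_cases ht : ‖t‖ < b.rOut
    · exact mul_le_mul_of_nonneg_left (hF t ht) (b.nonneg_normed t)
    · have : b.normed volume t = 0 := by
        rw [← Function.notMem_support, b.support_normed_eq]
        simpa using ht
      simp [this]
  rwa [integral_mul_const, b.integral_normed, one_mul] at h1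

section heat

variable {d : ℕ} {W : Rd d → ℂ} {C : ℝ} {l : ℕ}

theorem locallyIntegrable_of_le_bracket (hm : Measurable W)
    (hW : ∀ η, ‖W η‖ ≤ C * bracket η ^ l) : LocallyIntegrable W :=
  (Continuous.locallyIntegrable (f := fun η : Rd d => C * bracket η ^ l)
    (by have := continuous_bracket (d := d); fun_prop)).mono hm.aestronglyMeasurable
    (Eventually.of_forall fun η => (hW η).trans (le_abs_self _))

/-- By Fubini, mollifying the Gaussian averages is the same as averaging the mollified function; a
bound on averages over an open set thus becomes information on a continuous function. -/
theorem integral_normed_mul_integral_exp (hm : Measurable W) (hC : 0 ≤ C)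
    (hW : ∀ η, ‖W η‖ ≤ C * bracket η ^ l) (b : ContDiffBump (0 : Rd d)) (ξ : Rd d) {s : ℝ}
    (hs : |s| ≤ 1) :
    ∫ t, (b.normed volume t : ℂ) * ∫ w, W (ξ - t - s • w) * Complex.exp ((-‖w‖ ^ 2 : ℝ) : ℂ) =
      ∫ w, (∫ t, (b.normed volume t : ℂ) * W (ξ - s • w - t)) *
        Complex.exp ((-‖w‖ ^ 2 : ℝ) : ℂ) := by
  simp_rw [← integral_const_mul, ← integral_mul_const]
  rw [integral_integral_swap]
  · refine integral_congr_ae (Eventually.of_forall fun w => ?_)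
    refine integral_congr_ae (Eventually.of_forall fun t => ?_)
    simp only
    rw [sub_right_comm, mul_assoc]
  · have hb1 : Integrable fun t : Rd d => bracket t ^ l * b.normed volume t := by
      refine Continuous.integrable_of_hasCompactSupport ?_ b.hasCompactSupport_normed.mul_left
      have := continuous_bracket (d := d)
      have := b.continuous_normed (μ := volume)
      fun_prop
    have hb2 := integrable_bracket_pow_mul_exp (d := d) l
    refine ((hb1.mul_prod hb2).const_mul (C * 4 ^ l * bracket ξ ^ l)).mono' ?_
      (Eventually.of_forall fun p => ?_)
    · have h1 : Measurable fun p : Rd d × Rd d => W (ξ - p.1 - s • p.2) :=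
        hm.comp (by fun_prop)
      have h2 : Measurable fun p : Rd d × Rd d => (b.normed volume p.1 : ℂ) :=
        (Complex.continuous_ofReal.comp
          ((b.continuous_normed (μ := volume)).comp continuous_fst)).measurable
      have h3 : Continuous fun p : Rd d × Rd d => Complex.exp ((-‖p.2‖ ^ 2 : ℝ) : ℂ) := by fun_prop
      exact (h2.mul (h1.mul h3.measurable)).aestronglyMeasurable
    · have hn := b.nonneg_normed (μ := volume) p.1
      have hbr : bracket (ξ - p.1 - s • p.2) ≤ 4 * (bracket ξ * bracket p.1 * bracket p.2) := by
        have h2 := bracket_add_le ξ (-p.1)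
        rw [bracket_neg, ← sub_eq_add_neg] at h2
        have hp1 := bracket_pos p.2
        calc _ ≤ _ := bracket_sub_smul_le (ξ - p.1) p.2 hs
          _ ≤ 2 * ((2 * (bracket ξ * bracket p.1)) * bracket p.2) := by gcongr
          _ = _ := by ring
      have hp0 := bracket_pos (ξ - p.1 - s • p.2)
      simp only [Function.uncurry]
      rw [norm_mul, norm_mul, Complex.norm_real,
        Real.norm_of_nonneg hn, Complex.norm_exp, Complex.ofReal_re]
      calc _ ≤ b.normed volume p.1 * (C * (4 * (bracket ξ * bracket p.1 * bracket p.2)) ^ l *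
            Real.exp (-‖p.2‖ ^ 2)) := by
            gcongr
            exact (hW _).trans (by gcongr)
        _ = _ := by simp only [mul_pow]; ring

theorem ContDiffBump.tendsto_integral_exp (hm : Measurable W) (hC : 0 ≤ C)
    (hW : ∀ η, ‖W η‖ ≤ C * bracket η ^ l) (b : ContDiffBump (0 : Rd d)) (hb : b.rOut ≤ 1)
    (ξ : Rd d) {s : ℕ → ℝ} (hs : ∀ i, |s i| ≤ 1) (hs0 : Tendsto s atTop (𝓝 0)) :
    Tendsto (fun i => ∫ w, (∫ t, (b.normed volume t : ℂ) * W (ξ - s i • w - t)) *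
        Complex.exp ((-‖w‖ ^ 2 : ℝ) : ℂ)) atTop
      (𝓝 (∫ w : Rd d, (∫ t, (b.normed volume t : ℂ) * W (ξ - t)) *
        Complex.exp ((-‖w‖ ^ 2 : ℝ) : ℂ))) := by
  have hcont : Continuous fun ζ => ∫ t, (b.normed volume t : ℂ) * W (ζ - t) :=
    b.hasCompactSupport_normed.continuous_convolution_left (ContinuousLinearMap.lsmul ℝ ℝ)
      b.continuous_normed (locallyIntegrable_of_le_bracket hm hW)
  have hbd : ∀ ζ, ‖∫ t, (b.normed volume t : ℂ) * W (ζ - t)‖ ≤ C * (4 * bracket ζ) ^ l := fun ζ => by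
    refine b.norm_integral_normed_mul_le fun t ht => (hW _).trans ?_
    have := bracket_pos (ζ - t)
    gcongr
    exact bracket_sub_le ζ (ht.le.trans hb)
  refine tendsto_integral_of_dominated_convergence
    (fun w => C * 8 ^ l * bracket ξ ^ l * (bracket w ^ l * Real.exp (-‖w‖ ^ 2)))
    (fun i => ?_) ((integrable_bracket_pow_mul_exp l).const_mul _)
    (fun i => Eventually.of_forall fun w => ?_) (Eventually.of_forall fun w => ?_)
  · refine Continuous.aestronglyMeasurable (Continuous.mul (hcont.comp (by fun_prop)) (by fun_prop))
  · rw [norm_mul, Complex.norm_exp, Complex.ofReal_re]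
    have h0 := bracket_pos (ξ - s i • w)
    have h2 := bracket_pos ξ
    calc _ ≤ C * (4 * (2 * (bracket ξ * bracket w))) ^ l * Real.exp (-‖w‖ ^ 2) := by
          gcongr
          refine (hbd _).trans ?_
          gcongr
          exact bracket_sub_smul_le ξ w (hs i)
      _ = _ := by
          rw [show 4 * (2 * (bracket ξ * bracket w)) = 8 * bracket ξ * bracket w by ring, mul_pow,
            mul_pow]
          ring
  · refine Tendsto.mul_const _ ((hcont.tendsto ξ).comp ?_)
    simpa using (tendsto_const_nhds (x := ξ)).sub (hs0.smul_const w)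

/-- A function whose Gaussian averages decay uniformly on an open set decays there. -/
theorem exists_ae_norm_mul_bracket_pow_le (hm : Measurable W) (hC : 0 ≤ C)
    (hW : ∀ η, ‖W η‖ ≤ C * bracket η ^ l) {Γ : Set (Rd d)} (hΓ : IsOpen Γ) {s : ℕ → ℝ}
    (hs : ∀ i, |s i| ≤ 1) (hs0 : Tendsto s atTop (𝓝 0)) {n : ℕ} {B : ℝ}
    (h : ∀ᶠ i in atTop, ∀ ξ ∈ Γ,
      ‖∫ w, W (ξ - s i • w) * Complex.exp ((-‖w‖ ^ 2 : ℝ) : ℂ)‖ * bracket ξ ^ n ≤ B) :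
    ∃ C', ∀ᵐ ξ, ξ ∈ Γ → ‖W ξ‖ * bracket ξ ^ n ≤ C' := by
  set J : ℂ := ∫ w : Rd d, Complex.exp ((-‖w‖ ^ 2 : ℝ) : ℂ) with hJ
  have hJ0 : 0 < ‖J‖ := by
    have h1 := GaussianFourier.integral_cexp_neg_mul_sq_norm_add (V := Rd d) (b := 1) (by simp) 0 0
    have h2 : J = (Real.pi : ℂ) ^ (d / 2 : ℂ) := by
      simpa [hJ, finrank_euclideanSpace] using h1
    rw [h2, Complex.norm_cpow_eq_rpow_re_of_pos Real.pi_pos]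
    exact Real.rpow_pos_of_pos Real.pi_pos _
  -- Mollification makes `W` continuous, so its averages converge at every point to `J` times its
  -- value. The factor `4 ^ n` comes from `⟨ξ⟩ ≤ 4⟨ξ - t⟩` for `‖t‖ ≤ 1`.
  have hkey : ∀ (b : ContDiffBump (0 : Rd d)) (ξ : Rd d), b.rOut ≤ 1 → Metric.ball ξ b.rOut ⊆ Γ →
      ‖∫ t, (b.normed volume t : ℂ) * W (ξ - t)‖ ≤ B * 4 ^ n / ‖J‖ / bracket ξ ^ n := by
    intro b ξ hb hξ
    have hbp := bracket_pos ξ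
    have h1 := (b.tendsto_integral_exp hm hC hW hb ξ hs hs0).norm
    rw [integral_const_mul, norm_mul] at h1
    rw [div_div, le_div_iff₀ (by positivity), ← mul_assoc, ← le_div_iff₀ (by positivity)]
    refine le_of_tendsto h1 ?_
    filter_upwards [h] with i hi
    rw [← integral_normed_mul_integral_exp hm hC hW b ξ (hs i)]
    refine b.norm_integral_normed_mul_le fun t ht => ?_
    have ht' : ξ - t ∈ Γ := hξ (by simpa [Metric.mem_ball, dist_eq_norm] using ht)
    have h2 := hi _ ht'
    have h3 : bracket ξ ≤ 4 * bracket (ξ - t) := by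
      simpa using bracket_sub_le (ξ - t) (t := -t) (by rw [norm_neg]; exact ht.le.trans hb)
    rw [le_div_iff₀ (by positivity)]
    calc _ ≤ _ * (4 * bracket (ξ - t)) ^ n := by gcongr
      _ = (_ * bracket (ξ - t) ^ n) * 4 ^ n := by rw [mul_pow]; ring
      _ ≤ _ := by gcongr
  refine ⟨B * 4 ^ n / ‖J‖, ?_⟩
  let b : ℕ → ContDiffBump (0 : Rd d) := fun i =>
    ⟨((i : ℝ) + 1)⁻¹ / 2, ((i : ℝ) + 1)⁻¹, by positivity, half_lt_self (by positivity)⟩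
  have hb0 : Tendsto (fun i => (b i).rOut) atTop (𝓝 0) := by
    simpa using tendsto_one_div_add_atTop_nhds_zero_nat (𝕜 := ℝ)
  -- The bound on the mollified functions is independent of the bump, and by Lebesgue
  -- differentiation they tend to `W` almost everywhere as the bumps shrink.
  filter_upwards [ContDiffBump.ae_convolution_tendsto_right_of_locallyIntegrable (K := 2) hb0
    (Eventually.of_forall fun i => by simp only [b]; linarith)
    (locallyIntegrable_of_le_bracket hm hW)] with ξ hξ hξΓ
  have hbp := bracket_pos ξ
  obtain ⟨ε, hε, hεΓ⟩ := Metric.isOpen_iff.1 hΓ ξ hξΓ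
  rw [← le_div_iff₀ (by positivity)]
  refine le_of_tendsto hξ.norm ?_
  filter_upwards [hb0.eventually_lt_const hε] with i hi
  refine hkey (b i) ξ ?_ ((Metric.ball_subset_ball hi.le).trans hεΓ)
  exact inv_le_one_of_one_le₀ (by linarith [Nat.cast_nonneg (α := ℝ) i])

end heat

/-! ### Microlocal ellipticity -/

theorem MvPolynomial.IsHomogeneous.eval_mul {d k : ℕ} {Q : MvPolynomial (Fin d) ℂ}
    (hQ : Q.IsHomogeneous k) (t : ℂ) (z : Fin d → ℂ) :
    MvPolynomial.eval (fun j => t * z j) Q = t ^ k * MvPolynomial.eval z Q := by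
  rw [MvPolynomial.eval_eq', MvPolynomial.eval_eq', Finset.mul_sum]
  refine Finset.sum_congr rfl fun α hα => ?_
  have h1 : ∑ j, α j = k := by
    have := hQ (MvPolynomial.mem_support_iff.1 hα)
    rw [← this]
    simp [Finsupp.weight_apply, Finsupp.sum_fintype]
  simp only [mul_pow]
  rw [Finset.prod_mul_distrib, Finset.prod_pow_eq_pow_sum, h1]
  ring

theorem MvPolynomial.eval_mul_eq_sum {d : ℕ} (P : MvPolynomial (Fin d) ℂ) (t : ℂ) (z : Fin d → ℂ) :
    MvPolynomial.eval (fun j => t * z j) P = ∑ k ∈ Finset.range (P.totalDegree + 1),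
      t ^ k * MvPolynomial.eval z (MvPolynomial.homogeneousComponent k P) := by
  conv_lhs => rw [← P.sum_homogeneousComponent, map_sum]
  exact Finset.sum_congr rfl fun k _ =>
    (MvPolynomial.homogeneousComponent_isHomogeneous k P).eval_mul t z

/-- Homogenize: `P(ξ) = t^m Q(1/t, ξ/t)` with `Q(τ, ζ) = ∑ τ^{m-k} P_k(ζ)` continuous and `Q(0, ξ₀)
= P_m(ξ₀) ≠ 0`. For `ξ` in a narrow cone and `t` large, the argument of `Q` is close to `(0, ξ₀)`.
-/
theorem exists_le_norm_eval {d : ℕ} (P : MvPolynomial (Fin d) ℂ) {ξ₀ : Rd d}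
    (h : MvPolynomial.eval (fun j => ((ξ₀ j : ℝ) : ℂ))
      (MvPolynomial.homogeneousComponent P.totalDegree P) ≠ 0) :
    ∃ r R c : ℝ, 0 < r ∧ 0 < c ∧ ∀ ξ ∈ coneOver ξ₀ r, R ≤ ‖ξ‖ →
      c ≤ ‖MvPolynomial.eval (fun j => ((ξ j : ℝ) : ℂ)) P‖ := by
  set m := P.totalDegree with hm
  let Q : ℝ × Rd d → ℂ := fun p => ∑ k ∈ Finset.range (m + 1), (p.1 : ℂ) ^ (m - k) *
    MvPolynomial.eval (fun j => ((p.2 j : ℝ) : ℂ)) (MvPolynomial.homogeneousComponent k P)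
  have hQc : Continuous Q := by
    refine continuous_finsetSum _ fun k _ => Continuous.mul (by fun_prop) ?_
    refine (MvPolynomial.continuous_eval _).comp (continuous_pi fun j => ?_)
    exact (continuous_coord j).comp continuous_snd
  have hQ0 : Q (0, ξ₀) ≠ 0 := by
    have : Q (0, ξ₀) = MvPolynomial.eval (fun j => ((ξ₀ j : ℝ) : ℂ))
        (MvPolynomial.homogeneousComponent m P) := by
      simp only [Q, Finset.sum_range_succ, Nat.sub_self, pow_zero, one_mul]
      rw [Finset.sum_eq_zero, zero_add]
      intro k hk
      have := Finset.mem_range.1 hk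
      rw [Complex.ofReal_zero, zero_pow (by omega), zero_mul]
    rwa [this]
  set c := ‖Q (0, ξ₀)‖ / 2 with hc
  have hc0 : 0 < c := by have := norm_pos_iff.2 hQ0; positivity
  have hev : ∀ᶠ p in 𝓝 ((0 : ℝ), ξ₀), c < ‖Q p‖ :=
    hQc.norm.continuousAt.eventually_const_lt (by have := norm_pos_iff.2 hQ0; rw [hc]; linarith)
  obtain ⟨δ, hδ, hball⟩ := Metric.eventually_nhds_iff_ball.1 hev
  -- In the cone `‖ξ‖ < t (‖ξ₀‖ + δ)`, so this radius forces `t > 1 + 1/δ`: then `1/t < δ` and also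
  -- `t^m ≥ 1`.
  refine ⟨δ, (1 + δ⁻¹) * (‖ξ₀‖ + δ), c, hδ, hc0, fun ξ ⟨t, ht, hξ⟩ hR => ?_⟩
  have htR : 1 + δ⁻¹ < t := by
    have h1 : ‖ξ‖ < t * (‖ξ₀‖ + δ) := by
      have h2 : ‖ξ‖ ≤ ‖ξ - t • ξ₀‖ + ‖t • ξ₀‖ := by simpa using norm_add_le (ξ - t • ξ₀) (t • ξ₀)
      rw [norm_smul, Real.norm_of_nonneg ht.le] at h2
      linarith
    exact lt_of_mul_lt_mul_right (hR.trans_lt h1) (by positivity)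
  have hδi : 0 < δ⁻¹ := inv_pos.2 hδ
  have hmem : (t⁻¹, t⁻¹ • ξ) ∈ Metric.ball ((0 : ℝ), ξ₀) δ := by
    rw [Metric.mem_ball, Prod.dist_eq, max_lt_iff]
    constructor
    · rw [Real.dist_eq, sub_zero, abs_of_pos (inv_pos.2 ht)]
      exact inv_lt_of_inv_lt₀ hδ (by linarith)
    · rw [dist_eq_norm]
      have e : t⁻¹ • ξ - ξ₀ = t⁻¹ • (ξ - t • ξ₀) := by
        rw [smul_sub, smul_smul, inv_mul_cancel₀ ht.ne', one_smul]
      rw [e, norm_smul, Real.norm_of_nonneg (inv_pos.2 ht).le, inv_mul_lt_iff₀ ht]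
      exact hξ
  have hcQ := hball _ hmem
  have htc : (t : ℂ) ≠ 0 := by exact_mod_cast ht.ne'
  have e : MvPolynomial.eval (fun j => ((ξ j : ℝ) : ℂ)) P = (t : ℂ) ^ m * Q (t⁻¹, t⁻¹ • ξ) := by
    have e1 : (fun j => ((ξ j : ℝ) : ℂ)) = fun j => (t : ℂ) * (((t⁻¹ • ξ) j : ℝ) : ℂ) := by
      funext j
      simp only [PiLp.smul_apply, smul_eq_mul]
      push_cast
      rw [mul_inv_cancel_left₀ htc]
    rw [e1, MvPolynomial.eval_mul_eq_sum, ← hm]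
    simp only [Q, Finset.mul_sum]
    refine Finset.sum_congr rfl fun k hk => ?_
    have hk' := Finset.mem_range_succ_iff.1 hk
    rw [← mul_assoc]
    congr 1
    push_cast
    rw [inv_pow, ← div_eq_mul_inv, eq_div_iff (pow_ne_zero _ htc), ← pow_add]
    congr 1
    omega
  rw [e, norm_mul, norm_pow, Complex.norm_real, Real.norm_of_nonneg ht.le]
  calc c ≤ 1 * ‖Q (t⁻¹, t⁻¹ • ξ)‖ := by rw [one_mul]; exact hcQ.le
    _ ≤ _ := by
      gcongr
      exact one_le_pow₀ (by linarith)

/-- For fixed `n` the bound `C^{n+1} n^{sn}` does not depend on `N`. As `N → ∞` the averages over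
Gaussians of size `(vN)^{-1/2}` concentrate, and the bound passes to `W` up to a constant. -/
theorem FourierRep.exists_ae_le_of_gevreyEstimate {d : ℕ} {L : GS d →ₗ[ℂ] ℂ} {W : Rd d → ℂ}
    (h : FourierRep L W) {s : ℝ} {x₀ ξ₀ : Rd d} (hL : GevreyEstimate s L x₀ ξ₀) :
    ∃ Γ, IsConeNhd Γ ξ₀ ∧ ∀ n, ∃ C, ∀ᵐ ξ, ξ ∈ Γ → ‖W ξ‖ * bracket ξ ^ n ≤ C := by
  obtain ⟨Γ, ho, hcone, hξ, v, N₀, A, hA, hest⟩ := hL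
  refine ⟨Γ, ⟨ho, hcone, hξ⟩, fun n => ?_⟩
  obtain ⟨C, l, hC, hW⟩ := h.2.1
  set K : ℝ := (4 * Real.pi) ^ (d / 2 : ℝ) with hK
  have hK0 : 0 < K := Real.rpow_pos_of_pos (by positivity) _
  let M : ℕ → ℕ+ := fun i => v * i.succPNat
  have hM : ∀ i : ℕ, (i : ℝ) + 1 ≤ (M i : ℝ) := fun i => by
    have h1 : (1 : ℝ) ≤ v := by exact_mod_cast one_le (a := v)
    have h2 : ((M i : ℕ) : ℝ) = v * ((i : ℝ) + 1) := by simp [M]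
    rw [h2]
    nlinarith [Nat.cast_nonneg (α := ℝ) i]
  have hs1 : ∀ i, |(√(M i : ℝ))⁻¹| ≤ 1 := fun i => by
    rw [abs_of_nonneg (by positivity)]
    refine inv_le_one_of_one_le₀ (Real.one_le_sqrt.2 ?_)
    linarith [hM i, Nat.cast_nonneg (α := ℝ) i]
  have hs0 : Tendsto (fun i => (√(M i : ℝ))⁻¹) atTop (𝓝 0) := by
    refine tendsto_inv_atTop_zero.comp (Real.tendsto_sqrt_atTop.comp ?_)
    exact tendsto_atTop_mono (fun i => (by linarith [hM i] : (i : ℝ) ≤ (M i : ℝ)))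
      tendsto_natCast_atTop_atTop
  have hm : Measurable fun η => W η * character (-η) x₀ :=
    h.1.mul (continuous_character.comp (by fun_prop : Continuous fun η : Rd d => (-η, x₀))).measurable
  obtain ⟨C', hC'⟩ := exists_ae_norm_mul_bracket_pow_le hm hC
    (fun η => by rw [norm_mul, norm_character, mul_one]; exact hW η) ho hs1 hs0 (n := n)
    (B := A ^ (n + 1) * (n : ℝ) ^ (s * n) / K) (by
      filter_upwards [eventually_ge_atTop (n + N₀)] with i hi ξ hξ
      have h1 := hest ξ hξ i.succPNat (by
        rw [← PNat.coe_lt_coe, Nat.succPNat_coe]; omega) n (by rw [Nat.succPNat_coe]; omega)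
      have hb := bracket_pos ξ
      rw [le_div_iff₀ (by positivity), h.norm_gaussianSTFT] at h1
      rw [le_div_iff₀ hK0]
      calc _ = _ := by ring
        _ ≤ _ := h1)
  refine ⟨C', ?_⟩
  filter_upwards [hC'] with ξ hξ hξΓ
  simpa only [norm_mul, norm_character, mul_one] using hξ hξΓ

/-- The transform is a Gaussian average of a polynomially bounded function that decays in `Γ`, so it
decays in a smaller cone. -/
theorem FourierRep.rapidAt {d : ℕ} {L : GS d →ₗ[ℂ] ℂ} {U : Rd d → ℂ} (h : FourierRep L U)
    (x₀ : Rd d) {ξ₀ : Rd d} {Γ : Set (Rd d)} (hΓ : IsConeNhd Γ ξ₀)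
    (hU : ∀ n, ∃ C, ∀ᵐ ξ, ξ ∈ Γ → ‖U ξ‖ * bracket ξ ^ n ≤ C) : RapidAt L x₀ ξ₀ := by
  obtain ⟨Γ', c, hΓ', hc, hc2, hsub⟩ := hΓ.exists_shrink
  refine ⟨Γ', hΓ', fun M n => ?_⟩
  have hM : (0 : ℝ) < M := by exact_mod_cast M.pos
  obtain ⟨C₁, hC₁⟩ := hU n
  obtain ⟨C, l, hC, hUl⟩ := h.2.1
  classical
  -- The decay of `U` is known only almost everywhere. Setting the function to zero on the
  -- exceptional set gives pointwise bounds without changing the integrals.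
  let V : Rd d → ℂ := fun ξ =>
    if ξ ∈ Γ → ‖U ξ‖ * bracket ξ ^ n ≤ C₁ then U ξ * character (-ξ) x₀ else 0
  have hVU : V =ᵐ[volume] fun ξ => U ξ * character (-ξ) x₀ := by
    filter_upwards [hC₁] with ξ hξ
    exact if_pos hξ
  have hVn : ∀ ξ, ‖V ξ‖ ≤ ‖U ξ‖ := fun ξ => by
    simp only [V]
    split_ifs
    · rw [norm_mul, norm_character, mul_one]
    · simp
  obtain ⟨C₂, hC₂, hV⟩ := exists_gaussian_mul_shift_le (F := V) hc hc2 hsub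
    (fun ε hε => by
      obtain ⟨K, hK, hb⟩ := exists_bracket_pow_le_exp (d := d) l hε
      refine ⟨C * K, by positivity, fun ξ => (hVn ξ).trans ((hUl ξ).trans ?_)⟩
      rw [mul_assoc]
      gcongr
      exact hb ξ)
    (n := n) (C₁ := |C₁|) (abs_nonneg _)
    (fun ξ hξ => by
      by_cases hcase : ξ ∈ Γ → ‖U ξ‖ * bracket ξ ^ n ≤ C₁
      · have := bracket_pos ξ
        exact (mul_le_mul_of_nonneg_right (hVn ξ) (by positivity)).trans
          ((hcase hξ).trans (le_abs_self _))
      · simp [V, hcase])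
    hM
  have hi := integrable_exp_neg_mul_sq_norm (d := d) (b := (M : ℝ) / 2) (by positivity)
  refine ⟨‖(Real.pi / (((4 * (M : ℝ))⁻¹ : ℝ) : ℂ)) ^ (d / 2 : ℂ)‖ *
    ∫ η : Rd d, C₂ * Real.exp (-((M : ℝ) / 2) * ‖η‖ ^ 2), fun ξ hξ => ?_⟩
  rw [h.gaussianSTFT_eq, norm_mul, norm_mul, norm_character, mul_one, mul_assoc]
  refine mul_le_mul_of_nonneg_left ?_ (norm_nonneg _)
  have hb := bracket_pos ξ
  rw [← le_div_iff₀ (by positivity), div_eq_inv_mul, ← integral_const_mul]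
  refine norm_integral_le_of_norm_le ((hi.const_mul _).const_mul _) ?_
  have hqm := (Measure.measurePreserving_sub_left (volume : Measure (Rd d)) ξ).quasiMeasurePreserving
  filter_upwards [hqm.ae hVU] with η hη
  rw [← hη, norm_mul, Complex.norm_exp, Complex.ofReal_re, ← div_eq_inv_mul,
    le_div_iff₀ (by positivity)]
  calc _ = _ := by ring
    _ ≤ _ := hV ξ hξ η

/-- The product `P U` decays almost everywhere in a cone; dividing by `|P| ≥ c` settles large `ξ`,
and for bounded `ξ` the polynomial bound on `U` is enough. -/
theorem IsSuitableExtension.rapidAt_of_polyOp {d : ℕ} {u T : Distr d} {L : GS d →ₗ[ℂ] ℂ}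
    {s : ℝ} {x₀ ξ₀ : Rd d} (h : IsSuitableExtension u x₀ T L) (hT : HasPolyBoundedFourier T)
    {P : MvPolynomial (Fin d) ℂ} (hP : GevreyEstimate s (polyOp gsD P L) x₀ ξ₀)
    (hell : MvPolynomial.eval (fun j => ((ξ₀ j : ℝ) : ℂ))
      (MvPolynomial.homogeneousComponent P.totalDegree P) ≠ 0) : RapidAt L x₀ ξ₀ := by
  obtain ⟨U, hU⟩ := h.1.exists_fourierRep hT
  obtain ⟨Γ, hΓ, hdec⟩ := (hU.polyOp P).exists_ae_le_of_gevreyEstimate hP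
  obtain ⟨r, R, c, hr, hc, hPc⟩ := exists_le_norm_eval P hell
  refine hU.rapidAt x₀ (hΓ.inter (isConeNhd_coneOver ξ₀ hr)) fun n => ?_
  obtain ⟨C₁, hC₁⟩ := hdec n
  obtain ⟨C, l, hC, hUl⟩ := hU.2.1
  refine ⟨max (C₁ / c) (C * (1 + |R|) ^ (l + n)), ?_⟩
  filter_upwards [hC₁] with ξ hξ hmem
  have hb := bracket_pos ξ
  rcases le_total R ‖ξ‖ with hR | hR
  · refine le_max_of_le_left ?_
    rw [le_div_iff₀ hc]
    have h1 := hPc ξ hmem.2 hR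
    have h2 := hξ hmem.1
    rw [norm_mul] at h2
    calc ‖U ξ‖ * bracket ξ ^ n * c
        ≤ ‖U ξ‖ * bracket ξ ^ n * ‖MvPolynomial.eval (fun j => ((ξ j : ℝ) : ℂ)) P‖ := by gcongr
      _ = _ := by ring
      _ ≤ _ := h2
  · refine le_max_of_le_right ?_
    have h1 : bracket ξ ≤ 1 + |R| :=
      (bracket_le_one_add_norm ξ).trans (by linarith [le_abs_self R])
    calc ‖U ξ‖ * bracket ξ ^ n ≤ C * bracket ξ ^ l * bracket ξ ^ n := by gcongr; exact hUl ξ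
      _ = C * bracket ξ ^ (l + n) := by rw [pow_add, mul_assoc]
      _ ≤ _ := by gcongr

/-! ### The second inclusion and the theorem -/

theorem WFs_subset_WFsP_union_CharSet {d : ℕ} (P : MvPolynomial (Fin d) ℂ) (u : Distr d) {s : ℝ}
    (hs : 0 ≤ s) : WFs s u ⊆ WFsP s P u ∪ CharSet P := by
  rintro ⟨x₀, ξ₀⟩ ⟨hξ, hno⟩
  by_cases hell : MvPolynomial.eval (fun j => ((ξ₀ j : ℝ) : ℂ))
      (MvPolynomial.homogeneousComponent P.totalDegree P) = 0
  · exact Or.inr ⟨hξ, hell⟩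
  · refine Or.inl ⟨hξ, fun ⟨_, T, L, hTL, hT, hP⟩ => hno ?_⟩
    exact hTL.exists_gevreyEstimate hξ (hTL.rapidAt_of_polyOp hT hP hell) hs

theorem theorem4 (d : ℕ) (P : MvPolynomial (Fin d) ℂ) (u : Distr d) (s : ℝ)
    (hs : 1 / 2 ≤ s) (hs' : s < 1) :
    WFs s (PDu P u) ⊆ WFs s u ∧ WFs s u ⊆ WFsP s P u ∪ CharSet P := by
  have hs₀ : 0 ≤ s := by linarith
  exact ⟨WFs_PDu_subset P u hs₀, WFs_subset_WFsP_union_CharSet P u hs₀⟩
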